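/- Let $k$ be an algebraically closed field. A quasi-projective variety is a reduced (not necessarily irreducible) $k$-scheme that is isomorphic over $k$ to a locally closed subscheme of some projective space $\mathbb P^n_k$. For a scheme $W$, the cohomological dimension $\mathrm{cd}(W)$ is the least $n$ such that $H^t(W,\mathcal F)=0$ for all quasi-coherent sheaves $\mathcal F$ on $W$ and all $t>n$ (with $\mathrm{cd}(\emptyset)=-\infty$). For a subset $W\subseteq X$, $\mathrm{codim}_X(W)=\inf_{x\in W}\dim\mathcal O_{X,x}$ (with $\mathrm{codim}_X(\emptyset)=\infty$). A locally closed subset $W\subseteq X$, with its reduced scheme structure, is called a local complete intersection (lci) in $X$ if every point of $W$ has a neighbourhood in $X$ on which the ideal sheaf of $W$ is generated by $\mathrm{codim}_X(W)$ sections. Let $X$ be a quasi-projective variety over $k$, let $$\emptyset=Z_0\subseteq Z_1\subseteq\dots\subseteq Z_r=X\qquad(r\ge 1)$$ be closed subsets, and let $Y_1,\dots,Y_r$ be quasi-projective varieties over $k$. Assume that $(Z_\bullet,Y_\bullet)$ is an lci affine bundle stratification of $X$, that is: for $j=2,\dots,r$ the stratum $Z_j\setminus Z_{j-1}$ is lci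 in $X$; and for $j=1,\dots,r$ there is an affine morphism $f_j:Z_j\setminus Z_{j-1}\to Y_j$ over $k$, where $Z_j\setminus Z_{j-1}$ carries its reduced scheme structure. Then $$\mathrm{cd}(X\setminus Z_1)\ \le\ \max_{2\le j\le r}\bigl\{\mathrm{cd}(Y_j)+\mathrm{codim}_X(Z_j\setminus Z_{j-1})\bigr\},$$ where the maximum of the empty family is $-\infty$ and $-\infty+\infty=-\infty$. -/

import Mathlib

universe u

open CategoryTheory AlgebraicGeometry TopologicalSpace

noncomputable section

namespace CdLci

/-! ### Projective space and quasi-projective varieties -/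

attribute [local instance] MvPolynomial.gradedAlgebra

/-- The `n`-dimensional projective space `ℙⁿ = Proj k[x₀, …, xₙ]` over a field `k`. -/
def projectiveSpace (k : Type u) [Field k] (n : ℕ) : Scheme.{u} :=
  Proj (MvPolynomial.homogeneousSubmodule (Fin (n + 1)) k)

/-- The structure morphism `ℙⁿ ⟶ Spec k`. -/
def projectiveSpaceHom (k : Type u) [Field k] (n : ℕ) :
    projectiveSpace k n ⟶ Spec (.of k) :=
  Proj.toSpecZero (MvPolynomial.homogeneousSubmodule (Fin (n + 1)) k) ≫
    Spec.map (CommRingCat.ofHom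
      (algebraMap k (MvPolynomial.homogeneousSubmodule (Fin (n + 1)) k 0)))

/-- A `k`-scheme `s : X ⟶ Spec k` is a quasi-projective variety if it is reduced and is isomorphic,
over `k`, to a locally closed subscheme of some projective space `ℙⁿ`.
Varieties are not required to be irreducible. -/
structure IsQuasiProjectiveVariety (k : Type u) [Field k] {X : Scheme.{u}}
    (s : X ⟶ Spec (.of k)) : Prop where
  isReduced : AlgebraicGeometry.IsReduced X
  exists_immersion : ∃ (n : ℕ) (i : X ⟶ projectiveSpace k n),
    IsImmersion i ∧ i ≫ projectiveSpaceHom k n = s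

/-! ### Cohomological dimension -/

/-- Abelian sheaves on a topological space have enough injectives, so that their
`Ext`-groups (and hence sheaf cohomology) live in the universe `u`. -/
instance hasExtSheaf (X : TopCat.{u}) :
    HasExt.{u} (Sheaf (Opens.grothendieckTopology X) AddCommGrpCat.{u}) :=
  hasExt_of_enoughInjectives _

/-- The sheaf cohomology group `Hᵗ(X, F)` of (the abelian sheaf underlying) a sheaf of
`𝒪_X`-modules `F`. -/
def cohomology {X : Scheme.{u}} (F : X.Modules) (t : ℕ) : Type u :=
  Sheaf.H ((SheafOfModules.toSheaf X.ringCatSheaf).obj F) t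

/-- The cohomological dimension `cd(W)`: the least `n` such that `Hᵗ(W, F) = 0` for all
quasi-coherent sheaves `F` on `W` and all `t > n`. It takes values in `WithBot ℕ∞`, where it is
`⊥` if and only if `W` is empty. -/
def cd (W : Scheme.{u}) : WithBot ℕ∞ :=
  sInf {n | ∀ F : W.Modules, F.IsQuasicoherent →
    ∀ t : ℕ, n < (t : WithBot ℕ∞) → Subsingleton (cohomology F t)}

/-! ### Codimension, strata and local complete intersections -/

/-- The codimension of a subset `W` of `X`: the infimum over `x ∈ W` of the dimension of the local
ring `𝒪_{X,x}`, which is the coheight of `x` for the specialization order of `X`.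
The empty set has codimension `⊤`. -/
def codim {X : Scheme.{u}} (W : Set X) : ℕ∞ :=
  ⨅ x ∈ W, Order.coheight x

variable {X : Scheme.{u}} (A B : Closeds X)

/-- The open subset `X \ B` of the scheme `X`, for `B` closed. -/
def closedCompl : X.Opens := B.compl

/-- The ideal sheaf of `A \ B`, with its reduced structure, in the open subscheme `X \ B`. -/
def stratumIdeal : (closedCompl B).toScheme.IdealSheafData :=
  Scheme.IdealSheafData.vanishingIdeal
    (A.preimage (closedCompl B).ι.continuous)

/-- The locally closed subset `A \ B` of `X`, as a scheme with its reduced structure. -/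
def stratum : Scheme.{u} := (stratumIdeal A B).subscheme

/-- The inclusion of `A \ B` in `X`. -/
def stratumι : stratum A B ⟶ X :=
  (stratumIdeal A B).subschemeι ≫ (closedCompl B).ι

/-- `A \ B` is a local complete intersection in `X`: around each of its points, its ideal sheaf
is generated by `c` sections, where `c` is the codimension of `A \ B` in `X`. -/
def IsLci : Prop :=
  ∀ x : (closedCompl B).toScheme, x.1 ∈ A →
    ∃ V : (closedCompl B).toScheme.affineOpens, x ∈ V.1 ∧
      ∃ c : ℕ, (c : ℕ∞) = codim ((A : Set X) \ B) ∧
        ∃ g : Fin c → Γ((closedCompl B).toScheme, V.1),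
          (stratumIdeal A B).ideal V = Ideal.span (Set.range g)

end CdLci

open CdLci

/-- `(Z_•, Y_•)` is an lci affine bundle stratification of the `k`-scheme `s : X ⟶ Spec k`.
The filtration is `∅ = Z 0 ⊆ Z 1 ⊆ … ⊆ Z r = X`. The index `j : Fin r` stands for the `(j + 1)`-st
stratum `Z_{j+1} \ Z_j`, which maps to the variety `Y_{j+1}`, written `Y j` below, whose structure
morphism is `t j`. -/
structure IsLciAffineBundleStratification (k : Type u) [Field k] {X : Scheme.{u}}
    (s : X ⟶ Spec (.of k)) {r : ℕ} (Z : Fin (r + 1) → Closeds X)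
    (Y : Fin r → Scheme.{u}) (t : ∀ j, Y j ⟶ Spec (.of k)) : Prop where
  eq_bot : Z 0 = ⊥
  monotone : Monotone Z
  eq_top : Z (Fin.last r) = ⊤
  isQuasiProjectiveVariety : ∀ j, IsQuasiProjectiveVariety k (t j)
  isLci : ∀ j : Fin r, 1 ≤ (j : ℕ) → IsLci (Z j.succ) (Z j.castSucc)
  exists_isAffineHom : ∀ j : Fin r, ∃ f : stratum (Z j.succ) (Z j.castSucc) ⟶ Y j,
    f ≫ t j = stratumι (Z j.succ) (Z j.castSucc) ≫ s ∧ IsAffineHom f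

end

open CdLci

/-!
Removing the strata one at a time, by descending induction on `j`, reduces the bound to the
following: if `Z ⊆ X` is closed, locally cut out by `c` equations, and affine over `Y`, then
`Hᵗ(X \ Z, F) = 0` implies `Hᵗ(X, F) = 0` for `F` quasi-coherent and `t > cd Y + c`.

A quasi-coherent module supported on `Z` is exhausted by its submodules killed by powers of the
ideal of `Z`; the graded pieces are modules on `Z`, and pushing them forward along the affine map to
`Y` shows that their cohomology vanishes in degrees above `cd Y`. On the other hand `X \ Z` is
locally a union of `c` affine open subsets, so that `F` has no cohomology in degrees `q ≥ c` on
small open subsets of `X \ Z`. If `c = 1`, then `Hᵗ(X, j_* j^* F) = Hᵗ(X \ Z, F)` for the inclusion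
`j` of `X \ Z`, and `F ⟶ j_* j^* F` is an isomorphism up to modules supported on `Z`. The cokernel
of the map from `F` to the degree zero term of its Čech complex on `X \ Z` satisfies the same
hypotheses with `c` and `t` decreased by one, which replaces the spectral sequence of local
cohomology by an induction on `c`.
-/

noncomputable section

namespace CdLci

open Opposite Limits Abelian

/-! ### Abelian sheaves on a topological space -/

/-- Sheaves of abelian groups on a topological space. -/
abbrev AbSheaf (T : TopCat.{u}) := Sheaf (Opens.grothendieckTopology T) AddCommGrpCat.{u}

section AbSheaf

variable {T : TopCat.{u}} {F G H : AbSheaf T}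

/-- Restriction of sections of an abelian sheaf. -/
def res (F : AbSheaf T) {V U : Opens T} (h : V ≤ U) :
    F.obj.obj (op U) →+ F.obj.obj (op V) := (F.obj.map (homOfLE h).op).hom

/-- The action of a morphism of abelian sheaves on sections. -/
def secMap (φ : F ⟶ G) (U : Opens T) : F.obj.obj (op U) →+ G.obj.obj (op U) :=
  (φ.hom.app (op U)).hom

@[simp]
lemma res_self (F : AbSheaf T) {U : Opens T} (x : F.obj.obj (op U)) : res F le_rfl x = x := by
  change F.obj.map (𝟙 _) x = x
  rw [F.obj.map_id]; rfl

@[simp]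
lemma res_res (F : AbSheaf T) {W V U : Opens T} (h : W ≤ V) (h' : V ≤ U) (x : F.obj.obj (op U)) :
    res F h (res F h' x) = res F (h.trans h') x := by
  change (F.obj.map _ ≫ F.obj.map _) x = _
  rw [← F.obj.map_comp]; rfl

lemma secMap_res (φ : F ⟶ G) {V U : Opens T} (h : V ≤ U) (x : F.obj.obj (op U)) :
    secMap φ V (res F h x) = res G h (secMap φ U x) :=
  congr($(φ.hom.naturality (homOfLE h).op) x)

lemma secMap_comp (φ : F ⟶ G) (ψ : G ⟶ H) (U : Opens T) (x : F.obj.obj (op U)) :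
    secMap (φ ≫ ψ) U x = secMap ψ U (secMap φ U x) := rfl

lemma AbSheaf.hom_ext {φ ψ : F ⟶ G} (h : ∀ U x, secMap φ U x = secMap ψ U x) : φ = ψ := by
  apply Sheaf.hom_ext
  ext U x
  exact h U.unop x

lemma AbSheaf.eq_of_locally_eq (F : AbSheaf T) {ι : Type*} {U : Opens T} (V : ι → Opens T)
    (hV : ∀ i, V i ≤ U) (hU : U ≤ ⨆ i, V i) {x y : F.obj.obj (op U)}
    (h : ∀ i, res F (hV i) x = res F (hV i) y) : x = y :=
  TopCat.Sheaf.eq_of_locally_eq' F V U (fun i ↦ homOfLE (hV i)) hU x y h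

lemma AbSheaf.exists_glue (F : AbSheaf T) {ι : Type*} {U : Opens T} (V : ι → Opens T)
    (hV : ∀ i, V i ≤ U) (hU : U ≤ ⨆ i, V i) (s : ∀ i, F.obj.obj (op (V i)))
    (h : ∀ i j, res F (inf_le_left : V i ⊓ V j ≤ V i) (s i) =
      res F (inf_le_right : V i ⊓ V j ≤ V j) (s j)) :
    ∃ x : F.obj.obj (op U), ∀ i, res F (hV i) x = s i :=
  (TopCat.Sheaf.existsUnique_gluing' F V U (fun i ↦ homOfLE (hV i)) hU s h).exists

lemma injective_secMap_of_mono (φ : F ⟶ G) [Mono φ] (U : Opens T) :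
    Function.Injective (secMap φ U) := by
  have : Mono ((sheafToPresheaf _ _).map φ) := inferInstance
  have := (NatTrans.mono_iff_mono_app _).mp this (op U)
  exact (AddCommGrpCat.mono_iff_injective _).mp this

lemma mono_of_injective_secMap (φ : F ⟶ G) (h : ∀ U x, secMap φ U x = 0 → x = 0) : Mono φ := by
  refine ⟨fun a b hab ↦ AbSheaf.hom_ext fun U x ↦ ?_⟩
  rw [← sub_eq_zero]
  apply h
  rw [map_sub, ← secMap_comp, ← secMap_comp, hab, sub_self]

lemma epi_iff_locally_surjective (φ : F ⟶ G) :
    Epi φ ↔ ∀ U z, ∀ p ∈ U, ∃ (V : Opens T) (h : V ≤ U) (x : F.obj.obj (op V)),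
      p ∈ V ∧ secMap φ V x = res G h z := by
  rw [← Sheaf.isLocallySurjective_iff_epi']
  refine (TopCat.Presheaf.isLocallySurjective_iff φ.hom).trans ?_
  constructor
  · intro H U z p hp
    obtain ⟨V, h, ⟨x, hx⟩, hpV⟩ := H U z p hp
    exact ⟨V, h, x, hpV, hx⟩
  · intro H U z p hp
    obtain ⟨V, h, x, hpV, hx⟩ := H U z p hp
    exact ⟨V, h, ⟨x, hx⟩, hpV⟩

/-- Left exact sequences `0 ⟶ F ⟶ G ⟶ H` of abelian sheaves, in terms of sections. -/
structure IsLeftExact (φ : F ⟶ G) (ψ : G ⟶ H) : Prop where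
  inj : ∀ U x, secMap φ U x = 0 → x = 0
  zero : ∀ U x, secMap ψ U (secMap φ U x) = 0
  exact : ∀ U x, secMap ψ U x = 0 → ∃ y, secMap φ U y = x

/-- Short exact sequences `0 ⟶ F ⟶ G ⟶ H ⟶ 0` of abelian sheaves, in terms of sections. -/
structure IsShortExact (φ : F ⟶ G) (ψ : G ⟶ H) : Prop extends IsLeftExact φ ψ where
  surj : ∀ U z, ∀ p ∈ U, ∃ (V : Opens T) (h : V ≤ U) (x : G.obj.obj (op V)),
    p ∈ V ∧ secMap ψ V x = res H h z

lemma IsLeftExact.comp_eq_zero {φ : F ⟶ G} {ψ : G ⟶ H} (h : IsLeftExact φ ψ) : φ ≫ ψ = 0 :=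
  AbSheaf.hom_ext fun U x ↦ h.zero U x

lemma IsShortExact.of_shortExact {S : ShortComplex (AbSheaf T)} (hS : S.ShortExact) :
    IsShortExact S.f S.g where
  inj U x hx := by
    have := hS.mono_f
    exact injective_secMap_of_mono S.f U (hx.trans (map_zero _).symm)
  zero U x := by rw [← secMap_comp, S.zero]; rfl
  exact U x hx := TopCat.Sheaf.sections_exact_of_left_exact hS.exact hS.mono_f x hx
  surj := (epi_iff_locally_surjective S.g).mp hS.epi_g

lemma IsShortExact.shortExact {φ : F ⟶ G} {ψ : G ⟶ H} (h : IsShortExact φ ψ) :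
    (ShortComplex.mk φ ψ h.comp_eq_zero).ShortExact := by
  have hmono : Mono φ := mono_of_injective_secMap φ h.inj
  refine .mk' ?_ hmono ((epi_iff_locally_surjective ψ).mpr h.surj)
  rw [ShortComplex.exact_iff_epi_kernel_lift, epi_iff_locally_surjective]
  intro U z p hp
  obtain ⟨y, hy⟩ := h.exact U (secMap (kernel.ι ψ) U z) <| by
    rw [← secMap_comp, kernel.condition]; rfl
  refine ⟨U, le_rfl, y, hp, injective_secMap_of_mono (kernel.ι ψ) U ?_⟩
  rw [← secMap_comp, res_self, ← hy, kernel.lift_ι]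

lemma IsLeftExact.isShortExact_factorThruImage {φ : F ⟶ G} {ψ : G ⟶ H} (h : IsLeftExact φ ψ) :
    IsShortExact φ (Abelian.factorThruImage ψ) := by
  have secMap_ι (U : Opens T) (y) : secMap (Abelian.image.ι ψ) U
      (secMap (Abelian.factorThruImage ψ) U y) = secMap ψ U y := by
    rw [← secMap_comp, Abelian.image.fac]
  have inj (U : Opens T) := injective_secMap_of_mono (Abelian.image.ι ψ) U
  refine ⟨⟨h.inj, fun U x ↦ inj U ?_, fun U y hy ↦ h.exact U y ?_⟩,
    (epi_iff_locally_surjective _).mp inferInstance⟩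
  · rw [secMap_ι, map_zero, h.zero]
  · rw [← secMap_ι, hy, map_zero]

/-! ### Cohomology over open subsets -/

/-- The abelian sheaf representing sections over `U`. -/
abbrev freeSheaf (U : Opens T) : AbSheaf T :=
  (presheafToSheaf (Opens.grothendieckTopology T) AddCommGrpCat.{u}).obj
    (yoneda.obj U ⋙ AddCommGrpCat.free)

/-- The morphism between the sheaves representing sections which corepresents restriction. -/
abbrev freeSheafMap {V U : Opens T} (h : V ≤ U) : freeSheaf V ⟶ freeSheaf U :=
  (presheafToSheaf (Opens.grothendieckTopology T) AddCommGrpCat.{u}).map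
    (Functor.whiskerRight (yoneda.map (homOfLE h)) AddCommGrpCat.free)

/-- The universal property of the sheaf representing sections over `U`. -/
def freeSheafEquiv (U : Opens T) (F : AbSheaf T) : (freeSheaf U ⟶ F) ≃ F.obj.obj (op U) :=
  ((sheafificationAdjunction _ _).homEquiv _ F).trans
    (((AddCommGrpCat.adj.whiskerRight (Opens T)ᵒᵖ).homEquiv (yoneda.obj U) F.obj).trans
      (yonedaEquiv (F := F.obj ⋙ forget AddCommGrpCat)))

lemma freeSheafEquiv_comp (U : Opens T) (a : freeSheaf U ⟶ F) (φ : F ⟶ G) :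
    freeSheafEquiv U G (a ≫ φ) = secMap φ U (freeSheafEquiv U F a) := by
  simp only [freeSheafEquiv, Equiv.trans_apply]
  rw [Adjunction.homEquiv_naturality_right, Adjunction.homEquiv_naturality_right,
    yonedaEquiv_comp]
  rfl

lemma freeSheafEquiv_symm_secMap (U : Opens T) (φ : F ⟶ G) (x : F.obj.obj (op U)) :
    (freeSheafEquiv U G).symm (secMap φ U x) = (freeSheafEquiv U F).symm x ≫ φ := by
  rw [Equiv.symm_apply_eq, freeSheafEquiv_comp, Equiv.apply_symm_apply]

lemma freeSheafEquiv_map {V U : Opens T} (h : V ≤ U) (a : freeSheaf U ⟶ F) :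
    freeSheafEquiv V F (freeSheafMap h ≫ a) = res F h (freeSheafEquiv U F a) := by
  simp only [freeSheafEquiv, Equiv.trans_apply]
  rw [Adjunction.homEquiv_naturality_left]
  erw [Adjunction.homEquiv_naturality_left]
  exact (yonedaEquiv_naturality (F := F.obj ⋙ forget AddCommGrpCat) _ (homOfLE h)).symm

lemma freeSheafMap_comp {W V U : Opens T} (h : W ≤ V) (h' : V ≤ U) :
    freeSheafMap h ≫ freeSheafMap h' = freeSheafMap (h.trans h') := by
  rw [← Functor.map_comp, ← Functor.whiskerRight_comp, ← Functor.map_comp]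
  rfl

instance freeSheafMap_mono {V U : Opens T} (h : V ≤ U) : Mono (freeSheafMap h) := by
  have : Mono (Functor.whiskerRight (yoneda.map (homOfLE h)) AddCommGrpCat.free.{u}) := by
    apply +allowSynthFailures NatTrans.mono_of_mono_app
  infer_instance

/-- The vanishing of the cohomology group `Hⁿ(U, F)`. -/
def Vanishes (n : ℕ) (U : Opens T) (F : AbSheaf T) : Prop :=
  Subsingleton (Ext (freeSheaf U) F n)

variable {n : ℕ} {U V : Opens T}

lemma vanishes_iff : Vanishes n U F ↔ ∀ x : Ext (freeSheaf U) F n, x = 0 :=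
  ⟨fun h _ ↦ h.elim _ _, fun h ↦ ⟨fun x y ↦ (h x).trans (h y).symm⟩⟩

lemma Vanishes.of_iso (e : F ≅ G) (h : Vanishes n U F) : Vanishes n U G := by
  rw [vanishes_iff] at *
  intro x
  have : (x.comp (Ext.mk₀ e.inv) (add_zero n)).comp (Ext.mk₀ e.hom) (add_zero n) = x := by simp
  rw [← this, h (x.comp _ _), Ext.zero_comp]

lemma vanishes_zero_iff : Vanishes 0 U F ↔ Subsingleton (F.obj.obj (op U)) :=
  (Equiv.subsingleton_congr Ext.homEquiv₀).trans
    (Equiv.subsingleton_congr (freeSheafEquiv U F))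

/-- The sheaf representing global sections is the constant sheaf `ℤ`. -/
def freeSheafTopIso : freeSheaf ⊤ ≅
    (constantSheaf (Opens.grothendieckTopology T) AddCommGrpCat.{u}).obj
      (AddCommGrpCat.of (ULift ℤ)) :=
  let e (G : AbSheaf T) :=
    (((constantSheafAdj (Opens.grothendieckTopology T) AddCommGrpCat.{u}
      isTerminalTop).homAddEquiv _ G).trans (AddCommGrpCat.uliftZMultiplesAddEquiv _)).toEquiv.trans
      (freeSheafEquiv ⊤ G).symm
  Coyoneda.ext _ _ (fun {G} ↦ (e G).symm) (fun {G} ↦ e G) (fun {G} ↦ (e G).apply_symm_apply)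
    (fun {G} ↦ (e G).symm_apply_apply) fun {G G'} a φ ↦ by
      apply (freeSheafEquiv ⊤ G').injective
      rw [freeSheafEquiv_comp]
      simp only [e, Equiv.trans_apply, Equiv.apply_symm_apply]
      rfl

lemma subsingleton_H_iff_vanishes (F : AbSheaf T) (n : ℕ) :
    Subsingleton (F.H n) ↔ Vanishes n ⊤ F :=
  (((extFunctor n).mapIso freeSheafTopIso.op).app F).addCommGroupIsoToAddEquiv.subsingleton_congr

lemma vanishes_sup (hU : Vanishes (n + 1) U F) (hV : Vanishes (n + 1) V F)
    (hUV : Vanishes n (U ⊓ V) F) : Vanishes (n + 1) (U ⊔ V) F := by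
  let S := Opens.mayerVietorisSquare U V
  have h₁ : Subsingleton (Ext (freeSheaf U) F (n + 1)) := hU
  have h₂ : Subsingleton (Ext (freeSheaf V) F (n + 1)) := hV
  refine vanishes_iff.mpr fun x ↦ ?_
  have h₃ : Subsingleton (Ext (freeSheaf U ⊞ freeSheaf V) F (n + 1)) :=
    Ext.biprodAddEquiv.toEquiv.subsingleton
  obtain ⟨y, hy⟩ := Ext.contravariant_sequence_exact₃ S.shortComplex_shortExact F x
    (h₃.elim _ _) (add_comm 1 n)
  have hy0 : y = 0 := vanishes_iff.mp hUV y
  subst hy0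
  exact hy.symm.trans (Ext.comp_zero ..)

lemma vanishes_bot (n : ℕ) (F : AbSheaf T) : Vanishes n ⊥ F := by
  have id_eq_zero : 𝟙 (freeSheaf (⊥ : Opens T)) = 0 :=
    (freeSheafEquiv ⊥ _).injective <| AbSheaf.eq_of_locally_eq _ (ι := Empty) (fun _ ↦ ⊥)
      (fun _ ↦ le_rfl) bot_le nofun
  refine vanishes_iff.mpr fun x ↦ ?_
  rw [← Ext.mk₀_id_comp x, id_eq_zero, Ext.mk₀_zero, Ext.zero_comp]

/-! ### The long exact sequence -/

/-- The restriction map `Hⁿ(U, F) ⟶ Hⁿ(V, F)` for `V ≤ U`. -/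
def resExt (h : V ≤ U) (x : Ext (freeSheaf U) F n) : Ext (freeSheaf V) F n :=
  (Ext.mk₀ (freeSheafMap h)).comp x (zero_add n)

lemma resExt_comp (h : V ≤ U) {m k : ℕ} (x : Ext (freeSheaf U) F n) (y : Ext F G m)
    (hk : n + m = k) : resExt h (x.comp y hk) = (resExt h x).comp y hk :=
  (Ext.comp_assoc _ _ _ (zero_add n) hk (by omega)).symm

lemma resExt_resExt {W : Opens T} (h : W ≤ V) (h' : V ≤ U) (x : Ext (freeSheaf U) F n) :
    resExt h (resExt h' x) = resExt (h.trans h') x := by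
  simp only [resExt]
  rw [← Ext.comp_assoc _ _ _ (zero_add 0) (zero_add n) (by omega), Ext.mk₀_comp_mk₀,
    freeSheafMap_comp]

@[simp]
lemma resExt_zero (h : V ≤ U) : resExt h (0 : Ext (freeSheaf U) F n) = 0 := Ext.comp_zero ..

namespace IsShortExact

variable {φ : F ⟶ G} {ψ : G ⟶ H} (h : IsShortExact φ ψ)

/-- The connecting map `H⁰(U, H) ⟶ H¹(U, F)` of a short exact sequence. -/
def conn (z : H.obj.obj (op U)) : Ext (freeSheaf U) F 1 :=
  (Ext.mk₀ ((freeSheafEquiv U H).symm z)).comp h.shortExact.extClass (zero_add 1)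

lemma exists_conn_eq (x : Ext (freeSheaf U) F 1) (hx : x.comp (Ext.mk₀ φ) (add_zero 1) = 0) :
    ∃ z, h.conn z = x := by
  obtain ⟨y, rfl⟩ := Ext.covariant_sequence_exact₁ (freeSheaf U) h.shortExact x hx (zero_add 1)
  obtain ⟨b, rfl⟩ := (Ext.mk₀_bijective _ _).surjective y
  exact ⟨freeSheafEquiv U H b, by rw [conn, Equiv.symm_apply_apply]⟩

lemma conn_eq_zero_iff (z : H.obj.obj (op U)) : h.conn z = 0 ↔ ∃ y, secMap ψ U y = z := by
  constructor
  · intro hz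
    obtain ⟨x, hx⟩ := Ext.covariant_sequence_exact₃ (freeSheaf U) h.shortExact
      (Ext.mk₀ ((freeSheafEquiv U H).symm z)) (zero_add 1) hz
    obtain ⟨a, rfl⟩ := (Ext.mk₀_bijective _ _).surjective x
    refine ⟨freeSheafEquiv U G a, (freeSheafEquiv U H).symm.injective ?_⟩
    apply (Ext.mk₀_bijective _ _).injective
    rw [← hx, ← freeSheafEquiv_comp, Equiv.symm_apply_apply, ← Ext.mk₀_comp_mk₀]
  · rintro ⟨s, rfl⟩
    have comp_extClass : (Ext.mk₀ ψ).comp h.shortExact.extClass (zero_add 1) = 0 :=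
      h.shortExact.comp_extClass
    rw [conn, freeSheafEquiv_symm_secMap, ← Ext.mk₀_comp_mk₀,
      Ext.comp_assoc _ _ _ (zero_add 0) (zero_add 1) (by rfl), comp_extClass, Ext.comp_zero]

lemma resExt_conn (hVU : V ≤ U) (z : H.obj.obj (op U)) :
    resExt hVU (h.conn z) = h.conn (res H hVU z) := by
  rw [conn, resExt_comp, conn, resExt, Ext.mk₀_comp_mk₀]
  congr 2
  apply (freeSheafEquiv V H).injective
  rw [freeSheafEquiv_map, Equiv.apply_symm_apply, Equiv.apply_symm_apply]

include h

lemma surjective_of_vanishes (hF : Vanishes 1 U F) : Function.Surjective (secMap ψ U) :=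
  fun z ↦ (h.conn_eq_zero_iff z).mp (vanishes_iff.mp hF _)

lemma vanishes_one_left (hs : Function.Surjective (secMap ψ U)) (hG : Vanishes 1 U G) :
    Vanishes 1 U F := by
  refine vanishes_iff.mpr fun x ↦ ?_
  obtain ⟨z, rfl⟩ := h.exists_conn_eq x (vanishes_iff.mp hG _)
  exact (h.conn_eq_zero_iff z).mpr (hs z)

lemma vanishes_left (hH : Vanishes n U H) (hG : Vanishes (n + 1) U G) : Vanishes (n + 1) U F := by
  refine vanishes_iff.mpr fun x ↦ ?_
  obtain ⟨y, rfl⟩ := Ext.covariant_sequence_exact₁ (freeSheaf U) h.shortExact x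
    (vanishes_iff.mp hG _) rfl
  rw [vanishes_iff.mp hH y, Ext.zero_comp]

lemma vanishes_mid (hF : Vanishes n U F) (hH : Vanishes n U H) : Vanishes n U G := by
  refine vanishes_iff.mpr fun x ↦ ?_
  obtain ⟨y, rfl⟩ := Ext.covariant_sequence_exact₂ (freeSheaf U) h.shortExact x
    (vanishes_iff.mp hH _)
  rw [vanishes_iff.mp hF y, Ext.zero_comp]

lemma vanishes_right (hG : Vanishes n U G) (hF : Vanishes (n + 1) U F) : Vanishes n U H := by
  refine vanishes_iff.mpr fun x ↦ ?_
  obtain ⟨y, rfl⟩ := Ext.covariant_sequence_exact₃ (freeSheaf U) h.shortExact x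
    rfl (vanishes_iff.mp hF _)
  rw [vanishes_iff.mp hG y, Ext.zero_comp]

end IsShortExact

/-! ### Flasque sheaves -/

lemma surjective_res_of_isFlasque (F : AbSheaf T) [TopCat.Sheaf.IsFlasque F] (h : V ≤ U) :
    Function.Surjective (res F h) :=
  (AddCommGrpCat.epi_iff_surjective _).mp (TopCat.Presheaf.IsFlasque.epi (homOfLE h).op)

instance isFlasque_of_injective (F : AbSheaf T) [Injective F] : TopCat.Sheaf.IsFlasque F where
  epi {U V} i := (AddCommGrpCat.epi_iff_surjective _).mpr fun x ↦ by
    let extension := Injective.factorThru ((freeSheafEquiv V.unop F).symm x)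
      (freeSheafMap (leOfHom i.unop))
    refine ⟨freeSheafEquiv U.unop F extension, ?_⟩
    refine (freeSheafEquiv_map (leOfHom i.unop) extension).symm.trans ?_
    rw [Injective.comp_factorThru, Equiv.apply_symm_apply]

lemma exists_isShortExact_injective (F : AbSheaf T) :
    ∃ (I Q : AbSheaf T) (φ : F ⟶ I) (ψ : I ⟶ Q), IsShortExact φ ψ ∧ Injective I :=
  ⟨_, _, Injective.ι F, cokernel.π (Injective.ι F), .of_shortExact
    (S := .mk _ _ (cokernel.condition (Injective.ι F)))
    (.mk' (ShortComplex.exact_of_g_is_cokernel _ (cokernelIsCokernel _)) inferInstance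
      inferInstance), inferInstance⟩

lemma IsShortExact.isFlasque_right {φ : F ⟶ G} {ψ : G ⟶ H} (h : IsShortExact φ ψ)
    [TopCat.Sheaf.IsFlasque F] [TopCat.Sheaf.IsFlasque G] : TopCat.Sheaf.IsFlasque H :=
  TopCat.Sheaf.IsFlasque.of_shortExact_of_isFlasque₁₂ h.shortExact

lemma vanishes_of_isFlasque (F : AbSheaf T) [TopCat.Sheaf.IsFlasque F] (hn : 1 ≤ n)
    (U : Opens T) : Vanishes n U F := by
  have vanishes_of_injective (I : AbSheaf T) [Injective I] (n : ℕ) : Vanishes (n + 1) U I :=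
    vanishes_iff.mpr fun x ↦ Ext.eq_zero_of_injective x
  induction n, hn using Nat.le_induction generalizing F with
  | base =>
    obtain ⟨I, Q, φ, ψ, h, _⟩ := exists_isShortExact_injective F
    exact h.vanishes_one_left ((AddCommGrpCat.epi_iff_surjective _).mp
      (TopCat.Sheaf.IsFlasque.epi_of_shortExact h.shortExact)) (vanishes_of_injective I 0)
  | succ n _ ih =>
    obtain ⟨I, Q, φ, ψ, h, _⟩ := exists_isShortExact_injective F
    have := h.isFlasque_right
    exact h.vanishes_left (ih Q) (vanishes_of_injective I n)

lemma exists_isShortExact_isFlasque (F : AbSheaf T) :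
    ∃ (I Q : AbSheaf T) (φ : F ⟶ I) (ψ : I ⟶ Q),
      IsShortExact φ ψ ∧ TopCat.Sheaf.IsFlasque I := by
  obtain ⟨I, Q, φ, ψ, h, _⟩ := exists_isShortExact_injective F
  exact ⟨I, Q, φ, ψ, h, inferInstance⟩

lemma IsShortExact.vanishes_one_iff {φ : F ⟶ G} {ψ : G ⟶ H} (h : IsShortExact φ ψ)
    [TopCat.Sheaf.IsFlasque G] (U : Opens T) :
    Vanishes 1 U F ↔ Function.Surjective (secMap ψ U) :=
  ⟨h.surjective_of_vanishes, fun hs ↦ h.vanishes_one_left hs (vanishes_of_isFlasque G le_rfl U)⟩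

lemma IsShortExact.vanishes_succ_iff {φ : F ⟶ G} {ψ : G ⟶ H} (h : IsShortExact φ ψ)
    [TopCat.Sheaf.IsFlasque G] (U : Opens T) (hn : 1 ≤ n) :
    Vanishes (n + 1) U F ↔ Vanishes n U H :=
  ⟨h.vanishes_right (vanishes_of_isFlasque G hn U),
    fun hs ↦ h.vanishes_left hs (vanishes_of_isFlasque G (by omega) U)⟩

lemma exists_resExt_eq_zero (hn : 1 ≤ n) (x : Ext (freeSheaf U) F n) {p : T} (hp : p ∈ U) :
    ∃ (V : Opens T) (h : V ≤ U), p ∈ V ∧ resExt h x = 0 := by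
  induction n, hn using Nat.le_induction generalizing F with
  | base =>
    obtain ⟨I, Q, φ, ψ, h, _⟩ := exists_isShortExact_isFlasque F
    obtain ⟨z, rfl⟩ := h.exists_conn_eq x (vanishes_iff.mp (vanishes_of_isFlasque I le_rfl U) _)
    obtain ⟨V, hV, y, hpV, hy⟩ := h.surj U z p hp
    exact ⟨V, hV, hpV, by rw [h.resExt_conn, h.conn_eq_zero_iff]; exact ⟨y, hy⟩⟩
  | succ n hn ih =>
    obtain ⟨I, Q, φ, ψ, h, _⟩ := exists_isShortExact_isFlasque F
    obtain ⟨y, rfl⟩ := Ext.covariant_sequence_exact₁ (freeSheaf U) h.shortExact x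
      (vanishes_iff.mp (vanishes_of_isFlasque I (by omega) U) _) rfl
    obtain ⟨V, hV, hpV, hy⟩ := ih y
    exact ⟨V, hV, hpV, by rw [resExt_comp, hy, Ext.zero_comp]⟩

end AbSheaf

/-! ### Comparison of cohomology along a functor between open subsets -/

section Comparison

variable {T T' : TopCat.{u}} (θ : Opens T ⥤ Opens T')
  [θ.IsContinuous (Opens.grothendieckTopology T) (Opens.grothendieckTopology T')]

/-- The functor on abelian sheaves given by precomposition with a continuous functor between open
subsets: direct images and restrictions to open subspaces are special cases. -/
abbrev precomp : AbSheaf T' ⥤ AbSheaf T :=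
  θ.sheafPushforwardContinuous AddCommGrpCat.{u} (Opens.grothendieckTopology T)
    (Opens.grothendieckTopology T')

instance isFlasque_precomp (F : AbSheaf T') [TopCat.Sheaf.IsFlasque F] :
    TopCat.Sheaf.IsFlasque ((precomp θ).obj F) where
  epi i := TopCat.Presheaf.IsFlasque.epi (F := F.obj) (θ.op.map i)

variable {F G H : AbSheaf T'} {φ : F ⟶ G} {ψ : G ⟶ H} {n : ℕ}

lemma IsLeftExact.precomp (h : IsLeftExact φ ψ) :
    IsLeftExact ((precomp θ).map φ) ((precomp θ).map ψ) :=
  ⟨fun _ _ hx ↦ h.inj _ _ hx, fun _ _ ↦ h.zero _ _, fun _ _ hx ↦ h.exact _ _ hx⟩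

lemma vanishes_precomp_iff (P : AbSheaf T' → Prop)
    (hP : ∀ {F I Q : AbSheaf T'} {φ : F ⟶ I} {ψ : I ⟶ Q}, IsShortExact φ ψ →
      TopCat.Sheaf.IsFlasque I → P F →
        P Q ∧ IsShortExact ((precomp θ).map φ) ((precomp θ).map ψ))
    (hF : P F) (hn : 1 ≤ n) (U : Opens T) :
    Vanishes n U ((precomp θ).obj F) ↔ Vanishes n (θ.obj U) F := by
  induction n, hn using Nat.le_induction generalizing F with
  | base =>
    obtain ⟨I, Q, φ, ψ, h, hI⟩ := exists_isShortExact_isFlasque F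
    rw [h.vanishes_one_iff, (hP h hI hF).2.vanishes_one_iff]
    rfl
  | succ n hn ih =>
    obtain ⟨I, Q, φ, ψ, h, hI⟩ := exists_isShortExact_isFlasque F
    obtain ⟨hQ, h'⟩ := hP h hI hF
    rw [h.vanishes_succ_iff _ hn, h'.vanishes_succ_iff _ hn, ih hQ]

lemma vanishes_restrict_iff (j : T ⟶ T') (hj : Topology.IsOpenEmbedding j)
    [hj.isOpenMap.functor.IsContinuous (Opens.grothendieckTopology T)
      (Opens.grothendieckTopology T')] (F : AbSheaf T') (hn : 1 ≤ n) (U : Opens T) :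
    Vanishes n U ((precomp hj.isOpenMap.functor).obj F) ↔
      Vanishes n (hj.isOpenMap.functor.obj U) F := by
  refine vanishes_precomp_iff _ (fun _ ↦ True)
    (fun {F I Q φ ψ} h _ _ ↦ ⟨trivial, h.precomp _, ?_⟩) trivial hn U
  intro U z p hp
  obtain ⟨V, hV, x, hpV, hx⟩ := h.surj _ z (j p) ⟨p, hp, rfl⟩
  have image_le : hj.isOpenMap.functor.obj ((Opens.map j).obj V) ≤ V := by
    rintro _ ⟨q, hq, rfl⟩; exact hq
  have preimage_le : (Opens.map j).obj V ≤ U := by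
    intro q hq
    obtain ⟨q', hq', h⟩ := hV hq
    rwa [← hj.injective h]
  refine ⟨(Opens.map j).obj V, preimage_le, res I image_le x, hpV, ?_⟩
  refine (secMap_res ψ image_le x).trans ?_
  rw [hx]
  exact res_res _ _ _ _

section Basis

variable {B : Set (Opens T)} (hB : Opens.IsBasis B)
include hB

lemma IsShortExact.precomp_of_basis (h : IsShortExact φ ψ)
    (hF : ∀ V ∈ B, Vanishes 1 (θ.obj V) F) :
    IsShortExact ((precomp θ).map φ) ((precomp θ).map ψ) := by
  refine ⟨h.precomp θ, fun U z p hp ↦ ?_⟩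
  obtain ⟨V, hV, hpV, hVU⟩ := Opens.isBasis_iff_nbhd.mp hB hp
  obtain ⟨x, hx⟩ := h.surjective_of_vanishes (hF V hV) (res ((precomp θ).obj H) hVU z)
  exact ⟨V, hVU, x, hpV, hx⟩

lemma vanishes_precomp_iff_of_basis (hF : ∀ V ∈ B, ∀ n, 1 ≤ n → Vanishes n (θ.obj V) F)
    (hn : 1 ≤ n) (U : Opens T) :
    Vanishes n U ((precomp θ).obj F) ↔ Vanishes n (θ.obj U) F :=
  vanishes_precomp_iff θ (fun F ↦ ∀ V ∈ B, ∀ n, 1 ≤ n → Vanishes n (θ.obj V) F)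
    (fun h _ hF ↦ ⟨fun V hV n hn ↦ (h.vanishes_succ_iff _ hn).mp (hF V hV (n + 1) (by omega)),
      h.precomp_of_basis θ hB fun V hV ↦ hF V hV 1 le_rfl⟩) hF hn U

omit hB in
lemma injective_res_precomp (F : AbSheaf T') {V U : Opens T} (hVU : V ≤ U)
    (hθ : θ.obj U ≤ θ.obj V) : Function.Injective (res ((precomp θ).obj F) hVU) := by
  have res_res_eq (q : F.obj.obj (op (θ.obj U))) :
      res F hθ (res F (leOfHom (θ.map (homOfLE hVU))) q) = q := by rw [res_res, res_self]
  exact Function.LeftInverse.injective res_res_eq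

omit hB in
lemma eq_zero_of_resExt_precomp_eq_zero_of_one {V U : Opens T} (hVU : V ≤ U)
    (hθ : θ.obj U ≤ θ.obj V) (x : Ext (freeSheaf U) ((precomp θ).obj F) 1)
    (hx : resExt hVU x = 0) : x = 0 := by
  obtain ⟨I, Q, φ, ψ, h, hI⟩ := exists_isShortExact_isFlasque F
  have h' := (h.precomp θ).isShortExact_factorThruImage
  obtain ⟨z, rfl⟩ := h'.exists_conn_eq x
    (vanishes_iff.mp (vanishes_of_isFlasque _ le_rfl U) _)
  rw [h'.resExt_conn, h'.conn_eq_zero_iff] at hx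
  obtain ⟨e, he⟩ := hx
  obtain ⟨e, rfl⟩ := surjective_res_of_isFlasque _ hVU e
  refine (h'.conn_eq_zero_iff z).mpr ⟨e, ?_⟩
  apply injective_secMap_of_mono (Abelian.image.ι ((precomp θ).map ψ)) U
  apply injective_res_precomp θ Q hVU hθ
  rw [← secMap_res, ← secMap_res, ← secMap_res, he]

/-- The comparison map `Hⁿ(U, precomp θ F) ⟶ Hⁿ(θ U, F)` is injective, as `n` is the first degree in
which the higher direct images of `F` are allowed to contribute. -/
lemma eq_zero_of_resExt_precomp_eq_zero (hn : 1 ≤ n)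
    (hF : ∀ V ∈ B, ∀ s, 1 ≤ s → s < n → Vanishes s (θ.obj V) F) {V U : Opens T} (hVU : V ≤ U)
    (hθ : θ.obj U ≤ θ.obj V) (x : Ext (freeSheaf U) ((precomp θ).obj F) n)
    (hx : resExt hVU x = 0) : x = 0 := by
  induction n, hn using Nat.le_induction generalizing F with
  | base => exact eq_zero_of_resExt_precomp_eq_zero_of_one θ hVU hθ x hx
  | succ n hn ih =>
    obtain ⟨I, Q, φ, ψ, h, hI⟩ := exists_isShortExact_isFlasque F
    have h' := h.precomp_of_basis θ hB fun W hW ↦ hF W hW 1 le_rfl (by omega)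
    obtain ⟨y, rfl⟩ := Ext.covariant_sequence_exact₁ (freeSheaf U) h'.shortExact x
      (vanishes_iff.mp (vanishes_of_isFlasque _ (by omega) U) _) rfl
    rw [resExt_comp] at hx
    obtain ⟨w, hw⟩ := Ext.covariant_sequence_exact₃ (freeSheaf V) h'.shortExact _ rfl hx
    rw [vanishes_iff.mp (vanishes_of_isFlasque _ hn V) w, Ext.zero_comp] at hw
    have hQ (W) (hW : W ∈ B) (s) (hs : 1 ≤ s) (hsn : s < n) : Vanishes s (θ.obj W) Q :=
      (h.vanishes_succ_iff _ hs).mp (hF W hW (s + 1) (by omega) (by omega))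
    rw [ih hQ y hw.symm, Ext.zero_comp]

end Basis

end Comparison

/-! ### Sheaves of modules on schemes -/

/-- The forgetful functor from sheaves of modules to abelian sheaves. -/
abbrev abF (X : Scheme.{u}) : X.Modules ⥤ AbSheaf X.toTopCat :=
  SheafOfModules.toSheaf X.ringCatSheaf

instance (X : Scheme.{u}) : (abF X).Faithful :=
  inferInstanceAs (SheafOfModules.toSheaf X.ringCatSheaf).Faithful

instance (X : Scheme.{u}) : (abF X).Additive :=
  inferInstanceAs (SheafOfModules.toSheaf X.ringCatSheaf).Additive

instance (X : Scheme.{u}) : PreservesFiniteLimits (abF X) :=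
  inferInstanceAs (PreservesFiniteLimits (SheafOfModules.toSheaf X.ringCatSheaf))

section Modules

variable {X : Scheme.{u}}

/-- The abelian sheaf underlying a sheaf of modules. -/
abbrev ab (M : X.Modules) : AbSheaf X.toTopCat := (abF X).obj M

/-- The sections of a sheaf of modules over an open subset. -/
abbrev Sec (M : X.Modules) (U : X.Opens) : Type u := (ab M).obj.obj (op U)

/-- The map induced on sections by a morphism of sheaves of modules. -/
abbrev homSec {M N : X.Modules} (φ : M ⟶ N) (U : X.Opens) : Sec M U →+ Sec N U :=
  secMap ((abF X).map φ) U

instance moduleSec (M : X.Modules) (U : X.Opens) : Module Γ(X, U) (Sec M U) :=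
  inferInstanceAs (Module Γ(X, U) Γ(M, U))

/-- Restriction of regular functions. -/
def resRing {V U : X.Opens} (h : V ≤ U) : Γ(X, U) →+* Γ(X, V) := (X.presheaf.map (homOfLE h).op).hom

@[simp]
lemma resRing_resRing {W V U : X.Opens} (h : W ≤ V) (h' : V ≤ U) (r : Γ(X, U)) :
    resRing h (resRing h' r) = resRing (h.trans h') r := by
  change (X.presheaf.map _ ≫ X.presheaf.map _) r = _
  rw [← X.presheaf.map_comp]; rfl

@[simp]
lemma resRing_self {U : X.Opens} (r : Γ(X, U)) : resRing le_rfl r = r := by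
  change X.presheaf.map (𝟙 _) r = r
  rw [X.presheaf.map_id]; rfl

lemma basicOpen_resRing {V U : X.Opens} (h : V ≤ U) (r : Γ(X, U)) :
    X.basicOpen (resRing h r) = V ⊓ X.basicOpen r := X.basicOpen_res r (homOfLE h).op

lemma res_smul (M : X.Modules) {V U : X.Opens} (h : V ≤ U) (r : Γ(X, U)) (x : Sec M U) :
    res (ab M) h (r • x) = resRing h r • res (ab M) h x := M.map_smul (homOfLE h) r x

lemma homSec_smul {M N : X.Modules} (φ : M ⟶ N) {U : X.Opens} (r : Γ(X, U)) (x : Sec M U) :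
    homSec φ U (r • x) = r • homSec φ U x := φ.app_smul r x

lemma homSec_comp {M N P : X.Modules} (φ : M ⟶ N) (ψ : N ⟶ P) (U : X.Opens) (x : Sec M U) :
    homSec (φ ≫ ψ) U x = homSec ψ U (homSec φ U x) := rfl

lemma modules_hom_ext {M N : X.Modules} {φ ψ : M ⟶ N} (h : ∀ U x, homSec φ U x = homSec ψ U x) :
    φ = ψ :=
  (abF X).map_injective (AbSheaf.hom_ext h)

lemma exists_hom_of_linear {M N : X.Modules} (φ : ab M ⟶ ab N)
    (h : ∀ (U : X.Opens) (r : Γ(X, U)) (x : Sec M U), secMap φ U (r • x) = r • secMap φ U x) :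
    ∃ ψ : M ⟶ N, (abF X).map ψ = φ :=
  ⟨⟨PresheafOfModules.homMk φ.hom fun U r m ↦ h U.unop r m⟩, rfl⟩

lemma exists_affine_mem_le {U : X.Opens} {p : X} (hp : p ∈ U) :
    ∃ V : X.Opens, IsAffineOpen V ∧ p ∈ V ∧ V ≤ U := by
  obtain ⟨V, hV, hpV, h⟩ := Opens.isBasis_iff_nbhd.mp X.isBasis_affineOpens hp
  exact ⟨V, hV, hpV, h⟩

lemma exists_subsheaf (M : X.Modules) (p : ∀ U : X.Opens, Submodule Γ(X, U) (Sec M U))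
    (hres : ∀ {V U : X.Opens} (h : V ≤ U) (x : Sec M U), x ∈ p U → res (ab M) h x ∈ p V)
    (hloc : ∀ {U : X.Opens} (x : Sec M U), (∀ q ∈ U, ∃ (V : X.Opens) (h : V ≤ U), q ∈ V ∧
      res (ab M) h x ∈ p V) → x ∈ p U) :
    ∃ (N : X.Modules) (ι : N ⟶ M), (∀ U x, homSec ι U x = 0 → x = 0) ∧
      ∀ U m, m ∈ p U ↔ ∃ x, homSec ι U x = m := by
  let P : PresheafOfModules.Submodule M.val :=
    { obj U := p U.unop
      map {U V} f x hx := hres (leOfHom f.unop) x hx }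
  have hP : TopCat.Presheaf.IsSheaf (X := X.toTopCat) P.toPresheafOfModules.presheaf := by
    rw [TopCat.Presheaf.isSheaf_iff_isSheafUniqueGluing]
    intro ι U s hs
    obtain ⟨x, hx, hx'⟩ := TopCat.Sheaf.existsUnique_gluing (ab M) U
      (fun i ↦ Subtype.val (p := (· ∈ p (U i))) (s i))
      (fun i j ↦ congr_arg (Subtype.val (p := (· ∈ p (U i ⊓ U j)))) (hs i j))
    have hxp : x ∈ p (iSup U) := by
      apply hloc
      intro q hq
      obtain ⟨i, hi⟩ := Opens.mem_iSup.mp hq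
      refine ⟨U i, le_iSup U i, hi, ?_⟩
      rw [show res (ab M) (le_iSup U i) x = _ from hx i]
      exact (s i : p (U i)).2
    refine ⟨(⟨x, hxp⟩ : p (iSup U)), fun i ↦ Subtype.ext (hx i), fun y hy ↦ ?_⟩
    exact Subtype.ext (hx' _ fun i ↦ congr_arg (Subtype.val (p := (· ∈ p (U i)))) (hy i))
  let N : X.Modules := ⟨P.toPresheafOfModules, hP⟩
  let ι : N ⟶ M := ⟨P.ι⟩
  exact ⟨N, ι, fun U x hx ↦ Subtype.ext hx, fun U m ↦
    ⟨fun hm ↦ ⟨(⟨m, hm⟩ : p U), rfl⟩, by rintro ⟨x, rfl⟩; exact (x : p U).2⟩⟩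

lemma injective_homSec_of_mono {M N : X.Modules} (φ : M ⟶ N) [Mono φ] (U : X.Opens) (x : Sec M U)
    (hx : homSec φ U x = 0) : x = 0 := by
  have : Mono ((abF X).map φ) := inferInstance
  exact injective_secMap_of_mono ((abF X).map φ) U (hx.trans (map_zero _).symm)

lemma mono_of_injective_homSec {M N : X.Modules} (φ : M ⟶ N)
    (h : ∀ U x, homSec φ U x = 0 → x = 0) : Mono φ :=
  (abF X).mono_of_mono_map (mono_of_injective_secMap _ h)

/-- The sections of `N` which lift locally along `φ`, that is, the sections of the image of `φ`. -/
def locallyLiftable {M N : X.Modules} (φ : M ⟶ N) (U : X.Opens) : Submodule Γ(X, U) (Sec N U) where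
  carrier := {z | ∀ q ∈ U, ∃ (V : X.Opens) (h : V ≤ U) (x : Sec M V), q ∈ V ∧
    homSec φ V x = res (ab N) h z}
  add_mem' := by
    intro z w hz hw q hq
    obtain ⟨V, hV, x, hqV, hx⟩ := hz q hq
    obtain ⟨V', hV', x', hqV', hx'⟩ := hw q hq
    refine ⟨V ⊓ V', inf_le_left.trans hV, res _ inf_le_left x + res _ inf_le_right x',
      ⟨hqV, hqV'⟩, ?_⟩
    rw [map_add, secMap_res, secMap_res, hx, hx', res_res, res_res, map_add]
  zero_mem' q hq := ⟨U, le_rfl, 0, hq, by rw [map_zero, map_zero]⟩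
  smul_mem' := by
    intro r z hz q hq
    obtain ⟨V, hV, x, hqV, hx⟩ := hz q hq
    exact ⟨V, hV, resRing hV r • x, hqV, by rw [homSec_smul, hx, res_smul]⟩

lemma exists_locallyLiftable_subsheaf {M N : X.Modules} (φ : M ⟶ N) :
    ∃ (I : X.Modules) (ι : I ⟶ N), (∀ U x, homSec ι U x = 0 → x = 0) ∧
      ∀ U z, z ∈ locallyLiftable φ U ↔ ∃ x, homSec ι U x = z := by
  refine exists_subsheaf N (locallyLiftable φ) (fun {V U} h z hz q hq ↦ ?_)
    (fun {U} z hz q hq ↦ ?_)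
  · obtain ⟨W, hW, x, hqW, hx⟩ := hz q (h hq)
    refine ⟨V ⊓ W, inf_le_left, res _ inf_le_right x, ⟨hq, hqW⟩, ?_⟩
    rw [secMap_res, hx, res_res, res_res]
  · obtain ⟨V, hV, hqV, h⟩ := hz q hq
    obtain ⟨W, hW, x, hqW, hx⟩ := h q hqV
    exact ⟨W, hW.trans hV, x, hqW, by rw [hx, res_res]⟩

lemma locally_surjective_of_epi {M N : X.Modules} (φ : M ⟶ N) [Epi φ] (U : X.Opens)
    (z : Sec N U) : z ∈ locallyLiftable φ U := by
  obtain ⟨I, ι, hι, hI⟩ := exists_locallyLiftable_subsheaf φ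
  have cokernel_π_eq_zero : cokernel.π ι = 0 := by
    rw [← cancel_epi φ, comp_zero]
    refine modules_hom_ext fun U x ↦ ?_
    obtain ⟨y, hy⟩ := (hI U (homSec φ U x)).mp fun q hq ↦ ⟨U, le_rfl, x, hq, by rw [res_self]⟩
    rw [homSec_comp, ← hy, ← homSec_comp, cokernel.condition]
    rfl
  have : Mono ι := mono_of_injective_homSec ι hι
  have : Epi ι := Abelian.epi_of_cokernel_π_eq_zero ι cokernel_π_eq_zero
  have : IsIso ι := isIso_of_mono_of_epi ι
  refine (hI U z).mpr ⟨homSec (inv ι) U z, ?_⟩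
  rw [← homSec_comp, IsIso.inv_hom_id]
  rfl

lemma IsShortExact.of_modules {S : ShortComplex X.Modules} (hS : S.ShortExact) :
    IsShortExact ((abF X).map S.f) ((abF X).map S.g) := by
  have hmono := hS.mono_f
  have hepi := hS.epi_g
  obtain ⟨hexact, hmono'⟩ := ((Functor.preservesFiniteLimits_tfae (abF X)).out 1 3 rfl rfl).mpr
    inferInstance S ⟨hS.exact, hmono⟩
  refine ⟨⟨fun U x ↦ injective_homSec_of_mono S.f U x, fun U x ↦ ?_,
    fun U x ↦ TopCat.Sheaf.sections_exact_of_left_exact hexact hmono' x⟩,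
    locally_surjective_of_epi S.g⟩
  rw [← homSec_comp, S.zero]
  rfl

lemma isShortExact_cokernel {M N : X.Modules} (φ : M ⟶ N) [Mono φ] :
    IsShortExact ((abF X).map φ) ((abF X).map (cokernel.π φ)) :=
  .of_modules (S := .mk φ (cokernel.π φ) (cokernel.condition φ))
    (.mk' (ShortComplex.exact_of_g_is_cokernel _ (cokernelIsCokernel φ)) inferInstance
      inferInstance)

lemma exists_isShortExact_image {M N : X.Modules} (φ : M ⟶ N) :
    ∃ (K I C : X.Modules) (k : K ⟶ M) (e : M ⟶ I) (i : I ⟶ N) (c : N ⟶ C),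
      IsShortExact ((abF X).map k) ((abF X).map e) ∧
      IsShortExact ((abF X).map i) ((abF X).map c) ∧ e ≫ i = φ :=
  ⟨_, _, _, _, _, _, _, isShortExact_cokernel (kernel.ι φ),
    isShortExact_cokernel (Abelian.factorThruCoimage φ), Abelian.coimage.fac φ⟩

end Modules

/-! ### Quasi-coherence in terms of sections -/

section SectionsLocalize

variable {X : Scheme.{u}}

/-- Sections over the open subsets in `B` localize well: a section over a basic open subset extends
after multiplication by a power of its equation, and a section which restricts to zero there is
killed by such a power. The basic open subset is a variable `V` with an equation, so that it can be
rewritten. -/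
structure SectionsLocalizeOn (B : Set X.Opens) (M : X.Modules) : Prop where
  exists_res_eq : ∀ {U : X.Opens}, U ∈ B → ∀ (f : Γ(X, U)) {V : X.Opens}, V = X.basicOpen f →
    ∀ (h : V ≤ U) (s : Sec M V), ∃ (n : ℕ) (t : Sec M U), res (ab M) h t = resRing h f ^ n • s
  exists_pow_smul_eq_zero : ∀ {U : X.Opens}, U ∈ B → ∀ (f : Γ(X, U)) {V : X.Opens},
    V = X.basicOpen f → ∀ (h : V ≤ U) (t : Sec M U), res (ab M) h t = 0 → ∃ n : ℕ, f ^ n • t = 0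

/-- Quasi-coherence, expressed in terms of sections over affine open subsets; see
`sectionsLocalize_iff_isQuasicoherent`. -/
abbrev SectionsLocalize (M : X.Modules) : Prop := SectionsLocalizeOn X.affineOpens M

lemma exists_basicOpen_cover {U : X.Opens} (hU : IsAffineOpen U)
    (P : ∀ V : X.Opens, V ≤ U → Prop)
    (hP : ∀ {V W : X.Opens} (hWV : W ≤ V) (hV : V ≤ U), P V hV → P W (hWV.trans hV))
    (h : ∀ p ∈ U, ∃ (V : X.Opens) (hV : V ≤ U), p ∈ V ∧ P V hV) :
    ∃ s : Finset Γ(X, U), Ideal.span (s : Set Γ(X, U)) = ⊤ ∧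
      ∀ g ∈ s, P (X.basicOpen g) (X.basicOpen_le g) := by
  let S : Set Γ(X, U) := {g | P (X.basicOpen g) (X.basicOpen_le g)}
  have hS : Ideal.span S = ⊤ := by
    rw [← hU.iSup_basicOpen_eq_self_iff]
    refine le_antisymm (iSup_le fun g ↦ X.basicOpen_le _) fun p hp ↦ ?_
    obtain ⟨V, hV, hpV, hPV⟩ := h p hp
    obtain ⟨g, hg, hpg⟩ := hU.exists_basicOpen_le ⟨p, hpV⟩ hp
    exact Opens.mem_iSup.mpr ⟨⟨g, hP hg hV hPV⟩, hpg⟩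
  obtain ⟨s, hs, hs'⟩ := Submodule.mem_span_finite_of_mem_span
    (show (1 : Γ(X, U)) ∈ Ideal.span S by rw [hS]; trivial)
  exact ⟨s, (Ideal.eq_top_iff_one _).mpr hs', fun g hg ↦ hs hg⟩

lemma le_iSup_basicOpen {U : X.Opens} (hU : IsAffineOpen U) {s : Finset Γ(X, U)}
    (hs : Ideal.span (s : Set Γ(X, U)) = ⊤) : U ≤ ⨆ g : s, X.basicOpen g.1 :=
  (hU.iSup_basicOpen_eq_self_iff.mpr hs).ge

lemma exists_forall_of_finset {α : Type*} (s : Finset α) (P : α → ℕ → Prop)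
    (hP : ∀ a n m, n ≤ m → P a n → P a m) (h : ∀ a ∈ s, ∃ n, P a n) : ∃ n, ∀ a ∈ s, P a n := by
  classical
  choose! n hn using h
  exact ⟨s.sup n, fun a ha ↦ hP a _ _ (Finset.le_sup ha) (hn a ha)⟩

lemma IsShortExact.exists_lift_cover {F E G : X.Modules} {φ : F ⟶ E} {ψ : E ⟶ G}
    (h : IsShortExact ((abF X).map φ) ((abF X).map ψ)) {U : X.Opens} (hU : IsAffineOpen U)
    (z : Sec G U) :
    ∃ s : Finset Γ(X, U), Ideal.span (s : Set Γ(X, U)) = ⊤ ∧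
      ∀ g ∈ s, ∃ x, homSec ψ (X.basicOpen g) x = res (ab G) (X.basicOpen_le g) z :=
  exists_basicOpen_cover hU (fun W hW ↦ ∃ x, homSec ψ W x = res (ab G) hW z)
    (fun {W W'} hle hW ⟨x, hx⟩ ↦ ⟨res _ hle x, by rw [secMap_res, hx, res_res]⟩)
    (fun p hp ↦ by
      obtain ⟨W, hW, x, hpW, hx⟩ := h.surj U z p hp
      exact ⟨W, hW, hpW, x, hx⟩)

section Quotient

variable {F E G : X.Modules} {φ : F ⟶ E} {ψ : E ⟶ G}
  (h : IsShortExact ((abF X).map φ) ((abF X).map ψ)) (hF : SectionsLocalize F)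
  (hE : SectionsLocalize E)
include h hF hE

lemma IsShortExact.exists_pow_smul_homSec_eq_zero {U : X.Opens} (hU : IsAffineOpen U)
    (f : Γ(X, U)) {V : X.Opens} (hV : V = X.basicOpen f) (hVU : V ≤ U) (x : Sec E U)
    (hx : res (ab G) hVU (homSec ψ U x) = 0) : ∃ n : ℕ, f ^ n • homSec ψ U x = 0 := by
  obtain ⟨y, hy⟩ := h.exact V (res _ hVU x) (by rw [secMap_res, hx])
  obtain ⟨n, y', hy'⟩ := hF.exists_res_eq hU f hV hVU y
  obtain ⟨m, hm⟩ := hE.exists_pow_smul_eq_zero hU f hV hVU (f ^ n • x - homSec φ U y') (by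
    rw [map_sub, res_smul, map_pow, ← secMap_res, hy', homSec_smul, hy, sub_self])
  refine ⟨m + n, ?_⟩
  have := congr(homSec ψ U $hm)
  rwa [homSec_smul, map_sub, h.zero, sub_zero, homSec_smul, map_zero, ← mul_smul, ← pow_add]
    at this

lemma IsShortExact.exists_pow_smul_eq_zero {U : X.Opens} (hU : IsAffineOpen U) (f : Γ(X, U))
    {V : X.Opens} (hV : V = X.basicOpen f) (hVU : V ≤ U) (z : Sec G U)
    (hz : res (ab G) hVU z = 0) : ∃ n : ℕ, f ^ n • z = 0 := by
  obtain ⟨s, hs, hs'⟩ := h.exists_lift_cover hU z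
  obtain ⟨n, hn⟩ := exists_forall_of_finset s
    (fun g n ↦ res (ab G) (X.basicOpen_le g) (f ^ n • z) = 0)
    (fun g n m hnm hn ↦ by
      obtain ⟨k, rfl⟩ := Nat.exists_eq_add_of_le' hnm
      rw [pow_add, mul_smul, res_smul, hn, smul_zero])
    (fun g hg ↦ by
      obtain ⟨x, hx⟩ := hs' g hg
      let f' := resRing (X.basicOpen_le g) f
      have hWV : X.basicOpen f' ≤ V := by rw [hV, basicOpen_resRing]; exact inf_le_right
      obtain ⟨n, hn⟩ := h.exists_pow_smul_homSec_eq_zero hF hE (hU.basicOpen g) f' rfl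
        (X.basicOpen_le f') x (by rw [hx, res_res, ← res_res (ab G) hWV hVU, hz, map_zero])
      exact ⟨n, by rw [res_smul, map_pow, ← hx, hn]⟩)
  refine ⟨n, AbSheaf.eq_of_locally_eq (ab G) (fun g : s ↦ X.basicOpen g.1)
    (fun g ↦ X.basicOpen_le _) (le_iSup_basicOpen hU hs) fun g ↦ ?_⟩
  rw [hn g.1 g.2, map_zero]

lemma IsShortExact.surjective_homSec {U : X.Opens} (hU : IsAffineOpen U) :
    Function.Surjective (homSec ψ U) := by
  intro z
  let I : Ideal Γ(X, U) :=
    { carrier := {a | ∃ x, homSec ψ U x = a • z}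
      add_mem' := by
        rintro a b ⟨x, hx⟩ ⟨y, hy⟩
        exact ⟨x + y, by rw [map_add, hx, hy, add_smul]⟩
      zero_mem' := ⟨0, by rw [map_zero, zero_smul]⟩
      smul_mem' := by
        rintro a b ⟨x, hx⟩
        exact ⟨a • x, by rw [homSec_smul, hx, smul_smul, smul_eq_mul]⟩ }
  obtain ⟨s, hs, hs'⟩ := h.exists_lift_cover hU z
  obtain ⟨n, hn⟩ := exists_forall_of_finset s (fun g n ↦ g ^ n ∈ I)
    (fun g n m hnm hn ↦ I.pow_mem_of_pow_mem hn hnm)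
    (fun g hg ↦ by
      obtain ⟨x, hx⟩ := hs' g hg
      obtain ⟨n, t, ht⟩ := hE.exists_res_eq hU g rfl (X.basicOpen_le g) x
      obtain ⟨m, hm⟩ := h.exists_pow_smul_eq_zero hF hE hU g rfl (X.basicOpen_le g)
        (homSec ψ U t - g ^ n • z) (by
          rw [map_sub, ← secMap_res, ht, homSec_smul, hx, res_smul, map_pow, sub_self])
      refine ⟨m + n, g ^ m • t, ?_⟩
      rw [smul_sub, sub_eq_zero] at hm
      rw [homSec_smul, hm, smul_smul, pow_add])
  have hI : I = ⊤ := by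
    rw [eq_top_iff, ← Ideal.span_pow_eq_top _ hs n, Ideal.span_le]
    rintro _ ⟨g, hg, rfl⟩
    exact hn g hg
  obtain ⟨x, hx⟩ := (Ideal.eq_top_iff_one I).mp hI
  exact ⟨x, by rw [hx, one_smul]⟩

lemma IsShortExact.sectionsLocalize : SectionsLocalize G where
  exists_pow_smul_eq_zero hU f V hV hVU t ht := h.exists_pow_smul_eq_zero hF hE hU f hV hVU t ht
  exists_res_eq {U} hU f V hV hVU s := by
    have hVa : IsAffineOpen V := hV ▸ hU.basicOpen f
    obtain ⟨x, rfl⟩ := h.surjective_homSec hF hE hVa s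
    obtain ⟨n, t, ht⟩ := hE.exists_res_eq hU f hV hVU x
    exact ⟨n, homSec ψ U t, by rw [← secMap_res, ht, homSec_smul]⟩

end Quotient

lemma IsLeftExact.sectionsLocalize {F E G : X.Modules} {φ : F ⟶ E} {ψ : E ⟶ G}
    (h : IsLeftExact ((abF X).map φ) ((abF X).map ψ)) (hE : SectionsLocalize E)
    (hG : SectionsLocalize G) :
    SectionsLocalize F where
  exists_pow_smul_eq_zero {U} hU f V hV hVU t ht := by
    obtain ⟨n, hn⟩ := hE.exists_pow_smul_eq_zero hU f hV hVU (homSec φ U t)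
      (by rw [← secMap_res, ht, map_zero])
    exact ⟨n, h.inj U _ (by rw [homSec_smul, hn])⟩
  exists_res_eq {U} hU f V hV hVU s := by
    obtain ⟨n, t, ht⟩ := hE.exists_res_eq hU f hV hVU (homSec φ V s)
    obtain ⟨m, hm⟩ := hG.exists_pow_smul_eq_zero hU f hV hVU (homSec ψ U t) (by
      rw [← secMap_res, ht, homSec_smul, h.zero, smul_zero])
    obtain ⟨y, hy⟩ := h.exact U (f ^ m • t) (by rw [homSec_smul, hm])
    refine ⟨m + n, y, ?_⟩
    rw [← sub_eq_zero]
    apply h.inj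
    rw [map_sub, secMap_res, hy, res_smul, ht, homSec_smul, map_pow, smul_smul, pow_add, sub_self]

lemma homSec_sum {M N : X.Modules} {ι : Type*} (s : Finset ι) (φ : ι → (M ⟶ N)) (U : X.Opens)
    (x : Sec M U) : homSec (∑ i ∈ s, φ i) U x = ∑ i ∈ s, homSec (φ i) U x := by
  classical
  induction s using Finset.induction_on with
  | empty => simp only [Finset.sum_empty]; rfl
  | insert a s ha ih => rw [Finset.sum_insert ha, Finset.sum_insert ha, ← ih]; rfl

section Biproduct

instance (X : Scheme.{u}) : HasFiniteBiproducts X.Modules := Abelian.hasFiniteBiproducts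

variable {ι : Type} (M : ι → X.Modules)

lemma biproduct_sec_total [Fintype ι] (U : X.Opens) (x : Sec (⨁ M) U) :
    ∑ i, homSec (biproduct.ι M i) U (homSec (biproduct.π M i) U x) = x := by
  have := congr(homSec $(biproduct.total (f := M)) U x)
  rw [homSec_sum] at this
  exact this

variable [Finite ι]

lemma biproduct_sec_ext {U : X.Opens} {x y : Sec (⨁ M) U}
    (h : ∀ i, homSec (biproduct.π M i) U x = homSec (biproduct.π M i) U y) : x = y := by
  cases nonempty_fintype ι
  rw [← biproduct_sec_total M U x, ← biproduct_sec_total M U y]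
  simp only [h]

lemma exists_biproduct_sec {U : X.Opens} (s : ∀ i, Sec (M i) U) :
    ∃ x : Sec (⨁ M) U, ∀ i, homSec (biproduct.π M i) U x = s i := by
  classical
  cases nonempty_fintype ι
  refine ⟨∑ i, homSec (biproduct.ι M i) U (s i), fun j ↦ ?_⟩
  rw [map_sum, Finset.sum_eq_single j]
  · rw [← homSec_comp, biproduct.ι_π_self]; rfl
  · intro i _ hij
    rw [← homSec_comp, biproduct.ι_π_ne _ hij]; rfl
  · simp

variable {M} in
lemma SectionsLocalize.biproduct (h : ∀ i, SectionsLocalize (M i)) : SectionsLocalize (⨁ M) := by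
  cases nonempty_fintype ι
  refine ⟨fun {U} hU f V hV hVU s ↦ ?_, fun {U} hU f V hV hVU t ht ↦ ?_⟩
  · obtain ⟨n, hn⟩ := exists_forall_of_finset Finset.univ
      (fun i n ↦ ∃ t : Sec (M i) U, res _ hVU t = resRing hVU f ^ n • homSec (biproduct.π M i) V s)
      (fun i n m hnm ⟨t, ht⟩ ↦ by
        obtain ⟨k, rfl⟩ := Nat.exists_eq_add_of_le' hnm
        exact ⟨f ^ k • t, by rw [res_smul, ht, map_pow, smul_smul, pow_add]⟩)
      (fun i _ ↦ (h i).exists_res_eq hU f hV hVU _)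
    choose t ht using fun i ↦ hn i (Finset.mem_univ i)
    obtain ⟨x, hx⟩ := exists_biproduct_sec M t
    refine ⟨n, x, biproduct_sec_ext M fun i ↦ ?_⟩
    rw [secMap_res, hx, ht, homSec_smul]
  · obtain ⟨n, hn⟩ := exists_forall_of_finset Finset.univ
      (fun i n ↦ f ^ n • homSec (biproduct.π M i) U t = 0)
      (fun i n m hnm hn ↦ by
        obtain ⟨k, rfl⟩ := Nat.exists_eq_add_of_le' hnm
        rw [pow_add, mul_smul, hn, smul_zero])
      (fun i _ ↦ (h i).exists_pow_smul_eq_zero hU f hV hVU _ (by rw [← secMap_res, ht, map_zero]))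
    refine ⟨n, biproduct_sec_ext M fun i ↦ ?_⟩
    rw [homSec_smul, hn i (Finset.mem_univ i), map_zero]

lemma eq_zero_of_comp_biproduct_π {U : X.Opens} {n : ℕ} (x : Ext (freeSheaf U) (ab (⨁ M)) n)
    (h : ∀ i, x.comp (Ext.mk₀ ((abF X).map (biproduct.π M i))) (add_zero n) = 0) : x = 0 := by
  cases nonempty_fintype ι
  have id_eq_sum : 𝟙 (ab (⨁ M)) =
      ∑ i, (abF X).map (biproduct.π M i) ≫ (abF X).map (biproduct.ι M i) := by
    rw [← (abF X).map_id, ← biproduct.total, Functor.map_sum]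
    simp only [Functor.map_comp]
  have : x = x.comp (Ext.mk₀ (𝟙 (ab (⨁ M)))) (add_zero n) := by simp
  rw [this, id_eq_sum, Ext.mk₀_sum, Ext.comp_sum]
  refine Finset.sum_eq_zero fun i _ ↦ ?_
  rw [← Ext.mk₀_comp_mk₀, ← Ext.comp_assoc _ _ _ (add_zero n) (add_zero 0) (by omega), h,
    Ext.zero_comp]

lemma vanishes_biproduct {U : X.Opens} {n : ℕ} (h : ∀ i, Vanishes n U (ab (M i))) :
    Vanishes n U (ab (⨁ M)) :=
  vanishes_iff.mpr fun x ↦ eq_zero_of_comp_biproduct_π M x fun i ↦ vanishes_iff.mp (h i) _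

end Biproduct

end SectionsLocalize

lemma isContinuous_of_opens {T T' : TopCat.{u}} (θ : Opens T ⥤ Opens T')
    (hinf : ∀ U V : Opens T, θ.obj U ⊓ θ.obj V ≤ θ.obj (U ⊓ V))
    (hcov : ∀ (U : Opens T), ∀ p ∈ θ.obj U, ∃ q ∈ U, ∀ V : Opens T, q ∈ V → p ∈ θ.obj V) :
    θ.IsContinuous (Opens.grothendieckTopology T) (Opens.grothendieckTopology T') := by
  refine Functor.isContinuous_of_coverPreserving ⟨?_⟩ ⟨?_⟩
  · intro ℱ Z S x hx Y₁ Y₂ A f₁ f₂ g₁ g₂ hg₁ hg₂ _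
    have hA : A ≤ θ.obj (Y₁ ⊓ Y₂) := (le_inf (leOfHom f₁) (leOfHom f₂)).trans (hinf _ _)
    have h := hx (homOfLE inf_le_left : Y₁ ⊓ Y₂ ⟶ Y₁) (homOfLE inf_le_right) hg₁ hg₂ rfl
    have h' := congr(ℱ.obj.map (homOfLE hA).op $h)
    change (ℱ.obj.map _ ≫ ℱ.obj.map _) _ = (ℱ.obj.map _ ≫ ℱ.obj.map _) _ at h'
    rw [← ℱ.obj.map_comp, ← ℱ.obj.map_comp] at h'
    exact h'
  · intro U S hS p hp
    obtain ⟨q, hq, h⟩ := hcov U p hp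
    obtain ⟨V, f, hf, hqV⟩ := hS q hq
    exact ⟨θ.obj V, θ.map f, ⟨V, f, 𝟙 _, hf, by simp⟩, h V hqV⟩

section PushRes

/-- Intersection with `W`, as a functor. -/
def interFunctor {T : TopCat.{u}} (W : Opens T) : Opens T ⥤ Opens T :=
  Monotone.functor (f := fun V ↦ W ⊓ V) fun _ _ h ↦ inf_le_inf_left W h

instance isContinuous_interFunctor {T : TopCat.{u}} (W : Opens T) : (interFunctor W).IsContinuous
    (Opens.grothendieckTopology T) (Opens.grothendieckTopology T) :=
  isContinuous_of_opens _ (fun U V ↦ (inf_inf_distrib_left W U V).ge)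
    fun _ p hp ↦ ⟨p, hp.2, fun _ hV ↦ ⟨hp.1, hV⟩⟩

variable {X : Scheme.{u}}

instance modulePushRes (W : X.Opens) (F : X.Modules) (V : (X.Opens)ᵒᵖ) :
    Module (X.ringCatSheaf.obj.obj V) (((precomp (interFunctor W)).obj (ab F)).obj.obj V) :=
  Module.compHom (Sec F (W ⊓ V.unop)) (resRing (inf_le_right : W ⊓ V.unop ≤ V.unop))

/-- The direct image of the restriction of `F` to the open subset `W`: its sections over `V` are
the sections of `F` over `W ⊓ V`. -/
def pushRes (W : X.Opens) (F : X.Modules) : X.Modules :=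
  ⟨PresheafOfModules.ofPresheaf (R := X.ringCatSheaf.obj)
    ((precomp (interFunctor W)).obj (ab F)).obj (fun {V V'} f r x ↦ by
      refine (res_smul F (leOfHom ((interFunctor W).map f.unop)) _ x).trans ?_
      refine congrArg (fun a : Γ(X, W ⊓ V'.unop) ↦
        a • res (ab F) (inf_le_inf_left W (leOfHom f.unop)) x) ?_
      exact (resRing_resRing _ _ r).trans
        (resRing_resRing (inf_le_right : W ⊓ V'.unop ≤ V'.unop) (leOfHom f.unop) r).symm),
    ((precomp (interFunctor W)).obj (ab F)).property⟩

variable (W : X.Opens) (F : X.Modules)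

/-- Sections of `pushRes W F` over `V` are sections of `F` over `W ⊓ V`. -/
def secPush (V : X.Opens) : Sec (pushRes W F) V ≃+ Sec F (W ⊓ V) := AddEquiv.refl _

lemma secPush_res {V U : X.Opens} (h : V ≤ U) (x : Sec (pushRes W F) U) :
    secPush W F V (res _ h x) = res (ab F) (inf_le_inf_left W h) (secPush W F U x) := rfl

lemma secPush_smul {V : X.Opens} (r : Γ(X, V)) (x : Sec (pushRes W F) V) :
    secPush W F V (r • x) = resRing (inf_le_right : W ⊓ V ≤ V) r • secPush W F V x := rfl

lemma exists_toPushRes : ∃ φ : F ⟶ pushRes W F, ∀ U x,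
    secPush W F U (homSec φ U x) = res (ab F) inf_le_right x := by
  let φ : ab F ⟶ ab (pushRes W F) :=
    ⟨{ app U := (ab F).obj.map (homOfLE (inf_le_right : W ⊓ U.unop ≤ U.unop)).op
       naturality U V f := by
        exact ((ab F).obj.map_comp f (homOfLE inf_le_right).op).symm.trans
          ((ab F).obj.map_comp (homOfLE (inf_le_right : W ⊓ U.unop ≤ U.unop)).op
            ((interFunctor W).map f.unop).op) }⟩
  obtain ⟨ψ, hψ⟩ := exists_hom_of_linear (M := F) (N := pushRes W F) φ
    (fun U r x ↦ res_smul F inf_le_right r x)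
  exact ⟨ψ, fun U x ↦ by rw [homSec, hψ]; rfl⟩

end PushRes

section Restrict

variable {X Y : Scheme.{u}} (j : Y ⟶ X) [IsOpenImmersion j] (F : X.Modules)

/-- Sections of the restriction of `F` along an open immersion. -/
def secRestrict (V : Y.Opens) : Sec (F.restrict j) V ≃+ Sec F (j ''ᵁ V) := AddEquiv.refl _

lemma secRestrict_res {V U : Y.Opens} (h : V ≤ U) (x : Sec (F.restrict j) U) :
    secRestrict j F V (res _ h x) =
      res (ab F) (j.opensFunctor.monotone h) (secRestrict j F U x) := rfl

lemma secRestrict_smul {V : Y.Opens} (r : Γ(Y, V)) (x : Sec (F.restrict j) V) :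
    secRestrict j F V (r • x) = (j.appIso V).inv r • secRestrict j F V x := rfl

variable {F} in
lemma SectionsLocalize.restrict (hF : SectionsLocalize F) : SectionsLocalize (F.restrict j) := by
  refine ⟨fun {U} hU f V hV h s ↦ ?_, fun {U} hU f V hV h t ht ↦ ?_⟩
  · obtain ⟨n, t, ht⟩ := hF.exists_res_eq (hU.image_of_isOpenImmersion j) ((j.appIso U).inv f)
      (V := j ''ᵁ V) (by rw [hV, Scheme.image_basicOpen]) (j.opensFunctor.monotone h)
      (secRestrict j F V s)
    refine ⟨n, (secRestrict j F U).symm t, (secRestrict j F V).injective ?_⟩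
    rw [secRestrict_res, secRestrict_smul, AddEquiv.apply_symm_apply, ht, map_pow]
    congr 2
    exact congr($(j.appIso_inv_naturality (homOfLE h).op) f).symm
  · obtain ⟨n, hn⟩ := hF.exists_pow_smul_eq_zero (hU.image_of_isOpenImmersion j)
      ((j.appIso U).inv f) (V := j ''ᵁ V) (by rw [hV, Scheme.image_basicOpen])
      (j.opensFunctor.monotone h) (secRestrict j F U t)
      (by rw [← secRestrict_res j F h, ht, map_zero])
    exact ⟨n, (secRestrict j F U).injective (by rw [secRestrict_smul, map_pow, hn, map_zero])⟩

lemma vanishes_restrict {n : ℕ} (hn : 1 ≤ n) (U : Y.Opens) :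
    Vanishes n U (ab (F.restrict j)) ↔ Vanishes n (j ''ᵁ U) (ab F) := by
  have : j.isOpenEmbedding.isOpenMap.functor.IsContinuous (Opens.grothendieckTopology Y)
      (Opens.grothendieckTopology X) :=
    inferInstanceAs (j.opensFunctor.IsContinuous (Opens.grothendieckTopology Y)
      (Opens.grothendieckTopology X))
  exact vanishes_restrict_iff j.base j.isOpenEmbedding (ab F) hn U

end Restrict

section Pushforward

variable {X Y : Scheme.{u}} (f : Y ⟶ X) (F : Y.Modules)

/-- Sections of the direct image of `F`. -/
def secPushforward (V : X.Opens) :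
    Sec ((Scheme.Modules.pushforward f).obj F) V ≃+ Sec F (f ⁻¹ᵁ V) := AddEquiv.refl _

lemma secPushforward_res {V U : X.Opens} (h : V ≤ U)
    (x : Sec ((Scheme.Modules.pushforward f).obj F) U) :
    secPushforward f F V (res _ h x) = res (ab F) (f.preimage_mono h) (secPushforward f F U x) :=
  rfl

lemma secPushforward_smul {V : X.Opens} (r : Γ(X, V))
    (x : Sec ((Scheme.Modules.pushforward f).obj F) V) :
    secPushforward f F V (r • x) = f.app V r • secPushforward f F V x := rfl

end Pushforward

section Noetherian

variable {X : Scheme.{u}} [NoetherianSpace X] {B : Set X.Opens}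

lemma exists_finite_cover_of (hB : Opens.IsBasis B) (O : X.Opens)
    (P : ∀ V : X.Opens, V ≤ O → Prop)
    (hP : ∀ {V W : X.Opens} (hWV : W ≤ V) (hV : V ≤ O), P V hV → P W (hWV.trans hV))
    (h : ∀ p ∈ O, ∃ (V : X.Opens) (hV : V ≤ O), p ∈ V ∧ P V hV) :
    ∃ (n : ℕ) (D : Fin n → X.Opens) (hD : ∀ i, D i ≤ O), (∀ i, D i ∈ B) ∧
      (∀ i, P (D i) (hD i)) ∧ O ≤ ⨆ i, D i := by
  have (p : O) : ∃ (V : X.Opens) (hV : V ≤ O), V ∈ B ∧ p.1 ∈ V ∧ P V hV := by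
    obtain ⟨V, hV, hpV, hPV⟩ := h p.1 p.2
    obtain ⟨W, hW, hpW, hWV⟩ := Opens.isBasis_iff_nbhd.mp hB hpV
    exact ⟨W, hWV.trans hV, hW, hpW, hP hWV hV hPV⟩
  choose V hVO hV hpV hPV using this
  obtain ⟨s, hs⟩ := (NoetherianSpace.isCompact (O : Set X)).elim_finite_subcover
    (fun p : O ↦ (V p : Set X)) (fun p ↦ (V p).isOpen)
    fun p hp ↦ Set.mem_iUnion.mpr ⟨⟨p, hp⟩, hpV ⟨p, hp⟩⟩
  let e := s.equivFin
  refine ⟨s.card, fun i ↦ V (e.symm i), fun i ↦ hVO _, fun i ↦ hV _, fun i ↦ hPV _,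
    fun p hp ↦ ?_⟩
  obtain ⟨q, hq, hpq⟩ := Set.mem_iUnion₂.mp (hs hp)
  exact Opens.mem_iSup.mpr ⟨e ⟨q, hq⟩, by simpa using hpq⟩

lemma exists_finite_cover (hB : Opens.IsBasis B) (O : X.Opens) :
    ∃ (n : ℕ) (D : Fin n → X.Opens), (∀ i, D i ≤ O) ∧ (∀ i, D i ∈ B) ∧ O ≤ ⨆ i, D i := by
  obtain ⟨n, D, hD, hD', -, h⟩ := exists_finite_cover_of hB O (fun _ _ ↦ True)
    (fun _ _ _ ↦ trivial) fun p hp ↦ ⟨O, le_rfl, hp, trivial⟩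
  exact ⟨n, D, hD, hD', h⟩

section Basis

variable {F : X.Modules} (hF : SectionsLocalizeOn B F)
include hF

omit [NoetherianSpace X] in
lemma SectionsLocalizeOn.exists_res_eq_cover {O : X.Opens} (f : Γ(X, O)) {V : X.Opens}
    (hV : V = X.basicOpen f) (h : V ≤ O) (s : Sec F V) {N : ℕ} {D : Fin N → X.Opens}
    (hD : ∀ i, D i ≤ O) (hD' : ∀ i, D i ∈ B) : ∃ (n : ℕ) (t : ∀ i, Sec F (D i)),
      ∀ i, res (ab F) inf_le_left (t i) =
        res (ab F) (inf_le_right : D i ⊓ V ≤ V) (resRing h f ^ n • s) := by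
  obtain ⟨n, hn⟩ := exists_forall_of_finset Finset.univ
    (fun i n ↦ ∃ t : Sec F (D i), res (ab F) inf_le_left t =
      res (ab F) (inf_le_right : D i ⊓ V ≤ V) (resRing h f ^ n • s))
    (fun i n m hnm ⟨t, ht⟩ ↦ by
      obtain ⟨k, rfl⟩ := Nat.exists_eq_add_of_le' hnm
      refine ⟨resRing (hD i) f ^ k • t, ?_⟩
      rw [pow_add, mul_smul, res_smul, res_smul _ _ (_ ^ k), ht]
      simp only [map_pow, resRing_resRing])
    (fun i _ ↦ by
      obtain ⟨n, t, ht⟩ := hF.exists_res_eq (hD' i) (resRing (hD i) f) (V := D i ⊓ V)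
        (by rw [hV, basicOpen_resRing]) inf_le_left (res _ inf_le_right s)
      exact ⟨n, t, by rw [ht, res_smul]; simp only [map_pow, resRing_resRing]⟩)
  choose t ht using fun i ↦ hn i (Finset.mem_univ i)
  exact ⟨n, t, ht⟩

variable (hB : Opens.IsBasis B)
include hB

lemma SectionsLocalizeOn.exists_pow_smul_eq_zero_of_isBasis {O : X.Opens} (f : Γ(X, O))
    {V : X.Opens} (hV : V = X.basicOpen f) (h : V ≤ O) (t : Sec F O)
    (ht : res (ab F) h t = 0) : ∃ n : ℕ, f ^ n • t = 0 := by
  obtain ⟨N, D, hD, hD', hO⟩ := exists_finite_cover hB O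
  obtain ⟨n, hn⟩ := exists_forall_of_finset Finset.univ
    (fun i n ↦ res (ab F) (hD i) (f ^ n • t) = 0)
    (fun g n m hnm hn ↦ by
      obtain ⟨k, rfl⟩ := Nat.exists_eq_add_of_le' hnm
      rw [pow_add, mul_smul, res_smul, hn, smul_zero])
    (fun i _ ↦ by
      obtain ⟨n, hn⟩ := hF.exists_pow_smul_eq_zero (hD' i) (resRing (hD i) f) (V := D i ⊓ V)
        (by rw [hV, basicOpen_resRing]) inf_le_left (res _ (hD i) t)
        (by rw [res_res, ← res_res _ inf_le_right h, ht, map_zero])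
      exact ⟨n, by rw [res_smul, map_pow, hn]⟩)
  exact ⟨n, AbSheaf.eq_of_locally_eq (ab F) D hD hO fun i ↦
    by rw [hn i (Finset.mem_univ i), map_zero]⟩

lemma SectionsLocalizeOn.exists_pow_smul_eq_on_overlaps {O : X.Opens} (f : Γ(X, O)) {V : X.Opens}
    (hV : V = X.basicOpen f) {N : ℕ} {D : Fin N → X.Opens} (hD : ∀ i, D i ≤ O)
    (s : Sec F V) (t : ∀ i, Sec F (D i))
    (ht : ∀ i, res (ab F) inf_le_left (t i) = res (ab F) (inf_le_right : D i ⊓ V ≤ V) s) :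
    ∃ m : ℕ, ∀ i k, res (ab F) (inf_le_left : D i ⊓ D k ≤ _) (resRing (hD i) f ^ m • t i) =
      res (ab F) inf_le_right (resRing (hD k) f ^ m • t k) := by
  obtain ⟨m, hm⟩ := exists_forall_of_finset Finset.univ
    (fun (i : Fin N × Fin N) m ↦ resRing (inf_le_left.trans (hD i.1)) f ^ m •
      (res (ab F) (inf_le_left : D i.1 ⊓ D i.2 ≤ _) (t i.1) - res (ab F) inf_le_right (t i.2)) = 0)
    (fun g n m hnm hn ↦ by
      obtain ⟨k, rfl⟩ := Nat.exists_eq_add_of_le' hnm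
      rw [pow_add, mul_smul, hn, smul_zero])
    (fun i _ ↦ hF.exists_pow_smul_eq_zero_of_isBasis hB _ (V := D i.1 ⊓ D i.2 ⊓ V)
      (by rw [hV, basicOpen_resRing]) inf_le_left _ (by
        rw [map_sub, res_res, res_res,
          ← res_res _ (le_inf (inf_le_left.trans inf_le_left) inf_le_right) inf_le_left (t i.1),
          ← res_res _ (le_inf (inf_le_left.trans inf_le_right) inf_le_right) inf_le_left (t i.2),
          ht, ht, res_res, res_res, sub_self]))
  refine ⟨m, fun i k ↦ ?_⟩
  have := hm (i, k) (Finset.mem_univ _)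
  rw [smul_sub, sub_eq_zero] at this
  rw [res_smul, res_smul]
  simpa only [map_pow, resRing_resRing] using this

lemma SectionsLocalizeOn.of_isBasis (C : Set X.Opens) : SectionsLocalizeOn C F where
  exists_pow_smul_eq_zero _ f _ hV h t ht :=
    hF.exists_pow_smul_eq_zero_of_isBasis hB f hV h t ht
  exists_res_eq {O} _ f V hV h s := by
    obtain ⟨N, D, hD, hD', hO⟩ := exists_finite_cover hB O
    obtain ⟨n, t, ht⟩ := hF.exists_res_eq_cover f hV h s hD hD'
    obtain ⟨m, hm⟩ := hF.exists_pow_smul_eq_on_overlaps hB f hV hD _ t ht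
    obtain ⟨x, hx⟩ := AbSheaf.exists_glue (ab F) D hD hO (fun i ↦ resRing (hD i) f ^ m • t i) hm
    refine ⟨m + n, x, AbSheaf.eq_of_locally_eq (ab F) (fun i ↦ D i ⊓ V) (fun i ↦ inf_le_right)
      ?_ fun i ↦ ?_⟩
    · rw [← iSup_inf_eq]
      exact le_inf (h.trans hO) le_rfl
    · rw [res_res, ← res_res _ inf_le_left (hD i), hx, res_smul, ht, pow_add, mul_smul,
        res_smul _ _ (_ ^ m)]
      simp only [map_pow, resRing_resRing]

end Basis

variable {F : X.Modules} (hF : SectionsLocalize F)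
include hF

lemma SectionsLocalize.sectionsLocalizeOn_univ : SectionsLocalizeOn Set.univ F :=
  hF.of_isBasis X.isBasis_affineOpens _

lemma SectionsLocalize.pushforward {Y : Scheme.{u}} (f : X ⟶ Y) :
    SectionsLocalize ((Scheme.Modules.pushforward f).obj F) := by
  refine ⟨fun {U} _ g V hV h s ↦ ?_, fun {U} _ g V hV h t ht ↦ ?_⟩
  · obtain ⟨n, t, ht⟩ := hF.sectionsLocalizeOn_univ.exists_res_eq trivial (f.app U g)
      (V := f ⁻¹ᵁ V) (by rw [hV, Scheme.preimage_basicOpen]) (f.preimage_mono h)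
      (secPushforward f F V s)
    refine ⟨n, (secPushforward f F U).symm t, (secPushforward f F V).injective ?_⟩
    rw [secPushforward_res, secPushforward_smul, AddEquiv.apply_symm_apply, ht, map_pow]
    congr 2
    exact congr($(f.naturality (homOfLE h).op) g).symm
  · obtain ⟨n, hn⟩ := hF.sectionsLocalizeOn_univ.exists_pow_smul_eq_zero trivial (f.app U g)
      (V := f ⁻¹ᵁ V) (by rw [hV, Scheme.preimage_basicOpen]) (f.preimage_mono h)
      (secPushforward f F U t)
      (by rw [← secPushforward_res f F h, ht, map_zero])
    refine ⟨n, (secPushforward f F U).injective ?_⟩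
    rw [secPushforward_smul, map_pow, hn, map_zero]

lemma SectionsLocalize.pushRes (W : X.Opens) : SectionsLocalize (pushRes W F) := by
  refine ⟨fun {U} _ g V hV h s ↦ ?_, fun {U} _ g V hV h t ht ↦ ?_⟩
  · obtain ⟨n, t, ht⟩ := hF.sectionsLocalizeOn_univ.exists_res_eq trivial
      (resRing (inf_le_right : W ⊓ U ≤ U) g) (V := W ⊓ V)
      (by rw [hV, basicOpen_resRing, inf_assoc, inf_eq_right.mpr (X.basicOpen_le g)])
      (inf_le_inf_left W h) (secPush W F V s)
    refine ⟨n, (secPush W F U).symm t, (secPush W F V).injective ?_⟩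
    rw [secPush_res, secPush_smul, AddEquiv.apply_symm_apply, ht]
    simp only [map_pow, resRing_resRing]
  · obtain ⟨n, hn⟩ := hF.sectionsLocalizeOn_univ.exists_pow_smul_eq_zero trivial
      (resRing (inf_le_right : W ⊓ U ≤ U) g) (V := W ⊓ V)
      (by rw [hV, basicOpen_resRing, inf_assoc, inf_eq_right.mpr (X.basicOpen_le g)])
      (inf_le_inf_left W h) (secPush W F U t) (by rw [← secPush_res W F h, ht, map_zero])
    exact ⟨n, (secPush W F U).injective (by rw [secPush_smul, map_pow, hn, map_zero])⟩

end Noetherian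

/-! ### The Čech embedding -/

section Cech

variable {X : Scheme.{u}} (F : X.Modules)

/-- The restriction map from `F` to `pushRes W F`. -/
def toPushRes (W : X.Opens) : F ⟶ pushRes W F := (exists_toPushRes W F).choose

lemma secPush_toPushRes (W : X.Opens) {U : X.Opens} (x : Sec F U) :
    secPush W F U (homSec (toPushRes F W) U x) = res (ab F) inf_le_right x :=
  (exists_toPushRes W F).choose_spec U x

variable {N : ℕ} (D : Fin N → X.Opens)

/-- The degree zero term `∏ j_{i*} j_i^* F` of the sheafified Čech complex of `F` with respect to
the open subsets `D i` with inclusions `j_i`. -/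
abbrev cechObj : X.Modules := ⨁ fun i ↦ pushRes (D i) F

/-- The augmentation of the sheafified Čech complex. -/
def cechMap : F ⟶ cechObj F D := biproduct.lift fun i ↦ toPushRes F (D i)

lemma eq_zero_of_cechMap {U : X.Opens} {x : Sec F U} (hx : homSec (cechMap F D) U x = 0)
    (i : Fin N) : res (ab F) (inf_le_right : D i ⊓ U ≤ U) x = 0 := by
  have := congr(homSec (biproduct.π _ i) U $hx)
  rw [← homSec_comp, cechMap, biproduct.lift_π, map_zero] at this
  rw [← secPush_toPushRes, this, map_zero]

lemma mono_cechMap (h : ⊤ ≤ ⨆ i, D i) : Mono (cechMap F D) := by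
  refine mono_of_injective_homSec _ fun U x hx ↦ ?_
  refine AbSheaf.eq_of_locally_eq (ab F) (fun i ↦ D i ⊓ U) (fun i ↦ inf_le_right) ?_ fun i ↦ ?_
  · rw [← iSup_inf_eq]
    exact le_inf (le_top.trans h) le_rfl
  · rw [eq_zero_of_cechMap F D hx, map_zero]

lemma isShortExact_cechMap (h : ⊤ ≤ ⨆ i, D i) :
    IsShortExact ((abF X).map (cechMap F D)) ((abF X).map (cokernel.π (cechMap F D))) :=
  have := mono_cechMap F D h
  isShortExact_cokernel _

variable {F} in
lemma SectionsLocalize.cechObj [NoetherianSpace X] (hF : SectionsLocalize F) :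
    SectionsLocalize (CdLci.cechObj F D) :=
  .biproduct fun i ↦ hF.pushRes (D i)

lemma comp_cechMap_eq_zero {n : ℕ} (hn : 1 ≤ n)
    (hF : ∀ (i : Fin N) (V : X.Opens), IsAffineOpen V → ∀ s, 1 ≤ s → s < n →
      Vanishes s (D i ⊓ V) (ab F))
    {U : X.Opens} (hU : ∀ i, D i ≤ U) (x : Ext (freeSheaf U) (ab F) n)
    (hx : ∀ i, resExt (hU i) x = 0) :
    x.comp (Ext.mk₀ ((abF X).map (cechMap F D))) (add_zero n) = 0 := by
  refine eq_zero_of_comp_biproduct_π _ _ fun i ↦ ?_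
  rw [Ext.comp_assoc _ _ _ (add_zero n) (add_zero 0) (by omega), Ext.mk₀_comp_mk₀,
    ← Functor.map_comp, cechMap, biproduct.lift_π]
  refine eq_zero_of_resExt_precomp_eq_zero (interFunctor (D i)) X.isBasis_affineOpens
    (F := ab F) hn (hF i) (hU i) (le_inf inf_le_left inf_le_left) _ ?_
  have := resExt_comp (hU i) x (Ext.mk₀ ((abF X).map (toPushRes F (D i)))) (add_zero n)
  rwa [hx, Ext.zero_comp] at this

end Cech

section Affine

lemma noetherianSpace_opens {X : Scheme.{u}} [NoetherianSpace X] (U : X.Opens) :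
    NoetherianSpace U.toScheme :=
  U.ι.isOpenEmbedding.isInducing.noetherianSpace

lemma vanishes_affine_iff_top {X : Scheme.{u}} (F : X.Modules) {n : ℕ} (hn : 1 ≤ n)
    (U : X.Opens) : Vanishes n U (ab F) ↔ Vanishes n ⊤ (ab (F.restrict U.ι)) := by
  rw [vanishes_restrict _ _ hn, Scheme.Opens.ι_image_top]

lemma vanishes_top_of_isAffine {n : ℕ} (hn : 1 ≤ n) {X : Scheme.{u}} [IsAffine X]
    [NoetherianSpace X] {F : X.Modules} (hF : SectionsLocalize F) : Vanishes n ⊤ (ab F) := by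
  induction n using Nat.strong_induction_on generalizing X F with
  | _ n ih =>
  have ih' (s : ℕ) (hs : 1 ≤ s) (hsn : s < n) (V : X.Opens) (hV : IsAffineOpen V) :
      Vanishes s V (ab F) := by
    rw [vanishes_affine_iff_top _ hs]
    have : IsAffine V.toScheme := hV
    have := noetherianSpace_opens V
    exact ih s hsn hs (hF.restrict V.ι)
  refine vanishes_iff.mpr fun x ↦ ?_
  obtain ⟨N, D, hD, hD', hx, hcov⟩ := exists_finite_cover_of X.isBasis_affineOpens ⊤
    (fun V hV ↦ resExt hV x = 0) (fun h h' hx ↦ by rw [← resExt_resExt h h', hx, resExt_zero])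
    (fun p hp ↦ exists_resExt_eq_zero hn x hp)
  have h0 := comp_cechMap_eq_zero F D hn
    (fun i V hV s hs hsn ↦ ih' s hs hsn _ ((hD' i).inf hV)) hD x hx
  have hses := isShortExact_cechMap F D hcov
  have hC := hF.cechObj D
  obtain rfl | hn1 := hn.eq_or_lt
  · obtain ⟨z, rfl⟩ := hses.exists_conn_eq x h0
    rw [hses.conn_eq_zero_iff]
    exact hses.surjective_homSec hF hC (isAffineOpen_top X) z
  · obtain ⟨m, rfl⟩ := Nat.exists_eq_add_of_lt hn1
    obtain ⟨y, rfl⟩ := Ext.covariant_sequence_exact₁ (freeSheaf ⊤) hses.shortExact x h0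
      (n₀ := 1 + m) rfl
    rw [vanishes_iff.mp (ih (1 + m) (by omega) (by omega) (hses.sectionsLocalize hF hC)) y,
      Ext.zero_comp]

variable {X : Scheme.{u}} [NoetherianSpace X] {F : X.Modules} (hF : SectionsLocalize F)
include hF

theorem SectionsLocalize.vanishes_affine {n : ℕ} (hn : 1 ≤ n) {U : X.Opens}
    (hU : IsAffineOpen U) : Vanishes n U (ab F) := by
  rw [vanishes_affine_iff_top _ hn]
  have : IsAffine U.toScheme := hU
  have := noetherianSpace_opens U
  exact vanishes_top_of_isAffine hn (hF.restrict U.ι)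

variable [X.IsSeparated]

lemma SectionsLocalize.vanishes_pushRes {W : X.Opens} (hW : IsAffineOpen W) {n : ℕ} (hn : 1 ≤ n)
    (U : X.Opens) :
    Vanishes n U (ab (CdLci.pushRes W F)) ↔ Vanishes n (W ⊓ U) (ab F) :=
  vanishes_precomp_iff_of_basis (interFunctor W) X.isBasis_affineOpens
    (fun _ hV _ hn ↦ hF.vanishes_affine hn (hW.inf hV)) hn U

lemma SectionsLocalize.vanishes_cechObj {N : ℕ} {D : Fin N → X.Opens}
    (hD : ∀ i, IsAffineOpen (D i)) {n : ℕ} (hn : 1 ≤ n) (U : X.Opens)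
    (hU : ∀ i, IsAffineOpen (D i ⊓ U)) : Vanishes n U (ab (CdLci.cechObj F D)) :=
  vanishes_biproduct _ fun i ↦
    (hF.vanishes_pushRes (hD i) hn U).mpr (hF.vanishes_affine hn (hU i))

end Affine

section Quasicoherent

section Spec

variable {R : CommRingCat.{u}} {M : (Spec R).Modules}

lemma smul_sec_Spec {U : (Spec R).Opens} (r : R) (x : Γ(M, U)) :
    r • x = (resRing (le_top : U ≤ ⊤) ((Scheme.ΓSpecIso R).inv r) •
      (show Sec M U from x) : Sec M U) :=
  rfl

lemma SectionsLocalize.isLocalizing_spec (h : SectionsLocalize M) :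
    IsLocalizing (modulesSpecToSheaf.obj M) := by
  intro f
  refine ⟨?_, ?_, ?_⟩
  · rintro ⟨_, n, rfl⟩
    rw [map_pow]
    exact (Scheme.Modules.isUnit_algebraMap_end_of_le_basicOpen f le_rfl).pow n
  · intro y
    obtain ⟨n, t, ht⟩ := h.exists_res_eq (isAffineOpen_top (Spec R)) ((Scheme.ΓSpecIso R).inv f)
      (basicOpen_eq_of_affine f).symm le_top y
    refine ⟨⟨t, ⟨f ^ n, n, rfl⟩⟩, ?_⟩
    refine Eq.trans ?_ ht.symm
    refine (smul_sec_Spec (f ^ n) _).trans ?_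
    rw [map_pow, map_pow]
  · intro x y hxy
    obtain ⟨n, hn⟩ := h.exists_pow_smul_eq_zero (isAffineOpen_top (Spec R))
      ((Scheme.ΓSpecIso R).inv f) (basicOpen_eq_of_affine f).symm le_top ((show Sec M ⊤ from x) -
        (show Sec M ⊤ from y)) (by
        rw [map_sub, sub_eq_zero]; exact hxy)
    rw [smul_sub, sub_eq_zero] at hn
    refine ⟨⟨f ^ n, n, rfl⟩, ?_⟩
    have h₀ (z : Sec M ⊤) : (show Γ(M, ⊤) from f ^ n • (show Γ(M, ⊤) from z)) =
        (Scheme.ΓSpecIso R).inv f ^ n • z := by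
      rw [smul_sec_Spec, map_pow, resRing_self]
    exact (h₀ x).trans (hn.trans (h₀ y).symm)

lemma exists_res_eq_of_isLocalizing_spec (h : IsLocalizing (modulesSpecToSheaf.obj M)) (f : R)
    {D : (Spec R).Opens} (hD : D = PrimeSpectrum.basicOpen f) (s : Sec M D) :
    ∃ (n : ℕ) (t : Sec M ⊤), res (ab M) le_top t =
      resRing (le_top : D ≤ ⊤) ((Scheme.ΓSpecIso R).inv f) ^ n • s := by
  subst hD
  obtain ⟨⟨t, ⟨_, n, rfl⟩⟩, hn⟩ := (h f).surj s
  refine ⟨n, t, Eq.trans hn.symm ?_⟩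
  have := smul_sec_Spec (M := M) (f ^ n) s
  rw [map_pow, map_pow] at this
  exact this

lemma exists_pow_smul_eq_zero_of_isLocalizing_spec (h : IsLocalizing (modulesSpecToSheaf.obj M))
    (f : R) {D : (Spec R).Opens} (hD : D = PrimeSpectrum.basicOpen f) (t : Sec M ⊤)
    (ht : res (ab M) (le_top : D ≤ ⊤) t = 0) :
    ∃ n : ℕ, (Scheme.ΓSpecIso R).inv f ^ n • t = 0 := by
  subst hD
  obtain ⟨⟨_, n, rfl⟩, hn⟩ := (h f).exists_of_eq (x₁ := t) (x₂ := 0) (by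
    rw [map_zero]; exact ht)
  have := smul_sec_Spec (M := M) (f ^ n) t
  rw [map_pow, resRing_self] at this
  rw [smul_zero] at hn
  exact ⟨n, this.symm.trans hn⟩

end Spec

variable {X : Scheme.{u}} {M : X.Modules}

/-- Transports a presentation of `M|_U` from the open subscheme `U` to the slice site over `U`. -/
def presentationOver (U : X.Opens) (P : (M.restrict U.ι).Presentation) :
    (M.over U).Presentation := by
  let e : SheafOfModules (X.ringCatSheaf.over U) ≌ SheafOfModules U.toScheme.ringCatSheaf :=
    Scheme.Modules.overEquiv U
  let i : e.inverse.obj (M.restrict U.ι) ≅ M.over U :=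
    e.inverse.mapIso ((Scheme.Modules.overFunctorEquiv U).app M).symm ≪≫
      (e.unitIso.app (M.over U)).symm
  have : PreservesColimitsOfSize.{u, u} e.inverse :=
    e.symm.toAdjunction.leftAdjoint_preservesColimits
  let η : e.functor.obj (SheafOfModules.unit (X.ringCatSheaf.over U)) ≅
    SheafOfModules.unit U.toScheme.ringCatSheaf := Iso.refl _
  exact SheafOfModules.Presentation.ofIsIso.{u, u, u} i.hom
    (P.map e.inverse (e.unitIso.app _ ≪≫ e.inverse.mapIso η))

lemma SectionsLocalize.nonempty_presentation (h : SectionsLocalize M) {U : X.Opens}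
    (hU : IsAffineOpen U) : Nonempty (M.restrict U.ι).Presentation := by
  let N : (Spec Γ(X, U)).Modules := M.restrict hU.fromSpec
  have hN : SectionsLocalize N := h.restrict _
  have hN' : IsIso N.fromTildeΓ :=
    (isIso_fromTildeΓ_iff_isLocalizing N).mpr hN.isLocalizing_spec
  let P₁ := presentationTilde (moduleSpecΓFunctor.obj N) Set.univ Submodule.span_univ _
    (Submodule.span_eq _)
  let P₂ : N.Presentation := @SheafOfModules.Presentation.ofIsIso.{u, u, u} _ _ _ _ _ _ _ _
    N.fromTildeΓ hN' P₁
  let P₃ := Scheme.Modules.presentationRestrict hU.isoSpec.hom P₂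
  have e : hU.isoSpec.hom ≫ hU.fromSpec = U.ι := by simp
  have i : (M.restrict hU.fromSpec).restrict hU.isoSpec.hom ≅ M.restrict U.ι :=
    ((Scheme.Modules.restrictFunctorComp _ _).symm ≪≫
      Scheme.Modules.restrictFunctorCongr e).app M
  exact ⟨@SheafOfModules.Presentation.ofIsIso.{u, u, u} _ _ _ _ _ _ _ _ i.hom
    (inferInstanceAs (IsIso i.hom)) P₃⟩

lemma SectionsLocalize.isQuasicoherent (h : SectionsLocalize M) : M.IsQuasicoherent := by
  refine SheafOfModules.QuasicoherentData.isQuasicoherent.{u}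
    { I := X.affineOpens
      X := fun U ↦ U.1
      coversTop := ?_
      presentation := fun U ↦ presentationOver U.1 (h.nonempty_presentation U.2).some }
  rw [Opens.coversTop_iff]
  exact eq_top_iff.mpr fun p _ ↦ by
    obtain ⟨V, hV, hp, -⟩ := exists_affine_mem_le (X := X) (U := ⊤) (p := p) trivial
    exact Opens.mem_iSup.mpr ⟨⟨V, hV⟩, hp⟩

lemma appIso_fromSpec_inv {U : X.Opens} (hU : IsAffineOpen U) (f : Γ(X, U))
    (D : (Spec Γ(X, U)).Opens) (h : hU.fromSpec ''ᵁ D ≤ U) :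
    (hU.fromSpec.appIso D).inv (resRing le_top ((Scheme.ΓSpecIso _).inv f)) = resRing h f := by
  have : Function.Injective (hU.fromSpec.appIso D).hom :=
    (ConcreteCategory.bijective_of_isIso (hU.fromSpec.appIso D).hom).injective
  apply this
  rw [← ConcreteCategory.comp_apply, Iso.inv_hom_id, Scheme.Hom.appIso_hom]
  have h₁ : resRing h f = X.presheaf.map (homOfLE h).op f := rfl
  rw [h₁, ← ConcreteCategory.comp_apply, ← Category.assoc, hU.fromSpec.naturality,
    hU.fromSpec_app_self, Category.assoc, Category.assoc, ← Functor.map_comp, ← Functor.map_comp]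
  rfl

lemma isLocalizing_restrict_fromSpec (M : X.Modules) [M.IsQuasicoherent] {U : X.Opens}
    (hU : IsAffineOpen U) : IsLocalizing (modulesSpecToSheaf.obj (M.restrict hU.fromSpec)) := by
  have hM : (M.restrict hU.fromSpec).IsQuasicoherent :=
    Scheme.Modules.isQuasicoherent_restrictFunctor hU.fromSpec M
  exact (isIso_fromTildeΓ_iff_isLocalizing _).mp ((isQuasicoherent_iff_isIso_fromTildeΓ _).mp hM)

lemma exists_eq_basicOpen_fromSpec_image_eq {U : X.Opens} (hU : IsAffineOpen U) (f : Γ(X, U))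
    {V : X.Opens} (hV : V = X.basicOpen f) : ∃ D : (Spec Γ(X, U)).Opens,
      D = PrimeSpectrum.basicOpen f ∧ hU.fromSpec ''ᵁ D = V :=
  ⟨_, rfl, hV ▸ hU.fromSpec_image_basicOpen f⟩

lemma exists_res_eq_of_isQuasicoherent (M : X.Modules) [M.IsQuasicoherent] {U : X.Opens}
    (hU : IsAffineOpen U) (f : Γ(X, U)) {V : X.Opens} (hV : V = X.basicOpen f) (h : V ≤ U)
    (s : Sec M V) : ∃ (n : ℕ) (t : Sec M U), res (ab M) h t = resRing h f ^ n • s := by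
  have hU' : hU.fromSpec ''ᵁ ⊤ = U := by simp
  obtain ⟨D, hD, hDV⟩ := exists_eq_basicOpen_fromSpec_image_eq hU f hV
  obtain ⟨n, t, hn⟩ := exists_res_eq_of_isLocalizing_spec (isLocalizing_restrict_fromSpec M hU) f hD
    ((secRestrict hU.fromSpec M D).symm (res (ab M) hDV.le s))
  have hn' := congr(res (ab M) hDV.ge (secRestrict hU.fromSpec M D $hn))
  rw [secRestrict_res, secRestrict_smul, AddEquiv.apply_symm_apply, map_pow,
    appIso_fromSpec_inv hU f _ (hDV.le.trans h), res_res, res_smul, res_res, res_self, map_pow,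
    resRing_resRing] at hn'
  exact ⟨n, res (ab M) hU'.ge (secRestrict hU.fromSpec M ⊤ t), by rw [res_res, hn']⟩

lemma exists_pow_smul_eq_zero_of_isQuasicoherent (M : X.Modules) [M.IsQuasicoherent]
    {U : X.Opens} (hU : IsAffineOpen U) (f : Γ(X, U)) {V : X.Opens} (hV : V = X.basicOpen f)
    (h : V ≤ U) (t : Sec M U) (ht : res (ab M) h t = 0) : ∃ n : ℕ, f ^ n • t = 0 := by
  have hU' : hU.fromSpec ''ᵁ ⊤ = U := by simp
  obtain ⟨D, hD, hDV⟩ := exists_eq_basicOpen_fromSpec_image_eq hU f hV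
  obtain ⟨n, hn⟩ := exists_pow_smul_eq_zero_of_isLocalizing_spec
    (isLocalizing_restrict_fromSpec M hU) f hD
    ((secRestrict hU.fromSpec M ⊤).symm (res (ab M) hU'.le t)) (by
      apply (secRestrict hU.fromSpec M D).injective
      rw [secRestrict_res _ _ le_top, AddEquiv.apply_symm_apply, res_res,
        ← res_res _ hDV.le h, ht, map_zero, map_zero])
  have hf := appIso_fromSpec_inv hU f ⊤ hU'.le
  rw [resRing_self] at hf
  have hn' := congr(res (ab M) hU'.ge (secRestrict hU.fromSpec M ⊤ $hn))
  rw [secRestrict_smul, AddEquiv.apply_symm_apply, map_pow, hf, map_zero, res_smul, res_res,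
    res_self, map_pow, resRing_resRing, resRing_self, map_zero] at hn'
  exact ⟨n, hn'⟩

lemma sectionsLocalize_iff_isQuasicoherent : SectionsLocalize M ↔ M.IsQuasicoherent where
  mp h := h.isQuasicoherent
  mpr _ :=
    { exists_res_eq := fun hU f _ hV h s ↦ exists_res_eq_of_isQuasicoherent M hU f hV h s
      exists_pow_smul_eq_zero := fun hU f _ hV h t ht ↦
        exists_pow_smul_eq_zero_of_isQuasicoherent M hU f hV h t ht }

end Quasicoherent

section Functoriality

variable {X : Scheme.{u}}

lemma exists_homSec_eq_of_locally {F G : X.Modules} (φ : F ⟶ G)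
    (hφ : ∀ U x, homSec φ U x = 0 → x = 0) {ι : Type*} {U : X.Opens} (V : ι → X.Opens)
    (hV : ∀ i, V i ≤ U) (hU : U ≤ ⨆ i, V i) (x : Sec G U)
    (h : ∀ i, ∃ y, homSec φ (V i) y = res (ab G) (hV i) x) : ∃ y, homSec φ U y = x := by
  choose s hs using h
  obtain ⟨y, hy⟩ := AbSheaf.exists_glue (ab F) V hV hU s fun i j ↦ by
    rw [← sub_eq_zero]
    apply hφ
    rw [map_sub, secMap_res, secMap_res, hs, hs, res_res, res_res, sub_self]
  exact ⟨y, AbSheaf.eq_of_locally_eq (ab G) V hV hU fun i ↦ by rw [← secMap_res, hy, hs]⟩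

lemma exists_homSec_eq_of_forall_mem {F G : X.Modules} (φ : F ⟶ G)
    (hφ : ∀ U x, homSec φ U x = 0 → x = 0) {U : X.Opens} (x : Sec G U)
    (h : ∀ p ∈ U, ∃ (V : X.Opens) (hV : V ≤ U), p ∈ V ∧ ∃ y, homSec φ V y = res (ab G) hV x) :
    ∃ y, homSec φ U y = x := by
  choose V hV hpV hy using fun p : U ↦ h p.1 p.2
  exact exists_homSec_eq_of_locally φ hφ V hV
    (fun p hp ↦ Opens.mem_iSup.mpr ⟨⟨p, hp⟩, hpV _⟩) x hy

lemma exists_pushResMap (W : X.Opens) {F G : X.Modules} (φ : F ⟶ G) :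
    ∃ ψ : pushRes W F ⟶ pushRes W G, ∀ U x,
      secPush W G U (homSec ψ U x) = homSec φ (W ⊓ U) (secPush W F U x) := by
  obtain ⟨ψ, hψ⟩ := exists_hom_of_linear (M := pushRes W F) (N := pushRes W G)
    ((precomp (interFunctor W)).map ((abF X).map φ)) (fun U r x ↦ homSec_smul φ _ _)
  exact ⟨ψ, fun U x ↦ by rw [homSec, hψ]; rfl⟩

/-- The map `j_* j^* F ⟶ j_* j^* G` induced by `φ : F ⟶ G`, for the inclusion `j` of `W`. -/
def pushResMap (W : X.Opens) {F G : X.Modules} (φ : F ⟶ G) : pushRes W F ⟶ pushRes W G :=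
  (exists_pushResMap W φ).choose

lemma secPush_pushResMap (W : X.Opens) {F G : X.Modules} (φ : F ⟶ G) {U : X.Opens}
    (x : Sec (pushRes W F) U) :
    secPush W G U (homSec (pushResMap W φ) U x) = homSec φ (W ⊓ U) (secPush W F U x) :=
  (exists_pushResMap W φ).choose_spec U x

variable {N : ℕ} (D : Fin N → X.Opens) {F G : X.Modules} (φ : F ⟶ G)

/-- The map induced by `φ : F ⟶ G` on the targets of the maps `cechMap`. -/
def cechObjMap : cechObj F D ⟶ cechObj G D :=
  biproduct.map fun i ↦ pushResMap (D i) φ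

lemma π_cechObjMap (i : Fin N) {U : X.Opens} (x : Sec (cechObj F D) U) :
    homSec (biproduct.π _ i) U (homSec (cechObjMap D φ) U x) =
      homSec (pushResMap (D i) φ) U (homSec (biproduct.π _ i) U x) := by
  rw [← homSec_comp, cechObjMap, biproduct.map_π, homSec_comp]

lemma π_cechMap (i : Fin N) {U : X.Opens} (x : Sec F U) :
    homSec (biproduct.π _ i) U (homSec (cechMap F D) U x) = homSec (toPushRes F (D i)) U x := by
  rw [← homSec_comp, cechMap, biproduct.lift_π]

lemma cechMap_naturality : cechMap F D ≫ cechObjMap D φ = φ ≫ cechMap G D := by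
  refine modules_hom_ext fun U x ↦ biproduct_sec_ext _ fun i ↦ ?_
  rw [homSec_comp, homSec_comp, π_cechObjMap, π_cechMap, π_cechMap]
  apply (secPush (D i) G U).injective
  rw [secPush_pushResMap, secPush_toPushRes, secPush_toPushRes, secMap_res]

end Functoriality

section Exhaustion

variable {X : Scheme.{u}}

/-- `N` is the increasing union of the submodules `P n`, embedded by `φ n`; the union is already
taken on the level of sections. -/
structure Exhausts (N : X.Modules) (P : ℕ → X.Modules) (φ : ∀ n, P n ⟶ N) : Prop where
  inj : ∀ n U x, homSec (φ n) U x = 0 → x = 0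
  mono : ∀ {n m}, n ≤ m → ∀ U x, ∃ y, homSec (φ m) U y = homSec (φ n) U x
  exh : ∀ U x, ∃ n y, homSec (φ n) U y = x

variable {N : X.Modules} {P : ℕ → X.Modules} {φ : ∀ n, P n ⟶ N} (h : Exhausts N P φ)
  {k : ℕ} (D : Fin k → X.Opens) (hD : ⊤ ≤ ⨆ i, D i)
include h

omit h in
lemma exists_cechObjMap_eq {U : X.Opens} (c : Sec (cechObj N D) U) {n : ℕ}
    (hc : ∀ i, ∃ y, homSec (φ n) (D i ⊓ U) y = secPush (D i) N U (homSec (biproduct.π _ i) U c)) :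
    ∃ c', homSec (cechObjMap D (φ n)) U c' = c := by
  choose y hy using hc
  obtain ⟨c', hc'⟩ := exists_biproduct_sec (fun i ↦ pushRes (D i) (P n))
    (fun i ↦ (secPush (D i) (P n) U).symm (y i))
  refine ⟨c', biproduct_sec_ext _ fun i ↦ (secPush (D i) N U).injective ?_⟩
  rw [π_cechObjMap, hc', secPush_pushResMap, AddEquiv.apply_symm_apply, hy]

lemma Exhausts.cechObjMap_inj (n : ℕ) (U : X.Opens) (c : Sec (cechObj (P n) D) U)
    (hc : homSec (cechObjMap D (φ n)) U c = 0) : c = 0 := by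
  refine biproduct_sec_ext _ fun i ↦ (secPush (D i) (P n) U).injective ?_
  rw [map_zero, map_zero]
  apply h.inj n
  rw [← secPush_pushResMap, ← π_cechObjMap, hc, map_zero, map_zero]

/-- The map induced on the cokernels of the maps `cechMap`. -/
def cechCokernelMap (φ : ∀ n, P n ⟶ N) (n : ℕ) :
    cokernel (cechMap (P n) D) ⟶ cokernel (cechMap N D) :=
  cokernel.map _ _ (φ n) (cechObjMap D (φ n)) (cechMap_naturality D (φ n))

omit h in
lemma cechCokernelMap_π (n : ℕ) {U : X.Opens} (c : Sec (cechObj (P n) D) U) :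
    homSec (cechCokernelMap D φ n) U (homSec (cokernel.π (cechMap (P n) D)) U c) =
      homSec (cokernel.π (cechMap N D)) U (homSec (cechObjMap D (φ n)) U c) := by
  rw [← homSec_comp, cechCokernelMap, cokernel.π_desc, homSec_comp]

include hD in
lemma Exhausts.cechCokernelMap_inj (n : ℕ) (U : X.Opens) (z : Sec (cokernel (cechMap (P n) D)) U)
    (hz : homSec (cechCokernelMap D φ n) U z = 0) : z = 0 := by
  have hs := isShortExact_cechMap (P n) D hD
  have hs' := isShortExact_cechMap N D hD
  choose V hV c hp hc using fun p : U ↦ hs.surj U z p.1 p.2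
  refine AbSheaf.eq_of_locally_eq _ V hV (fun p hp' ↦ Opens.mem_iSup.mpr ⟨⟨p, hp'⟩, hp _⟩)
    fun p ↦ ?_
  rw [← hc, map_zero]
  obtain ⟨x, hx⟩ := hs'.exact (V p) (homSec (cechObjMap D (φ n)) _ (c p)) (by
    rw [← cechCokernelMap_π, hc, secMap_res, hz, map_zero])
  obtain ⟨x', rfl⟩ := exists_homSec_eq_of_locally (φ n) (h.inj n) (fun i ↦ D i ⊓ V p)
    (fun i ↦ inf_le_right) (by rw [← iSup_inf_eq]; exact le_inf (le_top.trans hD) le_rfl) x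
    (fun i ↦ ⟨secPush (D i) (P n) _ (homSec (biproduct.π _ i) _ (c p)), by
      rw [← secPush_pushResMap, ← π_cechObjMap, ← hx, π_cechMap, secPush_toPushRes]⟩)
  have : c p = homSec (cechMap (P n) D) _ x' := by
    rw [← sub_eq_zero]
    apply h.cechObjMap_inj D
    rw [map_sub, ← hx, ← homSec_comp, ← homSec_comp, cechMap_naturality, sub_self]
  rw [this, hs.zero]

include hD in
lemma Exhausts.cechCokernelMap_mono {n m : ℕ} (hnm : n ≤ m) (U : X.Opens)
    (z : Sec (cokernel (cechMap (P n) D)) U) :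
    ∃ y, homSec (cechCokernelMap D φ m) U y = homSec (cechCokernelMap D φ n) U z := by
  refine exists_homSec_eq_of_forall_mem _ (h.cechCokernelMap_inj D hD m) _ fun p hp ↦ ?_
  obtain ⟨V, hV, c, hpV, hc⟩ := (isShortExact_cechMap (P n) D hD).surj U z p hp
  obtain ⟨c', hc'⟩ := exists_cechObjMap_eq D (homSec (cechObjMap D (φ n)) _ c) (n := m)
    (fun i ↦ by
      rw [π_cechObjMap, secPush_pushResMap]
      exact h.mono hnm _ _)
  refine ⟨V, hV, hpV, homSec (cokernel.π (cechMap (P m) D)) V c', ?_⟩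
  rw [cechCokernelMap_π, hc', ← cechCokernelMap_π, hc, secMap_res]

include hD in
lemma Exhausts.exists_cechCokernelMap_eq_res {U : X.Opens} (z : Sec (cokernel (cechMap N D)) U)
    {p : X} (hp : p ∈ U) : ∃ (V : X.Opens) (hV : V ≤ U), p ∈ V ∧
      ∃ n y, homSec (cechCokernelMap D φ n) V y = res _ hV z := by
  obtain ⟨V, hV, c, hpV, hc⟩ := (isShortExact_cechMap N D hD).surj U z p hp
  obtain ⟨n, hn⟩ := exists_forall_of_finset Finset.univ
    (fun i n ↦ ∃ y, homSec (φ n) (D i ⊓ V) y = secPush (D i) N V (homSec (biproduct.π _ i) V c))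
    (fun i n m hnm ⟨y, hy⟩ ↦ hy ▸ h.mono hnm _ y) (fun i _ ↦ h.exh _ _)
  obtain ⟨c', hc'⟩ := exists_cechObjMap_eq D c (n := n) fun i ↦ hn i (Finset.mem_univ i)
  refine ⟨V, hV, hpV, n, homSec (cokernel.π (cechMap (P n) D)) V c', ?_⟩
  rw [cechCokernelMap_π, hc', hc]

include hD in
lemma Exhausts.cokernel [NoetherianSpace X] :
    Exhausts (cokernel (cechMap N D)) (fun n ↦ cokernel (cechMap (P n) D))
      (cechCokernelMap D φ) := by
  refine ⟨h.cechCokernelMap_inj D hD, h.cechCokernelMap_mono D hD, fun U z ↦ ?_⟩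
  obtain ⟨K, V, hV, -, hc, hcov⟩ := exists_finite_cover_of X.isBasis_affineOpens U
    (fun V hV ↦ ∃ n y, homSec (cechCokernelMap D φ n) V y = res _ hV z)
    (fun h h' ⟨n, y, hy⟩ ↦ ⟨n, res _ h y, by rw [secMap_res, hy, res_res]⟩)
    (fun p hp ↦ h.exists_cechCokernelMap_eq_res D hD z hp)
  obtain ⟨n, hn⟩ := exists_forall_of_finset Finset.univ
    (fun i n ↦ ∃ y, homSec (cechCokernelMap D φ n) (V i) y = res _ (hV i) z)
    (fun i n m hnm ⟨y, hy⟩ ↦ hy ▸ h.cechCokernelMap_mono D hD hnm _ y) (fun i _ ↦ hc i)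
  exact ⟨n, exists_homSec_eq_of_locally _ (h.cechCokernelMap_inj D hD n) V hV hcov z
    fun i ↦ hn i (Finset.mem_univ i)⟩

omit h in
lemma extClass_cechMap_comp_mk₀ (hD : ⊤ ≤ ⨆ i, D i) (n : ℕ) :
    (isShortExact_cechMap (P n) D hD).shortExact.extClass.comp
      (Ext.mk₀ ((abF X).map (φ n))) (add_zero 1) =
    (Ext.mk₀ ((abF X).map (cechCokernelMap D φ n))).comp
      (isShortExact_cechMap N D hD).shortExact.extClass (zero_add 1) :=
  ShortComplex.ShortExact.extClass_naturality (isShortExact_cechMap (P n) D hD).shortExact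
    (isShortExact_cechMap N D hD).shortExact
    { τ₁ := (abF X).map (φ n)
      τ₂ := (abF X).map (cechObjMap D (φ n))
      τ₃ := (abF X).map (cechCokernelMap D φ n)
      comm₁₂ := by
        dsimp only
        rw [← Functor.map_comp, ← Functor.map_comp, cechMap_naturality]
      comm₂₃ := by
        dsimp only
        rw [← Functor.map_comp, ← Functor.map_comp, cechCokernelMap, cokernel.π_desc] }

omit h in
theorem Exhausts.exists_comp_mk₀_eq [NoetherianSpace X] [X.IsSeparated] {N : X.Modules}
    {P : ℕ → X.Modules} {φ : ∀ n, P n ⟶ N} (h : Exhausts N P φ) (hN : SectionsLocalize N) {t : ℕ}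
    (x : Ext (freeSheaf ⊤) (ab N) t) : ∃ (n : ℕ) (y : Ext (freeSheaf ⊤) (ab (P n)) t),
      y.comp (Ext.mk₀ ((abF X).map (φ n))) (add_zero t) = x := by
  induction t generalizing N P with
  | zero =>
    obtain ⟨a, rfl⟩ := (Ext.mk₀_bijective _ _).surjective x
    obtain ⟨n, y, hy⟩ := h.exh ⊤ (freeSheafEquiv _ _ a)
    refine ⟨n, Ext.mk₀ ((freeSheafEquiv _ _).symm y), ?_⟩
    rw [Ext.mk₀_comp_mk₀]
    congr 1
    apply (freeSheafEquiv _ _).injective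
    rw [freeSheafEquiv_comp, Equiv.apply_symm_apply, ← hy]
  | succ t ih =>
    obtain ⟨k, D, -, hD', hD⟩ := exists_finite_cover X.isBasis_affineOpens ⊤
    have hs := isShortExact_cechMap N D hD
    have cechObj_acyclic : Vanishes (t + 1) ⊤ (ab (cechObj N D)) :=
      hN.vanishes_cechObj hD' (by omega) ⊤ fun i ↦ by rw [inf_top_eq]; exact hD' i
    obtain ⟨y, rfl⟩ := Ext.covariant_sequence_exact₁ (freeSheaf ⊤) hs.shortExact x
      (vanishes_iff.mp cechObj_acyclic _) rfl
    obtain ⟨n, y', rfl⟩ := ih (h.cokernel D hD) (hs.sectionsLocalize hN (hN.cechObj D)) y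
    refine ⟨n, y'.comp (isShortExact_cechMap (P n) D hD).shortExact.extClass rfl, ?_⟩
    rw [Ext.comp_assoc _ _ _ rfl (add_zero 1) (by omega), extClass_cechMap_comp_mk₀ D hD,
      Ext.comp_assoc _ _ _ (add_zero t) (zero_add 1) (by omega)]

lemma Exhausts.vanishes [NoetherianSpace X] [X.IsSeparated] (hN : SectionsLocalize N) {t : ℕ}
    (hP : ∀ n, Vanishes t ⊤ (ab (P n))) : Vanishes t ⊤ (ab N) :=
  vanishes_iff.mpr fun x ↦ by
    obtain ⟨n, y, rfl⟩ := h.exists_comp_mk₀_eq hN x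
    rw [vanishes_iff.mp (hP n) y, Ext.zero_comp]

end Exhaustion

lemma app_resRing {S X : Scheme.{u}} (i : S ⟶ X) {W V : X.Opens} (h : W ≤ V) (a : Γ(X, V)) :
    i.app W (resRing h a) = resRing (i.preimage_mono h) (i.app V a) :=
  congr($(i.naturality (homOfLE h).op) a)

section Descent

variable {X : Scheme.{u}} (I : X.IdealSheafData)

/-- The largest open subset of `X` whose intersection with the closed subscheme of `I` is `V`. -/
def extOpen (V : I.subscheme.Opens) : X.Opens :=
  ⟨(I.subschemeι '' (V : Set I.subscheme)ᶜ)ᶜ,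
    (I.subschemeι.isClosedEmbedding.isClosedMap _ V.isOpen.isClosed_compl).isOpen_compl⟩

lemma mem_extOpen {V : I.subscheme.Opens} {p : X} :
    p ∈ extOpen I V ↔ ∀ q, I.subschemeι q = p → q ∈ V := by
  change ¬ (∃ q, q ∉ V ∧ _) ↔ _
  grind

lemma le_extOpen_iff {V : I.subscheme.Opens} {W : X.Opens} :
    W ≤ extOpen I V ↔ I.subschemeι ⁻¹ᵁ W ≤ V :=
  ⟨fun h q hq ↦ (mem_extOpen I).mp (h hq) q rfl,
    fun h p hp ↦ (mem_extOpen I).mpr fun q hq ↦ h (by subst hq; exact hp)⟩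

lemma extOpen_mono {V V' : I.subscheme.Opens} (h : V ≤ V') : extOpen I V ≤ extOpen I V' :=
  fun _ hp ↦ (mem_extOpen I).mpr fun q hq ↦ h ((mem_extOpen I).mp hp q hq)

/-- The complement of the closed subscheme of `I`. -/
def complOpen : X.Opens := I.support.compl

lemma mem_complOpen {p : X} : p ∈ complOpen I ↔ ∀ q, I.subschemeι q ≠ p := by
  change p ∉ (I.support : Set X) ↔ _
  rw [← I.range_subschemeι]
  exact not_exists

lemma preimage_extOpen (V : I.subscheme.Opens) : I.subschemeι ⁻¹ᵁ extOpen I V = V := by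
  ext q
  change I.subschemeι q ∈ extOpen I V ↔ _
  rw [mem_extOpen]
  exact ⟨fun h ↦ h q rfl, fun h q' hq' ↦ I.subschemeι.isClosedEmbedding.injective hq' ▸ h⟩

/-- The module `N` has no nonzero sections off the closed subscheme of `I`. -/
def IsSupportedOn (N : X.Modules) : Prop :=
  ∀ V : X.Opens, V ≤ complOpen I → ∀ x : Sec N V, x = 0

/-- The ideal sheaf `I` annihilates the module `N`. -/
def IsKilledBy (N : X.Modules) : Prop :=
  ∀ V : X.affineOpens, ∀ a ∈ I.ideal V, ∀ x : Sec N V.1, a • x = 0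

variable {I} {N : X.Modules}

section Support

variable (hZ : IsSupportedOn I N)
include hZ

lemma eq_zero_of_res_of_le_sup {W O : X.Opens} (h : W ≤ O) (hO : O ≤ W ⊔ complOpen I) {x : Sec N O}
    (hx : res (ab N) h x = 0) : x = 0 := by
  refine AbSheaf.eq_of_locally_eq (ab N) (fun b : Bool ↦ bif b then W else O ⊓ complOpen I)
    (fun b ↦ by cases b; exacts [inf_le_left, h]) (fun p hp ↦ ?_) fun b ↦ ?_
  · rcases hO hp with hp' | hp'
    · exact Opens.mem_iSup.mpr ⟨true, hp'⟩
    · exact Opens.mem_iSup.mpr ⟨false, hp, hp'⟩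
  · cases b
    · exact (hZ (O ⊓ complOpen I) inf_le_right _).trans (hZ _ inf_le_right _).symm
    · exact hx.trans (map_zero _).symm

lemma exists_res_eq_of_le_sup {W O : X.Opens} (h : W ≤ O) (hO : O ≤ W ⊔ complOpen I)
    (x : Sec N W) : ∃ y : Sec N O, res (ab N) h y = x := by
  obtain ⟨y, hy⟩ := AbSheaf.exists_glue (ab N) (fun b : Bool ↦ bif b then W else O ⊓ complOpen I)
    (fun b ↦ by cases b; exacts [inf_le_left, h]) (fun p hp ↦ by
      rcases hO hp with hp' | hp'
      · exact Opens.mem_iSup.mpr ⟨true, hp'⟩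
      · exact Opens.mem_iSup.mpr ⟨false, hp, hp'⟩)
    (fun b ↦ match b with | true => x | false => 0) (fun b c ↦ by
      cases b <;> cases c
      · rfl
      · exact (hZ _ (inf_le_left.trans inf_le_right) _).trans
          (hZ _ (inf_le_left.trans inf_le_right) _).symm
      · exact (hZ _ (inf_le_right.trans inf_le_right) _).trans
          (hZ _ (inf_le_right.trans inf_le_right) _).symm
      · rfl)
  exact ⟨y, hy true⟩

omit hZ in
lemma extOpen_preimage_le (W : X.Opens) :
    extOpen I (I.subschemeι ⁻¹ᵁ W) ≤ W ⊔ complOpen I := by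
  intro p hp
  rw [mem_extOpen] at hp
  by_cases h : p ∈ complOpen I
  · exact Or.inr h
  · rw [mem_complOpen] at h
    push Not at h
    obtain ⟨q, hq⟩ := h
    exact Or.inl (hq ▸ hp q hq)

omit hZ in
lemma le_extOpen_preimage (W : X.Opens) : W ≤ extOpen I (I.subschemeι ⁻¹ᵁ W) :=
  (le_extOpen_iff I).mpr le_rfl

omit hZ in
lemma extOpen_iSup_le {ι : Type*} (V : ι → I.subscheme.Opens) :
    extOpen I (⨆ i, V i) ≤ (⨆ i, extOpen I (V i)) ⊔ complOpen I := by
  refine le_trans ?_ (sup_le_sup_right (a := ⨆ i, extOpen I (V i)) le_rfl _)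
  refine le_trans ?_ (extOpen_preimage_le _)
  refine extOpen_mono I (iSup_le fun i ↦ ?_)
  rw [← preimage_extOpen I (V i)]
  exact I.subschemeι.preimage_mono (le_iSup (fun i ↦ extOpen I (V i)) i)

lemma existsUnique_glue_extOpen {ι : Type*} (V : ι → I.subscheme.Opens)
    (s : ∀ i, Sec N (extOpen I (V i)))
    (hs : ∀ i j, res (ab N) (extOpen_mono I (inf_le_left : V i ⊓ V j ≤ V i)) (s i) =
      res (ab N) (extOpen_mono I (inf_le_right : V i ⊓ V j ≤ V j)) (s j)) :
    ∃! z : Sec N (extOpen I (iSup V)), ∀ i, res (ab N) (extOpen_mono I (le_iSup V i)) z = s i := by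
  have hle (i : ι) : extOpen I (V i) ≤ ⨆ i, extOpen I (V i) := le_iSup (fun i ↦ extOpen I (V i)) i
  have hle' : (⨆ i, extOpen I (V i)) ≤ extOpen I (iSup V) :=
    iSup_le fun i ↦ extOpen_mono I (le_iSup V i)
  have hinf (i j : ι) : extOpen I (V i) ⊓ extOpen I (V j) ≤ extOpen I (V i ⊓ V j) :=
    fun p hp ↦ (mem_extOpen I).mpr fun q hq ↦
      ⟨(mem_extOpen I).mp hp.1 q hq, (mem_extOpen I).mp hp.2 q hq⟩
  obtain ⟨y, hy⟩ := AbSheaf.exists_glue (ab N) (fun i ↦ extOpen I (V i)) hle le_rfl s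
    (fun i j ↦ by
      have := congr(res (ab N) (hinf i j) $(hs i j))
      rwa [res_res, res_res] at this)
  obtain ⟨z, hz⟩ := exists_res_eq_of_le_sup hZ hle' (extOpen_iSup_le V) y
  refine ⟨z, fun i ↦ ?_, fun w hw ↦ ?_⟩
  · rw [← hy, ← hz, res_res]
  · refine sub_eq_zero.mp (eq_zero_of_res_of_le_sup hZ hle' (extOpen_iSup_le V) ?_)
    refine AbSheaf.eq_of_locally_eq (ab N) (fun i ↦ extOpen I (V i)) hle le_rfl fun i ↦ ?_
    rw [res_res, map_sub, hw, ← hy, ← hz, res_res, sub_self, map_zero]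

end Support

section Killed

variable (hK : IsKilledBy I N)
include hK

lemma smul_eq_zero_of_app_eq_zero {W : X.Opens} (a : Γ(X, W)) (ha : I.subschemeι.app W a = 0)
    (x : Sec N W) : a • x = 0 := by
  choose V hV hpV hVW using fun p : W ↦ exists_affine_mem_le p.2
  refine AbSheaf.eq_of_locally_eq (ab N) V hVW
    (fun p hp ↦ Opens.mem_iSup.mpr ⟨⟨p, hp⟩, hpV _⟩) fun p ↦ ?_
  rw [res_smul, map_zero]
  refine hK ⟨V p, hV p⟩ _ ?_ _
  rw [← I.ker_subschemeι_app, RingHom.mem_ker]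
  exact (app_resRing I.subschemeι (hVW p) a).trans (by rw [ha, map_zero])

lemma smul_eq_of_app_eq {W W' O : X.Opens} (hW : O ≤ W) (hW' : O ≤ W') (a : Γ(X, W))
    (a' : Γ(X, W')) {V : I.subscheme.Opens} (s : Γ(I.subscheme, V)) (h : I.subschemeι ⁻¹ᵁ W ≤ V)
    (h' : I.subschemeι ⁻¹ᵁ W' ≤ V) (ha : I.subschemeι.app W a = resRing h s)
    (ha' : I.subschemeι.app W' a' = resRing h' s) (x : Sec N O) :
    resRing hW a • x = resRing hW' a' • x := by
  rw [← sub_eq_zero, ← sub_smul]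
  apply smul_eq_zero_of_app_eq_zero hK
  rw [map_sub, app_resRing, app_resRing, ha, ha', resRing_resRing, resRing_resRing, sub_self]

omit hK in
lemma exists_app_eq {W : X.Opens} (hW : IsAffineOpen W) {V : I.subscheme.Opens}
    (s : Γ(I.subscheme, V)) (h : I.subschemeι ⁻¹ᵁ W ≤ V) :
    ∃ a, I.subschemeι.app W a = resRing h s :=
  I.subschemeι_app_surjective ⟨W, hW⟩ _

lemma exists_act {V : I.subscheme.Opens} (s : Γ(I.subscheme, V)) (x : Sec N (extOpen I V)) :
    ∃ y : Sec N (extOpen I V), ∀ (W : X.Opens) (hW : W ≤ extOpen I V) (a : Γ(X, W)),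
      I.subschemeι.app W a = resRing ((le_extOpen_iff I).mp hW) s →
        res (ab N) hW y = a • res (ab N) hW x := by
  choose W hW hpW hWV using fun p : extOpen I V ↦ exists_affine_mem_le p.2
  choose a ha using fun p ↦ exists_app_eq (hW p) s ((le_extOpen_iff I).mp (hWV p))
  have hcov : extOpen I V ≤ ⨆ p, W p := fun p hp ↦ Opens.mem_iSup.mpr ⟨⟨p, hp⟩, hpW _⟩
  obtain ⟨y, hy⟩ := AbSheaf.exists_glue (ab N) W hWV hcov
    (fun p ↦ a p • res (ab N) (hWV p) x) (fun p q ↦ by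
      rw [res_smul, res_smul, res_res, res_res]
      exact smul_eq_of_app_eq hK _ _ _ _ s _ _ (ha p) (ha q) _)
  refine ⟨y, fun O hO b hb ↦ AbSheaf.eq_of_locally_eq (ab N) (fun p ↦ O ⊓ W p)
    (fun p ↦ inf_le_left) (by rw [← inf_iSup_eq]; exact le_inf le_rfl (hO.trans hcov)) fun p ↦ ?_⟩
  rw [res_res, ← res_res _ inf_le_right (hWV p), hy, res_smul, res_smul, res_res, res_res]
  exact smul_eq_of_app_eq hK _ _ _ _ s _ _ (ha p) hb _

omit hK in
lemma eq_of_forall_exists_app_eq {V : I.subscheme.Opens} {x y : Sec N (extOpen I V)}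
    (h : ∀ (W : X.Opens) (hW : W ≤ extOpen I V), (∀ s : Γ(I.subscheme, V),
      ∃ a, I.subschemeι.app W a = resRing ((le_extOpen_iff I).mp hW) s) →
        res (ab N) hW x = res (ab N) hW y) : x = y := by
  choose W hW hpW hWV using fun p : extOpen I V ↦ exists_affine_mem_le p.2
  exact AbSheaf.eq_of_locally_eq (ab N) W hWV (fun p hp ↦ Opens.mem_iSup.mpr ⟨⟨p, hp⟩, hpW _⟩)
    fun p ↦ h _ _ fun s ↦ exists_app_eq (hW p) s _

/-- The action of a function `s` on the closed subscheme on the sections of `N`: locally, multiply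
by any lift of `s` to `X`. -/
def act {V : I.subscheme.Opens} (s : Γ(I.subscheme, V)) (x : Sec N (extOpen I V)) :
    Sec N (extOpen I V) :=
  (exists_act hK s x).choose

lemma res_act {V : I.subscheme.Opens} (s : Γ(I.subscheme, V)) (x : Sec N (extOpen I V))
    {W : X.Opens} (hW : W ≤ extOpen I V) {a : Γ(X, W)}
    (ha : I.subschemeι.app W a = resRing ((le_extOpen_iff I).mp hW) s) :
    res (ab N) hW (act hK s x) = a • res (ab N) hW x :=
  (exists_act hK s x).choose_spec W hW a ha

/-- The sections of `N` as a module over the functions on the closed subscheme, via `act`. -/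
@[reducible]
def actModule (V : I.subscheme.Opens) : Module Γ(I.subscheme, V) (Sec N (extOpen I V)) :=
  letI : SMul Γ(I.subscheme, V) (Sec N (extOpen I V)) := ⟨act hK⟩
  Module.ofMinimalAxioms
    (fun s x y ↦ eq_of_forall_exists_app_eq fun W hW h ↦ by
      obtain ⟨a, ha⟩ := h s
      change res (ab N) hW (act hK s (x + y)) = res (ab N) hW (act hK s x + act hK s y)
      rw [map_add, res_act hK _ _ hW ha, res_act hK _ _ hW ha, res_act hK _ _ hW ha, map_add,
        smul_add])
    (fun s t x ↦ eq_of_forall_exists_app_eq fun W hW h ↦ by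
      obtain ⟨a, ha⟩ := h s
      obtain ⟨b, hb⟩ := h t
      change res (ab N) hW (act hK (s + t) x) = res (ab N) hW (act hK s x + act hK t x)
      rw [map_add, res_act hK _ _ hW ha, res_act hK _ _ hW hb,
        res_act hK (s + t) x hW (a := a + b) (by rw [map_add, map_add, ha, hb]), add_smul])
    (fun s t x ↦ eq_of_forall_exists_app_eq fun W hW h ↦ by
      obtain ⟨a, ha⟩ := h s
      obtain ⟨b, hb⟩ := h t
      change res (ab N) hW (act hK (s * t) x) = res (ab N) hW (act hK s (act hK t x))
      rw [res_act hK _ _ hW ha, res_act hK _ _ hW hb,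
        res_act hK (s * t) x hW (a := a * b) (by rw [map_mul, map_mul, ha, hb]), mul_smul])
    (fun x ↦ eq_of_forall_exists_app_eq fun W hW _ ↦ by
      change res (ab N) hW (act hK 1 x) = _
      rw [res_act hK 1 x hW (a := 1) (by rw [map_one, map_one]), one_smul])

lemma res_act_extOpen {V V' : I.subscheme.Opens} (h : V ≤ V') (s : Γ(I.subscheme, V'))
    (x : Sec N (extOpen I V')) : res (ab N) (extOpen_mono I h) (act hK s x) =
      act hK (resRing h s) (res (ab N) (extOpen_mono I h) x) :=
  eq_of_forall_exists_app_eq fun W hW hlift ↦ by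
    obtain ⟨a, ha⟩ := hlift (resRing h s)
    rw [res_act hK _ _ hW ha, res_res, res_res,
      res_act hK _ _ _ (ha.trans (resRing_resRing _ h s))]

end Killed

section Descend

variable (hZ : IsSupportedOn I N) (hK : IsKilledBy I N)

/-- The abelian presheaf `V ↦ Γ(extOpen I V, N)` on the closed subscheme. -/
def descendPresheaf (N : X.Modules) : I.subscheme.Opensᵒᵖ ⥤ AddCommGrpCat :=
  (Monotone.functor (f := extOpen I) fun _ _ h ↦ extOpen_mono I h).op ⋙ (ab N).obj

include hZ in
lemma isSheaf_descendPresheaf :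
    TopCat.Presheaf.IsSheaf (X := I.subscheme.toTopCat) (descendPresheaf N) := by
  rw [TopCat.Presheaf.isSheaf_iff_isSheafUniqueGluing]
  exact fun ι V s hs ↦ existsUnique_glue_extOpen hZ V s hs

/-- The module on the closed subscheme whose direct image is `N`. -/
def descend : I.subscheme.Modules :=
  letI : ∀ V : I.subscheme.Opensᵒᵖ, Module (I.subscheme.ringCatSheaf.obj.obj V)
    ((descendPresheaf N).obj V) := fun V ↦ actModule hK V.unop
  ⟨PresheafOfModules.ofPresheaf (R := I.subscheme.ringCatSheaf.obj) (descendPresheaf N)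
    fun _ _ f s x ↦ res_act_extOpen hK (leOfHom f.unop) s x, isSheaf_descendPresheaf hZ⟩

/-- The sections of `descend hZ hK`, by construction. -/
def secDescend (V : I.subscheme.Opens) : Sec (descend hZ hK) V ≃+ Sec N (extOpen I V) :=
  AddEquiv.refl _

lemma secDescend_res {V V' : I.subscheme.Opens} (h : V ≤ V') (x : Sec (descend hZ hK) V') :
    secDescend hZ hK V (res (ab (descend hZ hK)) h x) =
      res (ab N) (extOpen_mono I h) (secDescend hZ hK V' x) :=
  rfl

lemma res_secDescend_smul {V : I.subscheme.Opens} (s : Γ(I.subscheme, V))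
    (x : Sec (descend hZ hK) V) {W : X.Opens} (hW : W ≤ extOpen I V) (a : Γ(X, W))
    (ha : I.subschemeι.app W a = resRing ((le_extOpen_iff I).mp hW) s) :
    res (ab N) hW (secDescend hZ hK V (s • x)) = a • res (ab N) hW (secDescend hZ hK V x) :=
  res_act hK s _ hW ha

lemma eq_zero_of_res_secDescend {W : X.Opens} {V : I.subscheme.Opens}
    (hV : V = I.subschemeι ⁻¹ᵁ W) (hW : W ≤ extOpen I V) {x : Sec (descend hZ hK) V}
    (hx : res (ab N) hW (secDescend hZ hK V x) = 0) : x = 0 := by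
  subst hV
  have := eq_zero_of_res_of_le_sup hZ hW (extOpen_preimage_le W) hx
  rwa [AddEquiv.map_eq_zero_iff] at this

lemma exists_res_secDescend_eq {W : X.Opens} {V : I.subscheme.Opens}
    (hV : V = I.subschemeι ⁻¹ᵁ W) (hW : W ≤ extOpen I V) (y : Sec N W) :
    ∃ x, res (ab N) hW (secDescend hZ hK V x) = y := by
  subst hV
  obtain ⟨x, hx⟩ := exists_res_eq_of_le_sup hZ hW (extOpen_preimage_le W) y
  exact ⟨(secDescend hZ hK _).symm x, by rw [AddEquiv.apply_symm_apply, hx]⟩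

end Descend

end Descent

section Pushforward

variable {S Y : Scheme.{u}} [NoetherianSpace S] {G : S.Modules}

lemma SectionsLocalize.vanishes_pushforward (hG : SectionsLocalize G) (f : S ⟶ Y)
    [IsAffineHom f] {n : ℕ} (hn : 1 ≤ n) (U : Y.Opens) :
    Vanishes n U (ab ((Scheme.Modules.pushforward f).obj G)) ↔ Vanishes n (f ⁻¹ᵁ U) (ab G) :=
  vanishes_precomp_iff_of_basis (Opens.map f.base) Y.isBasis_affineOpens
    (fun _ hV _ hn ↦ hG.vanishes_affine hn (IsAffineOpen.preimage hV f)) hn U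

end Pushforward

section Descent

lemma isIso_of_bijective_secMap {T : TopCat.{u}} {F G : AbSheaf T} (φ : F ⟶ G)
    (hinj : ∀ U x, secMap φ U x = 0 → x = 0) (hsurj : ∀ U, Function.Surjective (secMap φ U)) :
    IsIso φ := by
  have : Mono φ := mono_of_injective_secMap φ hinj
  have : Epi φ := (epi_iff_locally_surjective φ).mpr fun U z p hp ↦ by
    obtain ⟨x, hx⟩ := hsurj U z
    exact ⟨U, le_rfl, x, hp, by rw [hx, res_self]⟩
  exact isIso_of_mono_of_epi φ

variable {X : Scheme.{u}} {I : X.IdealSheafData} {N : X.Modules}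

lemma noetherianSpace_subscheme [NoetherianSpace X] : NoetherianSpace I.subscheme :=
  I.subschemeι.isClosedEmbedding.isInducing.noetherianSpace

lemma isBasis_preimage_affineOpens :
    Opens.IsBasis ((fun W ↦ I.subschemeι ⁻¹ᵁ W) '' X.affineOpens) :=
  X.isBasis_affineOpens.of_isInducing I.subschemeι.isClosedEmbedding.isInducing

variable (hN : SectionsLocalize N) (hZ : IsSupportedOn I N) (hK : IsKilledBy I N)

lemma exists_basicOpen_lift {W : X.Opens} (hW : IsAffineOpen W)
    (f : Γ(I.subscheme, I.subschemeι ⁻¹ᵁ W)) : ∃ a : Γ(X, W), I.subschemeι.app W a = f ∧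
      I.subscheme.basicOpen f = I.subschemeι ⁻¹ᵁ X.basicOpen a := by
  obtain ⟨a, rfl⟩ := I.subschemeι_app_surjective ⟨W, hW⟩ f
  exact ⟨a, rfl, (Scheme.preimage_basicOpen _ a).symm⟩

include hN in
lemma sectionsLocalizeOn_descend :
    SectionsLocalizeOn ((fun W ↦ I.subschemeι ⁻¹ᵁ W) '' X.affineOpens) (descend hZ hK) where
  exists_res_eq := by
    rintro _ ⟨W, hW, rfl⟩ f V hV h s
    obtain ⟨a, ha, hfa⟩ := exists_basicOpen_lift hW f
    have hle := le_extOpen_preimage (I := I) W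
    have hle' : X.basicOpen a ≤ extOpen I V := (le_extOpen_iff I).mpr (hV.trans hfa).ge
    obtain ⟨n, t, ht⟩ := hN.exists_res_eq hW a rfl (X.basicOpen_le a)
      (res (ab N) hle' (secDescend hZ hK _ s))
    obtain ⟨t, rfl⟩ := exists_res_secDescend_eq hZ hK rfl hle t
    have hpow : I.subschemeι.app _ (resRing (X.basicOpen_le a) a ^ n) =
        resRing ((le_extOpen_iff I).mp hle') (resRing h f ^ n) := by
      rw [map_pow, map_pow, app_resRing, resRing_resRing, ha]
    refine ⟨n, t, sub_eq_zero.mp (eq_zero_of_res_secDescend hZ hK (hV.trans hfa) hle' ?_)⟩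
    rw [map_sub, map_sub, secDescend_res, res_res, ← res_res _ (X.basicOpen_le a) hle, ht,
      res_secDescend_smul hZ hK _ s hle' _ hpow, sub_self]
  exists_pow_smul_eq_zero := by
    rintro _ ⟨W, hW, rfl⟩ f V hV h t ht
    obtain ⟨a, ha, hfa⟩ := exists_basicOpen_lift hW f
    have hle := le_extOpen_preimage (I := I) W
    have hle' : X.basicOpen a ≤ extOpen I V := (le_extOpen_iff I).mpr (hV.trans hfa).ge
    obtain ⟨n, hn⟩ := hN.exists_pow_smul_eq_zero hW a rfl (X.basicOpen_le a)
      (res (ab N) hle (secDescend hZ hK _ t)) (by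
        rw [res_res, ← res_res _ hle' (extOpen_mono I h), ← secDescend_res hZ hK h, ht, map_zero,
          map_zero])
    refine ⟨n, eq_zero_of_res_secDescend hZ hK rfl hle ?_⟩
    rw [res_secDescend_smul hZ hK (f ^ n) t hle (a ^ n) (by rw [map_pow, resRing_self, ha]), hn]

/-- The comparison map from the direct image of `descend hZ hK`, whose sections over `W` are those
of `N` over `extOpen I (I.subschemeι ⁻¹ᵁ W)`, to `N`. -/
def pushforwardDescend :
    ab ((Scheme.Modules.pushforward I.subschemeι).obj (descend hZ hK)) ⟶ ab N :=
  ⟨{ app W := AddCommGrpCat.ofHom ((res (ab N) (le_extOpen_preimage W.unop)).comp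
        (secDescend hZ hK (I.subschemeι ⁻¹ᵁ W.unop)).toAddMonoidHom)
     naturality W W' f := by
      have hnat {W' W : X.Opens} (h : W' ≤ W) (x : Sec (descend hZ hK) (I.subschemeι ⁻¹ᵁ W)) :
          res (ab N) (le_extOpen_preimage W')
              (secDescend hZ hK _ (res _ (I.subschemeι.preimage_mono h) x)) =
            res (ab N) h (res (ab N) (le_extOpen_preimage W) (secDescend hZ hK _ x)) := by
        rw [secDescend_res, res_res, res_res]
      ext x
      exact hnat (leOfHom f.unop) x }⟩

instance isIso_pushforwardDescend : IsIso (pushforwardDescend hZ hK) :=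
  isIso_of_bijective_secMap _
    (fun W _ hx ↦ eq_zero_of_res_secDescend hZ hK rfl (le_extOpen_preimage W) hx)
    (fun W y ↦ exists_res_secDescend_eq hZ hK rfl (le_extOpen_preimage W) y)

variable [NoetherianSpace X] {Y : Scheme.{u}} (f : I.subscheme ⟶ Y) [IsAffineHom f] {q : ℕ}
  (hq : 1 ≤ q) (hY : ∀ G : Y.Modules, SectionsLocalize G → Vanishes q ⊤ (ab G))
include hN hZ hK f hq hY

lemma vanishes_of_isKilledBy : Vanishes q ⊤ (ab N) := by
  have := noetherianSpace_subscheme (I := I)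
  have hG : SectionsLocalize (descend hZ hK) :=
    (sectionsLocalizeOn_descend hN hZ hK).of_isBasis isBasis_preimage_affineOpens _
  have h : Vanishes q ⊤ (ab (descend hZ hK)) :=
    (hG.vanishes_pushforward f hq ⊤).mp (hY _ (hG.pushforward f))
  exact ((hG.vanishes_pushforward I.subschemeι hq ⊤).mpr h).of_iso
    (asIso (pushforwardDescend hZ hK))

end Descent

section Torsion

variable {X : Scheme.{u}} {I J : X.IdealSheafData} {T N : X.Modules} {ι : T ⟶ N}

lemma IsSupportedOn.of_injective (hN : IsSupportedOn I N) (hι : ∀ U x, homSec ι U x = 0 → x = 0) :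
    IsSupportedOn I T :=
  fun V hV x ↦ hι V x (hN V hV _)

lemma IsSupportedOn.of_isShortExact {Q : X.Modules} {π : N ⟶ Q} (hN : IsSupportedOn I N)
    (h : IsShortExact ((abF X).map ι) ((abF X).map π)) : IsSupportedOn I Q := fun V hV z ↦ by
  choose W hW x hp hx using fun p : V ↦ h.surj V z p.1 p.2
  refine AbSheaf.eq_of_locally_eq _ W hW (fun p hp' ↦ Opens.mem_iSup.mpr ⟨⟨p, hp'⟩, hp _⟩)
    fun p ↦ ?_
  rw [← hx, hN _ ((hW p).trans hV) (x p), map_zero, map_zero]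

/-- The ideal sheaf `J` annihilates the section `x`. -/
def IsKilledSec (J : X.IdealSheafData) {U : X.Opens} (x : Sec N U) : Prop :=
  ∀ (W : X.affineOpens) (h : W.1 ≤ U), ∀ a ∈ J.ideal W, a • res (ab N) h x = 0

lemma isKilledSec_iff (U : X.affineOpens) {x : Sec N U.1} :
    IsKilledSec J x ↔ ∀ a ∈ J.ideal U, a • x = 0 := by
  refine ⟨fun hx a ha ↦ by simpa only [res_self] using hx U le_rfl a ha, fun hx W h a ha ↦ ?_⟩
  rw [← J.map_ideal (U := W) (V := U) h] at ha
  suffices (J.ideal U).map (X.presheaf.map (homOfLE h).op).hom ≤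
      LinearMap.ker (LinearMap.toSpanSingleton Γ(X, W) (Sec N W) (res (ab N) h x)) from this ha
  refine Ideal.map_le_iff_le_comap.mpr fun b hb ↦ ?_
  have := congr(res (ab N) h $(hx b hb))
  rwa [res_smul, map_zero] at this

lemma isKilledSec_of_locally {U : X.Opens} (x : Sec N U)
    (hx : ∀ p ∈ U, ∃ (V : X.Opens) (h : V ≤ U), p ∈ V ∧ IsKilledSec J (res (ab N) h x)) :
    IsKilledSec J x := fun W h a ha ↦ by
  choose V hV hpV hVx using fun p : W.1 ↦ hx p.1 (h p.2)
  choose W' hW' hpW' hle using fun p : W.1 ↦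
    exists_affine_mem_le (U := W.1 ⊓ V p) (p := p.1) ⟨p.2, hpV p⟩
  refine AbSheaf.eq_of_locally_eq (ab N) W' (fun p ↦ (hle p).trans inf_le_left)
    (fun p hp ↦ Opens.mem_iSup.mpr ⟨⟨p, hp⟩, hpW' _⟩) fun p ↦ ?_
  have := hVx p ⟨W' p, hW' p⟩ ((hle p).trans inf_le_right) (resRing ((hle p).trans inf_le_left) a)
    (J.ideal_le_comap_ideal (U := ⟨W' p, hW' p⟩) ((hle p).trans inf_le_left) ha)
  rwa [res_smul, map_zero, res_res, ← res_res _ ((hle p).trans inf_le_right) (hV p)]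

/-- `ι` embeds `T` into `N` as the submodule of the sections annihilated by `J`. -/
structure IsTorsionPart (J : X.IdealSheafData) (ι : T ⟶ N) : Prop where
  inj : ∀ U x, homSec ι U x = 0 → x = 0
  exists_eq_iff : ∀ U (m : Sec N U), (∃ x, homSec ι U x = m) ↔ IsKilledSec J m

variable (J N) in
lemma exists_isTorsionPart : ∃ (T : X.Modules) (ι : T ⟶ N), IsTorsionPart J ι := by
  obtain ⟨T, ι, hι, h⟩ := exists_subsheaf N (fun U ↦
    { carrier := {m | IsKilledSec J m}
      add_mem' := fun hx hy W h a ha ↦ by rw [map_add, smul_add, hx W h a ha, hy W h a ha, add_zero]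
      zero_mem' := fun _ _ _ _ ↦ by rw [map_zero, smul_zero]
      smul_mem' := fun r x hx W h a ha ↦ by
        rw [res_smul, smul_smul, mul_comm, mul_smul, hx W h a ha, smul_zero] })
    (fun {V U} hVU x hx W h a ha ↦ by rw [res_res]; exact hx W _ a ha)
    (fun {U} x hx ↦ isKilledSec_of_locally x hx)
  exact ⟨T, ι, hι, fun U m ↦ (h U m).symm⟩

section

variable (hT : IsTorsionPart J ι)
include hT

lemma IsTorsionPart.isKilledBy : IsKilledBy J T := fun V a ha x ↦ hT.inj _ _ <| by
  rw [homSec_smul]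
  exact (isKilledSec_iff V).mp ((hT.exists_eq_iff V.1 _).mp ⟨x, rfl⟩) a ha

variable [IsLocallyNoetherian X] (hN : SectionsLocalize N)
include hN

lemma IsTorsionPart.exists_eq_pow_smul {U : X.Opens} (hU : IsAffineOpen U) (f : Γ(X, U))
    {V : X.Opens} (hV : V = X.basicOpen f) (h : V ≤ U) (t : Sec N U)
    (ht : IsKilledSec J (res (ab N) h t)) : ∃ (k : ℕ) (y : Sec T U), homSec ι U y = f ^ k • t := by
  have hVaff : IsAffineOpen V := hV ▸ hU.basicOpen f
  have : IsNoetherianRing Γ(X, U) := IsLocallyNoetherian.component_noetherian ⟨U, hU⟩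
  obtain ⟨g, hg⟩ := (J.ideal ⟨U, hU⟩).fg_of_isNoetherianRing
  obtain ⟨k, hk⟩ := exists_forall_of_finset g (fun a k ↦ f ^ k • a • t = 0)
    (fun a n m hnm hn ↦ by
      obtain ⟨k, rfl⟩ := Nat.exists_eq_add_of_le' hnm
      rw [pow_add, mul_smul, hn, smul_zero])
    (fun a ha ↦ hN.exists_pow_smul_eq_zero hU f hV h (a • t) (by
      rw [res_smul]
      exact (isKilledSec_iff ⟨V, hVaff⟩).mp ht _ (J.ideal_le_comap_ideal (U := ⟨V, hVaff⟩)
        (V := ⟨U, hU⟩) h (hg ▸ Ideal.subset_span ha))))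
  have hann : J.ideal ⟨U, hU⟩ ≤
      LinearMap.ker (LinearMap.toSpanSingleton Γ(X, U) (Sec N U) (f ^ k • t)) := by
    rw [← hg, Ideal.span_le]
    intro a ha
    have := hk a ha
    rwa [smul_smul, mul_comm, mul_smul] at this
  exact ⟨k, (hT.exists_eq_iff U _).mpr ((isKilledSec_iff ⟨U, hU⟩).mpr fun a ha ↦ hann ha)⟩

lemma IsTorsionPart.sectionsLocalize : SectionsLocalize T where
  exists_res_eq {U} hU f V hV h s := by
    obtain ⟨m, t, ht⟩ := hN.exists_res_eq hU f hV h (homSec ι V s)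
    obtain ⟨k, y, hy⟩ := hT.exists_eq_pow_smul hN hU f hV h t (by
      rw [ht, ← homSec_smul, ← hT.exists_eq_iff]
      exact ⟨_, rfl⟩)
    refine ⟨k + m, y, sub_eq_zero.mp (hT.inj V _ ?_)⟩
    rw [map_sub, secMap_res, hy, res_smul, ht, homSec_smul, map_pow, pow_add, mul_smul, sub_self]
  exists_pow_smul_eq_zero {U} hU f V hV h t ht := by
    obtain ⟨m, hm⟩ := hN.exists_pow_smul_eq_zero hU f hV h (homSec ι U t) (by
      rw [← secMap_res, ht, map_zero])
    exact ⟨m, hT.inj _ _ (by rw [homSec_smul, hm])⟩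

end

section

variable [IsLocallyNoetherian X] (hN : SectionsLocalize N) (hZ : IsSupportedOn I N)
include hN hZ

lemma exists_isKilledSec_pow_of_affine (U : X.affineOpens) (x : Sec N U.1) :
    ∃ n : ℕ, IsKilledSec (I ^ n) x := by
  have : IsNoetherianRing Γ(X, U) := IsLocallyNoetherian.component_noetherian U
  obtain ⟨n, hn⟩ := Ideal.exists_pow_le_of_le_radical_of_fg (I := I.ideal U)
    (J := LinearMap.ker (LinearMap.toSpanSingleton Γ(X, U) (Sec N U) x))
    (fun a ha ↦ by
      obtain ⟨m, hm⟩ := hN.exists_pow_smul_eq_zero U.2 a rfl (X.basicOpen_le a) x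
        (hZ _ (fun p hp hp' ↦ (X.mem_zeroLocus_iff _ _).mp
          ((I.mem_support_iff_of_mem (X.basicOpen_le a hp)).mp hp') a ha hp) _)
      exact ⟨m, hm⟩) (Ideal.fg_of_isNoetherianRing _)
  exact ⟨n, (isKilledSec_iff U).mpr fun a ha ↦ hn ha⟩

lemma exists_isKilledSec_pow [NoetherianSpace X] {U : X.Opens} (x : Sec N U) :
    ∃ n : ℕ, IsKilledSec (I ^ n) x := by
  obtain ⟨k, D, hD, hD', hcov⟩ := exists_finite_cover X.isBasis_affineOpens U
  obtain ⟨n, hn⟩ := exists_forall_of_finset Finset.univ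
    (fun i n ↦ IsKilledSec (I ^ n) (res (ab N) (hD i) x))
    (fun i n m hnm h W hW a ha ↦ h W hW a (Ideal.pow_le_pow_right hnm ha))
    (fun i _ ↦ exists_isKilledSec_pow_of_affine hN hZ ⟨D i, hD' i⟩ _)
  refine ⟨n, isKilledSec_of_locally x fun p hp ↦ ?_⟩
  obtain ⟨i, hi⟩ := Opens.mem_iSup.mp (hcov hp)
  exact ⟨D i, hD i, hi, hn i (Finset.mem_univ i)⟩

lemma exhausts_of_isTorsionPart_pow [NoetherianSpace X] {P : ℕ → X.Modules} {φ : ∀ n, P n ⟶ N}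
    (hφ : ∀ n, IsTorsionPart (I ^ n) (φ n)) : Exhausts N P φ where
  inj n := (hφ n).inj
  mono {n m} hnm U x := ((hφ m).exists_eq_iff U _).mpr fun W h a ha ↦
    ((hφ n).exists_eq_iff U _).mp ⟨x, rfl⟩ W h a (Ideal.pow_le_pow_right hnm ha)
  exh U x := by
    obtain ⟨n, hn⟩ := exists_isKilledSec_pow hN hZ x
    exact ⟨n, ((hφ n).exists_eq_iff U x).mpr hn⟩

end

variable [NoetherianSpace X] [IsLocallyNoetherian X] {Y : Scheme.{u}} (f : I.subscheme ⟶ Y)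
  [IsAffineHom f] {q : ℕ} (hq : 1 ≤ q)
  (hY : ∀ G : Y.Modules, SectionsLocalize G → Vanishes q ⊤ (ab G))
  (hN : SectionsLocalize N) (hZ : IsSupportedOn I N)
include f hq hY hN hZ

lemma vanishes_of_isKilledBy_pow (n : ℕ) (hK : IsKilledBy (I ^ n) N) : Vanishes q ⊤ (ab N) := by
  induction n generalizing N with
  | zero => exact vanishes_of_isKilledBy hN hZ (fun V a _ x ↦ hK V a (by simp) x) f hq hY
  | succ n ih =>
    obtain ⟨T, ι, hT⟩ := exists_isTorsionPart (I ^ n) N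
    have : Mono ι := mono_of_injective_homSec ι hT.inj
    have hs := isShortExact_cokernel ι
    have hTq := hT.sectionsLocalize hN
    have hQ : IsKilledBy I (cokernel ι) := fun V a ha z ↦ by
      obtain ⟨x, rfl⟩ := hs.surjective_homSec hTq hN V.2 z
      obtain ⟨y, hy⟩ := (hT.exists_eq_iff V.1 (a • x)).mpr ((isKilledSec_iff V).mpr fun b hb ↦ by
        rw [smul_smul]
        exact hK V (b * a) (Ideal.mul_mem_mul hb ha) x)
      rw [← homSec_smul, ← hy, hs.zero]
    exact hs.vanishes_mid (ih hTq (hZ.of_injective hT.inj) hT.isKilledBy)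
      (vanishes_of_isKilledBy (hs.sectionsLocalize hTq hN) (hZ.of_isShortExact hs) hQ f hq hY)

theorem vanishes_of_isSupportedOn [X.IsSeparated] : Vanishes q ⊤ (ab N) := by
  choose T ι hT using fun n : ℕ ↦ exists_isTorsionPart (I ^ n) N
  exact (exhausts_of_isTorsionPart_pow hN hZ hT).vanishes hN fun n ↦
    vanishes_of_isKilledBy_pow f hq hY ((hT n).sectionsLocalize hN)
      (hZ.of_injective (hT n).inj) n (hT n).isKilledBy

end Torsion

/-! ### Complements of local complete intersections -/

lemma vanishes_of_forall_eq_zero {T : TopCat.{u}} {F : AbSheaf T}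
    (h : ∀ U (x : F.obj.obj (op U)), x = 0) (n : ℕ) (U : Opens T) : Vanishes n U F := by
  have id_eq_zero : 𝟙 F = 0 := AbSheaf.hom_ext fun U x ↦ (h U _).trans (h U _).symm
  refine vanishes_iff.mpr fun x ↦ ?_
  rw [← Ext.comp_mk₀_id x, id_eq_zero, Ext.mk₀_zero, Ext.comp_zero]

section Restriction

variable {X : Scheme.{u}} (F : X.Modules) {U V : X.Opens} (h : V ≤ U)
include h

lemma eq_zero_of_toPushRes {x : Sec F V} (hx : homSec (toPushRes F U) V x = 0) : x = 0 := by
  have res_eq_zero : res (ab F) (inf_le_right : U ⊓ V ≤ V) x = 0 := by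
    rw [← secPush_toPushRes, hx, map_zero]
  have := congr(res (ab F) (le_inf h le_rfl) $res_eq_zero)
  rwa [res_res, res_self, map_zero] at this

lemma surjective_toPushRes : Function.Surjective (homSec (toPushRes F U) V) := by
  intro y
  refine ⟨res (ab F) (le_inf h le_rfl) (secPush U F V y), (secPush U F V).injective ?_⟩
  rw [secPush_toPushRes, res_res, res_self]

end Restriction

section LocallyVanishing

variable {X : Scheme.{u}} [NoetherianSpace X] [X.IsSeparated] {F : X.Modules}
  (hF : SectionsLocalize F)
include hF

lemma SectionsLocalize.vanishes_iSup {k : ℕ} (D : Fin k → X.Opens)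
    (hD : ∀ i, IsAffineOpen (D i)) {q : ℕ} (hq : 1 ≤ q) (hkq : k ≤ q) :
    Vanishes q (⨆ i, D i) (ab F) := by
  induction k generalizing q with
  | zero =>
    rw [iSup_of_empty]
    exact vanishes_bot q _
  | succ k ih =>
    obtain ⟨m, rfl⟩ := Nat.exists_eq_add_of_le' hq
    have iSup_eq : (⨆ i, D i) = D 0 ⊔ ⨆ i : Fin k, D i.succ :=
      eq_of_forall_ge_iff fun _ ↦ by simp only [iSup_le_iff, sup_le_iff, Fin.forall_fin_succ]
    rw [iSup_eq]
    refine vanishes_sup (hF.vanishes_affine hq (hD 0)) (ih _ (fun i ↦ hD _) hq (by omega)) ?_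
    rw [inf_iSup_eq]
    obtain rfl | hm := Nat.eq_zero_or_pos m
    · obtain rfl : k = 0 := by omega
      rw [iSup_of_empty]
      exact vanishes_bot 0 _
    · exact ih _ (fun i ↦ (hD 0).inf (hD _)) hm (by omega)

end LocallyVanishing

section Step

variable {X : Scheme.{u}} {I : X.IdealSheafData}

lemma IsSupportedOn.vanishes_of_le {N : X.Modules} (hN : IsSupportedOn I N) {n : ℕ} (hn : 1 ≤ n)
    {O : X.Opens} (hO : O ≤ complOpen I) : Vanishes n O (ab N) := by
  rw [vanishes_affine_iff_top N hn]
  exact vanishes_of_forall_eq_zero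
    (fun V x ↦ hN (O.ι ''ᵁ V) ((O.ι_image_le V).trans hO) x) n ⊤

lemma exists_isShortExact_image_of_injective {F G : X.Modules} (φ : F ⟶ G)
    (hF : SectionsLocalize F) (hG : SectionsLocalize G)
    (hφ : ∀ V ≤ complOpen I, ∀ x, homSec φ V x = 0 → x = 0) :
    ∃ (K J C : X.Modules) (k : K ⟶ F) (e : F ⟶ J) (i : J ⟶ G) (c : G ⟶ C),
      IsShortExact ((abF X).map k) ((abF X).map e) ∧
      IsShortExact ((abF X).map i) ((abF X).map c) ∧ e ≫ i = φ ∧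
      SectionsLocalize K ∧ SectionsLocalize C ∧ IsSupportedOn I K := by
  obtain ⟨K, J, C, k, e, i, c, h₁, h₂, fac⟩ := exists_isShortExact_image φ
  have homSec_fac (V : X.Opens) (x : Sec F V) : homSec i V (homSec e V x) = homSec φ V x := by
    rw [← fac, homSec_comp]
  have kernel_φ : IsLeftExact ((abF X).map k) ((abF X).map φ) :=
    ⟨h₁.inj, fun V x ↦ by rw [← homSec_fac, h₁.zero, map_zero],
      fun V x hx ↦ h₁.exact V x (h₂.inj V _ ((homSec_fac V x).trans hx))⟩
  have hK : SectionsLocalize K := kernel_φ.sectionsLocalize hF hG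
  have hJ : SectionsLocalize J := h₁.sectionsLocalize hK hF
  exact ⟨K, J, C, k, e, i, c, h₁, h₂, fac, hK, h₂.sectionsLocalize hJ hG,
    fun V hV x ↦ h₁.inj V x (hφ V hV _ (kernel_φ.zero V x))⟩

variable [NoetherianSpace X] [X.IsSeparated] [IsLocallyNoetherian X] {Y : Scheme.{u}}
  (f : I.subscheme ⟶ Y) [IsAffineHom f] {d : ℕ}
  (hY : ∀ q, d < q → ∀ G : Y.Modules, SectionsLocalize G → Vanishes q ⊤ (ab G))
  {F : X.Modules} (hF : SectionsLocalize F) {t : ℕ}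
include f hY hF

lemma vanishes_top_of_bijective {G : X.Modules} (hG : SectionsLocalize G) (φ : F ⟶ G)
    (hinj : ∀ V ≤ complOpen I, ∀ x, homSec φ V x = 0 → x = 0)
    (hsurj : ∀ V ≤ complOpen I, Function.Surjective (homSec φ V)) (ht : d + 1 < t)
    (hGt : Vanishes t ⊤ (ab G)) : Vanishes t ⊤ (ab F) := by
  obtain ⟨t, rfl⟩ := Nat.exists_eq_add_of_le' (Nat.one_le_of_lt ht)
  obtain ⟨K, J, C, k, e, i, c, h₁, h₂, fac, hK, hC, hKZ⟩ :=
    exists_isShortExact_image_of_injective φ hF hG hinj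
  have hCZ : IsSupportedOn I C := fun V hV z ↦ by
    choose W hW x hpW hx using fun p : V ↦ h₂.surj V z p.1 p.2
    refine AbSheaf.eq_of_locally_eq (ab C) W hW
      (fun p hp ↦ Opens.mem_iSup.mpr ⟨⟨p, hp⟩, hpW _⟩) fun p ↦ ?_
    obtain ⟨y, hy⟩ := hsurj (W p) ((hW p).trans hV) (x p)
    rw [← hx, ← hy, ← fac, homSec_comp, h₂.zero, map_zero]
  exact h₁.vanishes_mid
    (vanishes_of_isSupportedOn f (by omega) (hY _ (by omega)) hK hKZ)
    (h₂.vanishes_left (vanishes_of_isSupportedOn f (by omega) (hY _ (by omega)) hC hCZ) hGt)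

variable {B : Set X.Opens} (hB : Opens.IsBasis B)
include hB

lemma vanishes_top_of_vanishes_inf_one
    (hc : ∀ V ∈ B, ∀ q, 1 ≤ q → Vanishes q (complOpen I ⊓ V) (ab F)) (ht : d + 1 < t)
    (htU : Vanishes t (complOpen I) (ab F)) : Vanishes t ⊤ (ab F) := by
  refine vanishes_top_of_bijective f hY hF (hF.pushRes (complOpen I))
    (toPushRes F (complOpen I)) (fun V hV x ↦ eq_zero_of_toPushRes F hV)
    (fun V hV ↦ surjective_toPushRes F hV) ht ?_
  refine (vanishes_precomp_iff_of_basis (interFunctor (complOpen I)) hB hc (by omega) ⊤).mpr ?_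
  change Vanishes t (complOpen I ⊓ ⊤) (ab F)
  rwa [inf_top_eq]

theorem vanishes_top_of_vanishes_inf (hB' : ∀ V ∈ B, IsAffineOpen V) {c : ℕ} (hc₁ : 1 ≤ c)
    (hc : ∀ V ∈ B, ∀ q, c ≤ q → Vanishes q (complOpen I ⊓ V) (ab F)) (ht : d + c < t)
    (htU : Vanishes t (complOpen I) (ab F)) : Vanishes t ⊤ (ab F) := by
  induction c, hc₁ using Nat.le_induction generalizing F t with
  | base => exact vanishes_top_of_vanishes_inf_one f hY hF hB hc ht htU
  | succ c hc₁ ih =>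
    obtain ⟨t, rfl⟩ := Nat.exists_eq_add_of_le' (Nat.one_le_of_lt ht)
    obtain ⟨n, D, hDU, hD, hcov⟩ := exists_finite_cover X.isBasis_affineOpens (complOpen I)
    have cechMap_inj (V) (hV : V ≤ complOpen I) (x) (hx : homSec (cechMap F D) V x = 0) :
        x = 0 := by
      refine AbSheaf.eq_of_locally_eq (ab F) (fun i ↦ D i ⊓ V) (fun _ ↦ inf_le_right) ?_ fun i ↦ ?_
      · rw [← iSup_inf_eq]
        exact le_inf (hV.trans hcov) le_rfl
      · rw [eq_zero_of_cechMap F D hx, map_zero]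
    obtain ⟨K, J, Q, k, e, i, π, h₁, h₂, -, hK, hQ, hKZ⟩ :=
      exists_isShortExact_image_of_injective (cechMap F D) hF (hF.cechObj D) cechMap_inj
    have vanishes_Q {q : ℕ} (hq : 1 ≤ q) {O : X.Opens} (hO : O ≤ complOpen I)
        (hDO : ∀ i, IsAffineOpen (D i ⊓ O)) (hFO : Vanishes (q + 1) O (ab F)) :
        Vanishes q O (ab Q) :=
      h₂.vanishes_right (hF.vanishes_cechObj hD hq O hDO)
        (h₁.vanishes_right hFO (hKZ.vanishes_of_le (by omega) hO))
    have affine_inf (i) {V} (hV : V ∈ B) : IsAffineOpen (D i ⊓ (complOpen I ⊓ V)) := by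
      rw [← inf_assoc, inf_eq_left.mpr (hDU i)]
      exact (hD i).inf (hB' V hV)
    have hQt : Vanishes t ⊤ (ab Q) :=
      ih hQ (fun V hV q hq ↦ vanishes_Q (by omega) inf_le_left (fun i ↦ affine_inf i hV)
        (hc V hV (q + 1) (by omega))) (by omega)
        (vanishes_Q (by omega) le_rfl (fun i ↦ by rw [inf_eq_left.mpr (hDU i)]; exact hD i) htU)
    exact h₁.vanishes_mid (vanishes_of_isSupportedOn f (by omega) (hY _ (by omega)) hK hKZ)
      (h₂.vanishes_left hQt
        (hF.vanishes_cechObj hD (by omega) ⊤ fun i ↦ by rw [inf_top_eq]; exact hD i))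

omit hB in
lemma vanishes_top_of_isCompl {W : X.Opens} (hW : IsCompl (complOpen I) W) (ht : d < t)
    (htU : Vanishes t (complOpen I) (ab F)) : Vanishes t ⊤ (ab F) := by
  have hB : Opens.IsBasis {V : X.Opens | IsAffineOpen V ∧ (V ≤ complOpen I ∨ V ≤ W)} := by
    refine Opens.isBasis_iff_nbhd.mpr fun {O p} hp ↦ ?_
    have hpUW : p ∈ complOpen I ⊔ W := hW.sup_eq_top ▸ trivial
    obtain hpU | hpW := hpUW
    · obtain ⟨V, hV, hpV, hVO⟩ := exists_affine_mem_le (U := O ⊓ complOpen I) ⟨hp, hpU⟩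
      exact ⟨V, ⟨hV, .inl (hVO.trans inf_le_right)⟩, hpV, hVO.trans inf_le_left⟩
    · obtain ⟨V, hV, hpV, hVO⟩ := exists_affine_mem_le (U := O ⊓ W) ⟨hp, hpW⟩
      exact ⟨V, ⟨hV, .inr (hVO.trans inf_le_right)⟩, hpV, hVO.trans inf_le_left⟩
  have supported : IsSupportedOn I (pushRes W F) := fun V hV x ↦
    (secPush W F V).injective <| AbSheaf.eq_of_locally_eq (ab F) (ι := Empty) (fun _ ↦ ⊥) nofun
      ((hW.symm.disjoint.mono_right hV).le_bot.trans bot_le) nofun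
  have acyclic (V : X.Opens) (hV : IsAffineOpen V ∧ (V ≤ complOpen I ∨ V ≤ W)) (n : ℕ)
      (hn : 1 ≤ n) : Vanishes n (W ⊓ V) (ab F) := by
    obtain ⟨hV, hVU | hVW⟩ := hV
    · rw [(hW.symm.disjoint.mono_right hVU).eq_bot]
      exact vanishes_bot n _
    · rw [inf_eq_right.mpr hVW]
      exact hF.vanishes_affine hn hV
  have htW : Vanishes t (W ⊓ ⊤) (ab F) :=
    (vanishes_precomp_iff_of_basis (interFunctor W) hB acyclic (by omega) ⊤).mp
      (vanishes_of_isSupportedOn f (by omega) (hY t ht) (hF.pushRes W) supported)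
  rw [inf_top_eq] at htW
  obtain ⟨t, rfl⟩ := Nat.exists_eq_add_of_le' (Nat.one_le_of_lt ht)
  rw [← hW.sup_eq_top]
  exact vanishes_sup htU htW (hW.inf_eq_bot ▸ vanishes_bot _ _)

end Step

section Lci

/-- The ideal sheaf `I` is locally generated by `c` sections along its closed subscheme. -/
def IsLocallyGeneratedBy {X : Scheme.{u}} (I : X.IdealSheafData) (c : ℕ) : Prop :=
  ∀ p ∈ I.support, ∃ V : X.affineOpens, p ∈ V.1 ∧
    ∃ g : Fin c → Γ(X, V.1), I.ideal V = Ideal.span (Set.range g)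

variable {X : Scheme.{u}} {I : X.IdealSheafData} {c : ℕ}

/-- The affine open subsets which avoid the closed subscheme of `I`, or on which `I` is generated
by `c` sections. -/
def lciBasis (I : X.IdealSheafData) (c : ℕ) : Set X.Opens :=
  {V | IsAffineOpen V ∧ (V ≤ complOpen I ∨
    ∃ (h : IsAffineOpen V) (g : Fin c → Γ(X, V)), I.ideal ⟨V, h⟩ = Ideal.span (Set.range g))}

lemma IsLocallyGeneratedBy.isBasis_lciBasis (hI : IsLocallyGeneratedBy I c) :
    Opens.IsBasis (lciBasis I c) := by
  refine Opens.isBasis_iff_nbhd.mpr fun {U p} hp ↦ ?_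
  by_cases h : p ∈ I.support
  · obtain ⟨V, hpV, g, hg⟩ := hI p h
    obtain ⟨W, hW, hpW, hWU⟩ := exists_affine_mem_le (U := U ⊓ V.1) (p := p) ⟨hp, hpV⟩
    have hWV := hWU.trans inf_le_right
    refine ⟨W, ⟨hW, .inr ⟨hW, fun i ↦ resRing hWV (g i), ?_⟩⟩, hpW, hWU.trans inf_le_left⟩
    rw [← I.map_ideal (U := ⟨W, hW⟩) (V := V) hWV, hg, Ideal.map_span, ← Set.range_comp]
    rfl
  · obtain ⟨W, hW, hpW, hWU⟩ := exists_affine_mem_le (U := U ⊓ complOpen I) (p := p) ⟨hp, h⟩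
    exact ⟨W, ⟨hW, .inl (hWU.trans inf_le_right)⟩, hpW, hWU.trans inf_le_left⟩

lemma complOpen_inf_eq_iSup {V : X.Opens} (h : IsAffineOpen V) (g : Fin c → Γ(X, V))
    (hg : I.ideal ⟨V, h⟩ = Ideal.span (Set.range g)) :
    complOpen I ⊓ V = ⨆ i, X.basicOpen (g i) := by
  have mem_support_iff {p : X} (hp : p ∈ V) : p ∈ I.support ↔ ∀ i, p ∉ X.basicOpen (g i) := by
    rw [I.mem_support_iff_of_mem (U := ⟨V, h⟩) hp, hg, Scheme.zeroLocus_span,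
      Scheme.mem_zeroLocus_iff, Set.forall_mem_range]
  ext p
  simp only [Opens.coe_inf, Set.mem_inter_iff, SetLike.mem_coe, Opens.mem_iSup]
  constructor
  · rintro ⟨hp, hpV⟩
    exact not_forall_not.mp (mt (mem_support_iff hpV).mpr hp)
  · rintro ⟨i, hi⟩
    have hpV := X.basicOpen_le _ hi
    exact ⟨fun hp ↦ (mem_support_iff hpV).mp hp i hi, hpV⟩

lemma IsLocallyGeneratedBy.isCompl_compl (hI : IsLocallyGeneratedBy I 0) :
    IsCompl (complOpen I) (complOpen I)ᶜ := by
  refine ⟨disjoint_compl_right, codisjoint_iff_le_sup.mpr fun p _ ↦ ?_⟩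
  by_cases hp : p ∈ complOpen I
  · exact .inl hp
  · obtain ⟨V, hpV, g, hg⟩ := hI p (not_not.mp hp)
    have hbot : complOpen I ⊓ V.1 = ⊥ := by rw [complOpen_inf_eq_iSup V.2 g hg, iSup_of_empty]
    exact .inr (le_compl_iff_disjoint_left.mpr (disjoint_iff.mpr hbot) hpV)

variable [NoetherianSpace X] [X.IsSeparated] {F : X.Modules} (hF : SectionsLocalize F)
include hF

lemma SectionsLocalize.vanishes_complOpen_inf {V : X.Opens} (hV : V ∈ lciBasis I c) {q : ℕ}
    (hq : 1 ≤ q) (hcq : c ≤ q) : Vanishes q (complOpen I ⊓ V) (ab F) := by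
  obtain ⟨hV, hVU | ⟨hV, g, hg⟩⟩ := hV
  · rw [inf_eq_right.mpr hVU]
    exact hF.vanishes_affine hq hV
  · rw [complOpen_inf_eq_iSup hV g hg]
    exact hF.vanishes_iSup _ (fun i ↦ hV.basicOpen _) hq hcq

theorem IsLocallyGeneratedBy.vanishes_top [IsLocallyNoetherian X] (hI : IsLocallyGeneratedBy I c)
    {Y : Scheme.{u}} (f : I.subscheme ⟶ Y) [IsAffineHom f] {d : ℕ}
    (hY : ∀ q, d < q → ∀ G : Y.Modules, SectionsLocalize G → Vanishes q ⊤ (ab G)) {t : ℕ}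
    (ht : d + c < t) (htU : Vanishes t (complOpen I) (ab F)) : Vanishes t ⊤ (ab F) := by
  obtain rfl | hc := Nat.eq_zero_or_pos c
  · exact vanishes_top_of_isCompl f hY hF hI.isCompl_compl ht htU
  · exact vanishes_top_of_vanishes_inf f hY hF hI.isBasis_lciBasis (fun V hV ↦ hV.1) hc
      (fun V hV q hq ↦ hF.vanishes_complOpen_inf hV (hc.trans_le hq) hq) ht htU

end Lci

/-! ### Quasi-projective varieties -/

attribute [local instance] MvPolynomial.gradedAlgebra

lemma isNoetherianRing_homogeneousSubmodule_zero (σ R : Type*) [CommRing R] [IsNoetherianRing R] :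
    IsNoetherianRing (MvPolynomial.homogeneousSubmodule σ R 0) := by
  refine isNoetherianRing_of_surjective R _
    (algebraMap R (MvPolynomial.homogeneousSubmodule σ R 0)) ?_
  rintro ⟨x, hx⟩
  rw [MvPolynomial.homogeneousSubmodule_zero] at hx
  obtain ⟨a, rfl⟩ := Submodule.mem_one.mp hx
  exact ⟨a, rfl⟩

instance finiteType_homogeneousSubmodule_zero (σ R : Type*) [CommRing R] [Finite σ] :
    Algebra.FiniteType (MvPolynomial.homogeneousSubmodule σ R 0) (MvPolynomial σ R) :=
  have : IsScalarTower R (MvPolynomial.homogeneousSubmodule σ R 0) (MvPolynomial σ R) :=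
    ⟨fun a b c ↦ smul_mul_assoc a b.1 c⟩
  Algebra.FiniteType.of_restrictScalars_finiteType R _ _

section QuasiProjective

variable (k : Type u) [Field k]

instance isNoetherian_projectiveSpace (n : ℕ) : IsNoetherian (projectiveSpace k n) := by
  have := isNoetherianRing_homogeneousSubmodule_zero (Fin (n + 1)) k
  let f : projectiveSpace k n ⟶ _ :=
    Proj.toSpecZero (MvPolynomial.homogeneousSubmodule (Fin (n + 1)) k)
  have : IsProper f :=
    inferInstanceAs (IsProper
      (Proj.toSpecZero (MvPolynomial.homogeneousSubmodule (Fin (n + 1)) k)))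
  have : IsLocallyNoetherian (projectiveSpace k n) := LocallyOfFiniteType.isLocallyNoetherian f
  have : CompactSpace (projectiveSpace k n) := QuasiCompact.compactSpace_of_compactSpace f
  exact {}

instance isSeparated_projectiveSpace (n : ℕ) : (projectiveSpace k n).IsSeparated :=
  inferInstanceAs (Scheme.IsSeparated (Proj (MvPolynomial.homogeneousSubmodule (Fin (n + 1)) k)))

lemma isSeparated_of_hom {X Y : Scheme.{u}} (f : X ⟶ Y) [IsSeparated f] [Y.IsSeparated] :
    X.IsSeparated := by
  rw [Scheme.isSeparated_iff, ← terminal.comp_from f]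
  infer_instance

variable {k} {X : Scheme.{u}} {s : X ⟶ Spec (.of k)} (h : IsQuasiProjectiveVariety k s)
include h

lemma IsQuasiProjectiveVariety.isLocallyNoetherian : IsLocallyNoetherian X := by
  obtain ⟨n, i, hi, -⟩ := h.exists_immersion
  exact LocallyOfFiniteType.isLocallyNoetherian i

lemma IsQuasiProjectiveVariety.noetherianSpace : NoetherianSpace X := by
  obtain ⟨n, i, hi, -⟩ := h.exists_immersion
  exact i.isEmbedding.isInducing.noetherianSpace

lemma IsQuasiProjectiveVariety.isSeparated : X.IsSeparated := by
  obtain ⟨n, i, hi, -⟩ := h.exists_immersion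
  exact isSeparated_of_hom i

end QuasiProjective

/-! ### Cohomological dimension of strata -/

lemma sectionsLocalize_unit (X : Scheme.{u}) :
    SectionsLocalize (X := X) (SheafOfModules.unit X.ringCatSheaf) := by
  refine ⟨fun {U} hU f V hV h s ↦ ?_, fun {U} hU f V hV h t ht ↦ ?_⟩
  · subst hV
    have := IsAffineOpen.isLocalization_basicOpen hU f
    obtain ⟨n, a, ha⟩ := IsLocalization.Away.surj (S := Γ(X, X.basicOpen f)) f s
    exact ⟨n, a, ha.symm.trans (mul_comm _ _)⟩
  · subst hV
    have := IsAffineOpen.isLocalization_basicOpen hU f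
    obtain ⟨n, hn⟩ := IsLocalization.Away.exists_of_eq (S := Γ(X, X.basicOpen f)) f
      (show algebraMap Γ(X, U) Γ(X, X.basicOpen f) t = algebraMap Γ(X, U) _ 0 from
        ht.trans (map_zero _).symm)
    exact ⟨n, hn.trans (mul_zero _)⟩

section CohomologicalDimension

variable {Y : Scheme.{u}}

lemma vanishes_top_of_cd_lt {q : ℕ} (hq : cd Y < (q : WithBot ℕ∞)) {G : Y.Modules}
    (hG : SectionsLocalize G) : Vanishes q ⊤ (ab G) := by
  obtain ⟨n, hn, hnq⟩ := sInf_lt_iff.mp hq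
  exact (subsingleton_H_iff_vanishes _ _).mp
    (hn G (sectionsLocalize_iff_isQuasicoherent.mp hG) q hnq)

lemma cd_ne_bot [Nonempty Y] : cd Y ≠ ⊥ := fun h ↦ by
  have vanishes := vanishes_top_of_cd_lt (q := 0) (h ▸ WithBot.bot_lt_coe _)
    (sectionsLocalize_unit Y)
  have hsub : Subsingleton Γ(Y, ⊤) := vanishes_zero_iff.mp vanishes
  have : Nonempty (⊤ : Y.Opens) := ‹Nonempty Y›.map fun y ↦ ⟨y, trivial⟩
  exact not_subsingleton Γ(Y, ⊤) hsub

lemma exists_eq_natCast_of_add_lt {a : WithBot ℕ∞} (ha : a ≠ ⊥) {c t : ℕ}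
    (h : a + ((c : ℕ∞) : WithBot ℕ∞) < (t : WithBot ℕ∞)) :
    ∃ d : ℕ, a = (d : WithBot ℕ∞) ∧ d + c < t := by
  obtain ⟨b, rfl⟩ := WithBot.ne_bot_iff_exists.mp ha
  have hbct : b + c < (t : ℕ∞) := by exact_mod_cast h
  obtain ⟨d, rfl⟩ := ENat.ne_top_iff_exists.mp (show b ≠ ⊤ by rintro rfl; simp at hbct)
  exact ⟨d, rfl, by exact_mod_cast hbct⟩

lemma subsingleton_cohomology_opens {X : Scheme.{u}} [NoetherianSpace X] (U : X.Opens) {t : ℕ}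
    (h : ∀ F : X.Modules, SectionsLocalize F → Vanishes t U (ab F)) (F : U.toScheme.Modules)
    (hF : F.IsQuasicoherent) : Subsingleton (cohomology F t) := by
  have := noetherianSpace_opens U
  let G := (Scheme.Modules.pushforward U.ι).obj F
  have hG : Vanishes t U (ab G) :=
    h G ((sectionsLocalize_iff_isQuasicoherent.mpr hF).pushforward U.ι)
  let e : G.restrict U.ι ≅ F := (Scheme.Modules.restrictFunctorAdjCounitIso U.ι).app F
  refine (subsingleton_H_iff_vanishes (ab F) t).mpr (Vanishes.of_iso ((abF _).mapIso e) ?_)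
  obtain rfl | ht := Nat.eq_zero_or_pos t
  · rw [vanishes_zero_iff] at hG ⊢
    rw [← U.ι_image_top] at hG
    exact hG
  · exact (vanishes_affine_iff_top G ht U).mp hG

end CohomologicalDimension

section Stratum

variable {X : Scheme.{u}} {A B : Closeds X}

lemma mem_support_stratumIdeal (x : (closedCompl B).toScheme) :
    x ∈ (stratumIdeal A B).support ↔ x.1 ∈ A := by
  change x ∈ ((stratumIdeal A B).support : Set _) ↔ _
  rw [stratumIdeal, Scheme.IdealSheafData.coe_support_vanishingIdeal]
  rfl

lemma nonempty_stratum (h : ¬ A ≤ B) : Nonempty (stratum A B) := by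
  obtain ⟨x, hxA, hxB⟩ := Set.not_subset.mp h
  obtain ⟨y, -⟩ := (stratumIdeal A B).range_subschemeι.ge
    ((mem_support_stratumIdeal ⟨x, hxB⟩).mpr hxA)
  exact ⟨y⟩

lemma image_complOpen_stratumIdeal (h : B ≤ A) :
    (closedCompl B).ι ''ᵁ complOpen (stratumIdeal A B) = closedCompl A := by
  ext x
  refine ⟨?_, fun hx ↦ ?_⟩
  · rintro ⟨y, hy, rfl⟩
    exact fun hA ↦ hy ((mem_support_stratumIdeal y).mpr hA)
  · exact ⟨⟨x, fun hB ↦ hx (h hB)⟩, fun hA ↦ hx ((mem_support_stratumIdeal _).mp hA), rfl⟩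

lemma IsLci.exists_isLocallyGeneratedBy (hlci : IsLci A B) (h : ¬ A ≤ B) :
    ∃ c : ℕ, codim ((A : Set X) \ B) = c ∧ IsLocallyGeneratedBy (stratumIdeal A B) c := by
  obtain ⟨x, hxA, hxB⟩ := Set.not_subset.mp h
  obtain ⟨-, -, c, hc, -⟩ := hlci ⟨x, hxB⟩ hxA
  refine ⟨c, hc.symm, fun p hp ↦ ?_⟩
  obtain ⟨V, hpV, c', hc', g, hg⟩ := hlci p ((mem_support_stratumIdeal p).mp hp)
  obtain rfl : c' = c := by exact_mod_cast hc'.trans hc.symm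
  exact ⟨V, hpV, g, hg⟩

lemma closedCompl_top : closedCompl (⊤ : Closeds X) = ⊥ := by
  ext
  simp [closedCompl]

theorem vanishes_closedCompl_of_stratum [NoetherianSpace X] [X.IsSeparated] [IsLocallyNoetherian X]
    (hBA : B ≤ A) (hlci : IsLci A B) {Y : Scheme.{u}} (f : stratum A B ⟶ Y) [hf : IsAffineHom f]
    {t : ℕ} (ht : cd Y + (codim ((A : Set X) \ B) : WithBot ℕ∞) < (t : WithBot ℕ∞))
    {F : X.Modules} (hF : SectionsLocalize F) (hA : Vanishes t (closedCompl A) (ab F)) :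
    Vanishes t (closedCompl B) (ab F) := by
  by_cases hAB : A ≤ B
  · rwa [le_antisymm hBA hAB]
  obtain ⟨c, hc, hI⟩ := hlci.exists_isLocallyGeneratedBy hAB
  have : Nonempty Y := (nonempty_stratum hAB).map f
  rw [hc] at ht
  obtain ⟨d, hd, hdt⟩ := exists_eq_natCast_of_add_lt cd_ne_bot ht
  have := noetherianSpace_opens (closedCompl B)
  have : (closedCompl B).toScheme.IsSeparated := isSeparated_of_hom (closedCompl B).ι
  let f' : (stratumIdeal A B).subscheme ⟶ Y := f
  have : IsAffineHom f' := hf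
  rw [vanishes_affine_iff_top _ (by omega)]
  refine hI.vanishes_top (hF.restrict _) f' (d := d)
    (fun q hq G hG ↦ vanishes_top_of_cd_lt (by rw [hd]; exact_mod_cast hq) hG) hdt ?_
  rwa [vanishes_restrict _ _ (by omega), image_complOpen_stratumIdeal hBA]

end Stratum

end CdLci

end

theorem mainTheorem1_general {X : Scheme.{u}} [NoetherianSpace X] [IsLocallyNoetherian X]
    [X.IsSeparated] {r : ℕ} (hr : 1 ≤ r) (Z : Fin (r + 1) → Closeds X) (hZ : Monotone Z)
    (hZ_last : Z (Fin.last r) = ⊤) (Y : Fin r → Scheme.{u})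
    (hlci : ∀ j : Fin r, 1 ≤ (j : ℕ) → IsLci (Z j.succ) (Z j.castSucc))
    (f : ∀ j : Fin r, 1 ≤ (j : ℕ) → (stratum (Z j.succ) (Z j.castSucc) ⟶ Y j))
    (hf : ∀ j hj, IsAffineHom (f j hj)) :
    cd (closedCompl (Z ⟨1, Nat.lt_succ_of_le hr⟩)).toScheme ≤
      ⨆ (j : Fin r) (_ : 1 ≤ (j : ℕ)),
        (cd (Y j) + (codim ((Z j.succ : Set X) \ Z j.castSucc) : WithBot ℕ∞)) := by
  refine sInf_le fun F hF n hn ↦ subsingleton_cohomology_opens _ (fun G hG ↦ ?_) F hF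
  suffices ∀ j : Fin (r + 1), 1 ≤ (j : ℕ) → Vanishes n (closedCompl (Z j)) (ab G) from
    this ⟨1, _⟩ le_rfl
  intro j
  induction j using Fin.reverseInduction with
  | last =>
    intro _
    rw [hZ_last, closedCompl_top]
    exact vanishes_bot n _
  | cast j ih =>
    intro hj
    have := hf j hj
    exact vanishes_closedCompl_of_stratum (hZ j.castSucc_le_succ) (hlci j hj) (f j hj)
      ((le_iSup₂_of_le j hj le_rfl).trans_lt hn) hG (ih (by simp))

theorem mainTheorem1 (k : Type u) [Field k] [IsAlgClosed k] {X : Scheme.{u}}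
    (s : X ⟶ Spec (.of k)) (hX : IsQuasiProjectiveVariety k s)
    {r : ℕ} (hr : 1 ≤ r) (Z : Fin (r + 1) → Closeds X)
    (Y : Fin r → Scheme.{u}) (t : ∀ j, Y j ⟶ Spec (.of k))
    (h : IsLciAffineBundleStratification k s Z Y t) :
    cd (closedCompl (Z ⟨1, Nat.lt_succ_of_le hr⟩)).toScheme ≤
      ⨆ (j : Fin r) (_ : 1 ≤ (j : ℕ)),
        (cd (Y j) + (codim ((Z j.succ : Set X) \ Z j.castSucc) : WithBot ℕ∞)) := by
  have := hX.noetherianSpace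
  have := hX.isLocallyNoetherian
  have := hX.isSeparated
  choose f _ hf using h.exists_isAffineHom
  exact mainTheorem1_general hr Z h.monotone h.eq_top Y h.isLci (fun j _ ↦ f j) fun j _ ↦ hf j
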